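/- Let $\mu,\nu$ be Borel probability measures on $\mathbb R$ with finite first moments and $\mu\le_{cx}\nu$ (convex order: $\int f\,d\mu\le\int f\,d\nu$ for all convex $f$). For a finite measure $\eta$ with finite first moment let $P_\eta(k)=\int (k-x)^+\,\eta(dx)$, and put $D=P_\nu-P_\mu$. Let $G$ be the left-continuous quantile function of $\mu$, and for $u\in(0,1)$ let $$\mu_u=\mu|_{(-\infty,G(u))}+\bigl(u-\mu((-\infty,G(u)))\bigr)\delta_{G(u)},\qquad \mathcal E_u=P_\nu-P_{\mu_u},$$ let $\mathcal E_u^c$ be the largest convex function below $\mathcal E_u$, and $\phi(u)=\inf\partial\mathcal E_u^c(G(u))$, where $\partial$ is the subdifferential. Define $$S(u)=\inf\{z\ge G(u):\mathcal E_u^c(z)=\mathcal E_u(z)\},$$ $$R(u)=\inf\{k\le G(u): D(k)=\mathcal E_u^c(G(u))+\phi(u)(k-G(u))\}.$$ Let $J$ be the set of those $u\in(0,1)$ for which $R(u)$ is a real number, i.e. the last set is non-empty and bounded below; for other $u$ put $R(u)=0$. Let $Y(u,v)=G(u)$ if $R(u)=S(u)$, and otherwise $Y(u,v)=R(u)$ if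 $v\le\frac{S(u)-G(u)}{S(u)-R(u)}$ and $Y(u,v)=S(u)$ if $v>\frac{S(u)-G(u)}{S(u)-R(u)}$. A shadow of $\eta$ in $\nu$ is a measure $S^\nu(\eta)\le\nu$ with $\eta\le_{cx}S^\nu(\eta)$ such that $S^\nu(\eta)\le_{cx}\theta$ for every $\theta$ with $\eta\le_{cx}\theta\le\nu$. The lifted left-curtain coupling of $\mu,\nu$ is the measure $\hat\pi(du,dx,dy)$ whose $(u,x)$-marginal is the quantile lift $\hat\mu(du,dx)=du\,\delta_{G(u)}(dx)$ on $(0,1)\times\mathbb R$, whose $y$-marginal is $\nu$, which disintegrates as $\hat\mu(du,dx)\,\hat\pi_{u,x}(dy)$ with probability measures satisfying $\int y\,\hat\pi_{u,x}(dy)=x$ for $\hat\mu$-a.e. $(u,x)$, and which satisfies $\hat\pi([0,u]\times A\times\mathbb R)=\mu_u(A)$ and $\hat\pi([0,u]\times\mathbb R\times B)=S^\nu(\mu_u)(B)$ for all $u\in(0,1)$ and Borel $A,B$. The left-curtain coupling is the martingale coupling $\pi$ of $\mu$ and $\nu$ such that for each $x\in\mathbb R$ the marginals of $\pi|_{(-\infty,x]\times\mathbb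 R}$ are $\mu|_{(-\infty,x]}$ and $S^\nu(\mu|_{(-\infty,x]})$. **Theorem.** Let $U,V$ be independent uniform random variables with values in $(0,1)$ on a probability space, and put $X=G(U)$, $Y=Y(U,V)$. 1. $S(u)$ is real for every $u\in(0,1)$. If the pair is irreducible, i.e. $\{D>0\}$ is an interval and $\mu(\{D>0\})=1$, then $J=(0,1)$. In general, $S(u)=G(u)$ for all but countably many $u\in(0,1)\setminus J$ (so that then $Y(u,v)=G(u)$). 2. $(R,S)$ is left-monotone with respect to $G$ on $J$: $R\le G\le S$ on $J$, and for $u<u'$ in $J$ one has $S(u)\le S(u')$ and $R(u')\notin(R(u),S(u))$. 3. $\bigl(\int x\,\mu(dx),X,Y\bigr)$ is a martingale for the filtration $(\{\emptyset,\Omega\},\sigma(U),\sigma(U,V))$, with $X\sim\mu$ and $Y\sim\nu$. 4. The law of $(U,X,Y)$ is the lifted left-curtain coupling of $\mu$ and $\nu$ (it has the defining properties and is the only measure that has them), and the law of $(X,Y)$ is likewise the left-curtain coupling of $\mu$ and $\nu$. -/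

import Mathlib

open MeasureTheory ProbabilityTheory Set

noncomputable section

namespace LeftCurtain

/-! ### Convex order and shadow measure -/

/-- The convex order `η ≤_cx χ` between finite measures on `ℝ` with finite first moment.  A convex
function is bounded below by an affine function, so that its integral always makes sense in
`(-∞, ∞]`.  If it is not `χ`-integrable its `χ`-integral is `∞` and nothing is required. -/
def ConvexOrder (η χ : Measure ℝ) : Prop :=
  ∀ f : ℝ → ℝ, ConvexOn ℝ univ f → Integrable f χ →
    Integrable f η ∧ ∫ x, f x ∂η ≤ ∫ x, f x ∂χ

/-- `θ` is the shadow of `η` in `χ`: the least measure, for the convex order, among the measures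
between `η` (in convex order) and `χ` (setwise). -/
def IsShadow (η χ θ : Measure ℝ) : Prop :=
  θ ≤ χ ∧ ConvexOrder η θ ∧ ∀ θ' : Measure ℝ, ConvexOrder η θ' → θ' ≤ χ → ConvexOrder θ θ'

/-! ### Potentials, quantiles, convex hulls -/

/-- The modified potential `P_η(k) = ∫ (k - x)⁺ η(dx)`. -/
def potential (η : Measure ℝ) (k : ℝ) : ℝ := ∫ x, max (k - x) 0 ∂η

/-- `D = P_ν - P_μ`. -/
def potDiff (μ ν : Measure ℝ) (k : ℝ) : ℝ := potential ν k - potential μ k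

/-- The left-continuous quantile function of `μ` (meaningful on `(0,1)`). -/
def quantile (μ : Measure ℝ) (u : ℝ) : ℝ := sInf {x : ℝ | u ≤ μ.real (Iic x)}

/-- `μ_u`: the left-most part of `μ` of total mass `u`, for `0 < u < 1`. -/
def leftPart (μ : Measure ℝ) (u : ℝ) : Measure ℝ :=
  μ.restrict (Iio (quantile μ u)) +
    ENNReal.ofReal (u - μ.real (Iio (quantile μ u))) • Measure.dirac (quantile μ u)

/-- `f^c`: the largest convex function below `f` (for `f` that has a convex minorant). -/
def convexHullFn (f : ℝ → ℝ) (y : ℝ) : ℝ :=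
  sSup {a : ℝ | ∃ h : ℝ → ℝ, ConvexOn ℝ univ h ∧ (∀ x, h x ≤ f x) ∧ h y = a}

/-- The subdifferential of `f` at `x`. -/
def subdiff (f : ℝ → ℝ) (x : ℝ) : Set ℝ := {ψ : ℝ | ∀ y, f x + ψ * (y - x) ≤ f y}

/-! ### The geometric construction -/

/-- `𝓔_u = P_ν - P_{μ_u}`. -/
def excess (μ ν : Measure ℝ) (u k : ℝ) : ℝ := potential ν k - potential (leftPart μ u) k

/-- `𝓔_u^c`. -/
def excessHull (μ ν : Measure ℝ) (u : ℝ) : ℝ → ℝ := convexHullFn (excess μ ν u)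

/-- `φ(u)`: the smallest subgradient of `𝓔_u^c` at `G(u)`. -/
def slope (μ ν : Measure ℝ) (u : ℝ) : ℝ := sInf (subdiff (excessHull μ ν u) (quantile μ u))

/-- The set `{z ≥ G(u) : 𝓔_u^c(z) = 𝓔_u(z)}`, whose infimum is `S(u)`. -/
def upperSet (μ ν : Measure ℝ) (u : ℝ) : Set ℝ :=
  {z : ℝ | quantile μ u ≤ z ∧ excessHull μ ν u z = excess μ ν u z}

/-- The upper function `S`. -/
def upperFn (μ ν : Measure ℝ) (u : ℝ) : ℝ := sInf (upperSet μ ν u)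

/-- The set of those `k ≤ G(u)` at which `D` meets the line of slope `φ(u)` through
`(G(u), 𝓔_u^c(G(u)))`. Its infimum is `R(u)`. -/
def lowerSet (μ ν : Measure ℝ) (u : ℝ) : Set ℝ :=
  {k : ℝ | k ≤ quantile μ u ∧ potDiff μ ν k =
    excessHull μ ν u (quantile μ u) + slope μ ν u * (k - quantile μ u)}

/-- The lower function `R`. -/
def lowerFn (μ ν : Measure ℝ) (u : ℝ) : ℝ := sInf (lowerSet μ ν u)

/-- The set of the `u ∈ (0,1)` for which the infimum that defines `R(u)` is a real number. -/
def lowerDomain (μ ν : Measure ℝ) : Set ℝ :=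
  {u : ℝ | u ∈ Ioo (0 : ℝ) 1 ∧ (lowerSet μ ν u).Nonempty ∧ BddBelow (lowerSet μ ν u)}

/-- `(f, h)` is left-monotone with respect to `g` on `I`. -/
def LeftMonotoneOn (g f h : ℝ → ℝ) (I : Set ℝ) : Prop :=
  (∀ x ∈ I, f x ≤ g x ∧ g x ≤ h x) ∧
  ∀ x ∈ I, ∀ x' ∈ I, x < x' → h x ≤ h x' ∧ f x' ∉ Ioo (f x) (h x)

open Classical in
/-- `Y(u,v)`: the choice between `R(u)` and `S(u)` with the martingale probabilities. -/
def target (μ ν : Measure ℝ) (u v : ℝ) : ℝ :=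
  if lowerFn μ ν u = upperFn μ ν u then quantile μ u
  else if v ≤ (upperFn μ ν u - quantile μ u) / (upperFn μ ν u - lowerFn μ ν u)
    then lowerFn μ ν u else upperFn μ ν u

/-! ### The martingale -/

/-- The filtration `({∅, Ω}, σ(U), σ(U,V))`. -/
def twoStepFiltration {Ω : Type*} [mΩ : MeasurableSpace Ω] (U V : Ω → Ioo (0 : ℝ) 1)
    (hU : Measurable U) (hV : Measurable V) : Filtration (Fin 3) mΩ where
  seq := ![⊥, MeasurableSpace.comap U inferInstance,
    MeasurableSpace.comap (fun ω => (U ω, V ω)) inferInstance]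
  mono' := by
    have h : MeasurableSpace.comap U inferInstance ≤
        MeasurableSpace.comap (fun ω => (U ω, V ω)) inferInstance := by
      rintro s ⟨t, ht, rfl⟩
      exact ⟨Prod.fst ⁻¹' t, measurable_fst ht, rfl⟩
    intro i j hij
    fin_cases i <;> fin_cases j <;> simp_all
  le' := by
    intro i
    fin_cases i
    · exact bot_le
    · exact hU.comap_le
    · exact (hU.prodMk hV).comap_le

/-- The three-step process `(mean of μ, X, Y)` with `X = G(U)` and `Y = Y(U,V)`. -/
def curtainProcess {Ω : Type*} (μ ν : Measure ℝ) (U V : Ω → Ioo (0 : ℝ) 1) : Fin 3 → Ω → ℝ :=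
  ![fun _ => ∫ x, x ∂μ, fun ω => quantile μ (U ω), fun ω => target μ ν (U ω) (V ω)]

/-! ### The left-curtain coupling and its lifted version -/

/-- The quantile lift `du δ_{G(u)}(dx)` of `μ`. -/
def quantileLift (μ : Measure ℝ) : Measure (ℝ × ℝ) :=
  (volume.restrict (Ioo (0 : ℝ) 1)).map (fun u => (u, quantile μ u))

/-- `π`, a measure in the variables `((u, x), y)`, is the lifted left-curtain coupling of `μ` and
`ν`: a lifted martingale transport plan from the quantile lift of `μ` to `ν` that transports
each `μ_u` to the shadow of `μ_u` in `ν`. (For `u = 0` and `u = 1` the last clause is automatic.) -/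
def IsLiftedLeftCurtain (μ ν : Measure ℝ) (π : Measure ((ℝ × ℝ) × ℝ)) : Prop :=
  π.fst = quantileLift μ ∧ π.snd = ν ∧
  (∃ κ : Kernel (ℝ × ℝ) ℝ, IsMarkovKernel κ ∧ π = (quantileLift μ).compProd κ ∧
    ∀ᵐ p ∂(quantileLift μ), Integrable (fun y : ℝ => y) (κ p) ∧ ∫ y, y ∂(κ p) = p.2) ∧
  ∀ u ∈ Ioo (0 : ℝ) 1,
    (∀ A : Set ℝ, MeasurableSet A → π ((Icc 0 u ×ˢ A) ×ˢ univ) = leftPart μ u A) ∧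
    IsShadow (leftPart μ u) ν (π.restrict ((Icc 0 u ×ˢ univ) ×ˢ univ)).snd

/-- `π` is the left-curtain coupling of `μ` and `ν`: a martingale coupling that for each `x`
transports `μ|_(-∞,x]` to its shadow in `ν`. -/
def IsLeftCurtain (μ ν : Measure ℝ) (π : Measure (ℝ × ℝ)) : Prop :=
  π.fst = μ ∧ π.snd = ν ∧
  (∀ B : Set ℝ, MeasurableSet B → ∫ p in B ×ˢ univ, p.2 ∂π = ∫ x in B, x ∂μ) ∧
  ∀ x : ℝ,
    (π.restrict (Iic x ×ˢ univ)).fst = μ.restrict (Iic x) ∧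
    IsShadow (μ.restrict (Iic x)) ν (π.restrict (Iic x ×ˢ univ)).snd

end LeftCurtain

end

/-! The potential of the shadow of `μ_u` in `ν` is `P_ν - 𝓔_u^c`. So everything reduces to showing
that, for each fixed `k`, the function `u ↦ 𝓔_u^c(k)` decreases at the rate `p_k(u) = ∫ (k -
Y(u,v))⁺ dv`, the potential at `k` of the fibre law at `u` (`targetPotential`).

Geometry at one level: the supporting line of smallest slope at `G(u)` touches `𝓔_u` on the right of
`G(u)`, and also on the left unless its slope is `0`. Between `R(u)` and `S(u)` the hull is this
line, and beyond `S(u)` it equals `𝓔_u`, which is convex there. If `R(u)` is not real, then `𝓔_u^c`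
vanishes up to `S(u)`. This forces `S(u) ≤ G(u')` for all `u' > u`, so the nonempty intervals
`(G(u), S(u))` of such levels are disjoint, hence countable in number.

Two levels `u < u'`: the difference `𝓔_u - 𝓔_{u'}` is convex, increasing and squeezed between
`(u'-u)(k-G(u'))⁺` and `(u'-u)(k-G(u))⁺`. Convexity makes contact points of hull and function
persist when the level decreases, which gives the left-monotonicity. The squeeze gives
`(u'-u)(p_k(u) - ΔG) ≤ 𝓔_u^c(k) - 𝓔_{u'}^c(k) ≤ (u'-u)(p_k(u') + ΔG)`, with `ΔG = G(u') - G(u)`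
(`mul_sub_le_hull_sub_hull`, `hull_sub_hull_le_mul`). No derivative in `u` is needed: as `G` is
monotone the errors telescope over a partition, and `integral_eq_sub_of_increment_bounds` integrates
these bounds.

The hull tends to `P_ν(k)` as `u → 0` and to `0` as `u → 1`. Therefore `∫_0^u p_k = P_ν(k) -
𝓔_u^c(k)` and `∫_0^1 p_k = P_ν(k)`. Since potentials determine measures, `Y` has law `ν`, and `Y`
restricted to `U ≤ u` has the shadow of `μ_u` as its law. The martingale property is the choice of
the two-point probabilities. Shadows are unique and fix the coupling on all sets `{U ≤ a, Y ∈ B}`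
(or `{X ≤ a, Y ∈ B}`), whence uniqueness. -/

namespace LeftCurtain

open Filter Topology

/-! ### Convex functions on the line -/

/-- Denominators are cleared so that chord bounds combine linearly and `a = b` is allowed. -/
theorem three_point_le {f : ℝ → ℝ} (hf : ConvexOn ℝ univ f) {a k b : ℝ}
    (hak : a ≤ k) (hkb : k ≤ b) : f k * (b - a) ≤ f a * (b - k) + f b * (k - a) := by
  rcases eq_or_lt_of_le (hak.trans hkb) with rfl | hab
  · obtain rfl : k = a := le_antisymm hkb hak
    simp
  · have hpos : 0 < b - a := sub_pos.2 hab
    have h := hf.2 (mem_univ a) (mem_univ b)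
      (div_nonneg (sub_nonneg.2 hkb) hpos.le) (div_nonneg (sub_nonneg.2 hak) hpos.le)
      (by field_simp; ring)
    simp only [smul_eq_mul] at h
    have hk : (b - k) / (b - a) * a + (k - a) / (b - a) * b = k := by field_simp; ring
    rw [hk] at h
    calc f k * (b - a) ≤ ((b - k) / (b - a) * f a + (k - a) / (b - a) * f b) * (b - a) :=
          mul_le_mul_of_nonneg_right h hpos.le
      _ = f a * (b - k) + f b * (k - a) := by field_simp

theorem exists_mem_subdiff {f : ℝ → ℝ} (hf : ConvexOn ℝ univ f) (x : ℝ) :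
    (subdiff f x).Nonempty := by
  have hx : x ∈ interior (univ : Set ℝ) := by simp
  refine ⟨derivWithin f (Ioi x) x, fun y => ?_⟩
  rcases lt_trichotomy x y with h | rfl | h
  · have := hf.rightDeriv_le_slope_of_mem_interior hx (mem_univ y) h
    rw [slope_def_field, le_div_iff₀ (sub_pos.2 h)] at this
    linarith
  · simp
  · have h1 := hf.slope_le_leftDeriv_of_mem_interior (mem_univ y) hx h
    have h2 := hf.leftDeriv_le_rightDeriv_of_mem_interior hx
    have := h1.trans h2
    rw [slope_def_field, div_le_iff₀ (sub_pos.2 h)] at this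
    linarith

theorem subdiff_mono {f : ℝ → ℝ} {x y p q : ℝ} (hxy : x < y) (hp : p ∈ subdiff f x)
    (hq : q ∈ subdiff f y) : p ≤ q := by
  have h1 := hp y
  have h2 := hq x
  nlinarith

theorem isClosed_subdiff (f : ℝ → ℝ) (x : ℝ) : IsClosed (subdiff f x) := by
  have : subdiff f x = ⋂ y, {p : ℝ | f x + p * (y - x) ≤ f y} := by
    ext p; simp [subdiff]
  rw [this]
  exact isClosed_iInter fun y => isClosed_le (by fun_prop) continuous_const

theorem convexOn_affine (a b x₀ : ℝ) : ConvexOn ℝ univ fun x => a + b * (x - x₀) := by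
  refine ⟨convex_univ, fun x _ y _ s t _ _ hst => le_of_eq ?_⟩
  simp only [smul_eq_mul]
  obtain rfl : t = 1 - s := by linarith
  ring

theorem continuous_of_convexOn {f : ℝ → ℝ} (hf : ConvexOn ℝ univ f) : Continuous f :=
  continuousOn_univ.1 (hf.continuousOn isOpen_univ)

/-! ### Integration from two-sided increment bounds -/

/-- Over a partition into `n` equal pieces the increments of `m` telescope, so the total change of
`H` is at most `(b - a) / n * (m b - m a)`, which tends to `0`. The hypothesis itself makes `m`
monotone on `[a, b]`. -/
theorem eq_of_abs_sub_le_mul {a b : ℝ} (hab : a ≤ b) {H m : ℝ → ℝ}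
    (h : ∀ x ∈ Icc a b, ∀ y ∈ Icc a b, x < y → |H y - H x| ≤ (y - x) * (m y - m x)) :
    H b = H a := by
  rcases eq_or_lt_of_le hab with rfl | hab'
  · rfl
  have key : ∀ n : ℕ, 0 < n → |H b - H a| ≤ (b - a) / n * (m b - m a) := by
    intro n hn
    have hn' : (0 : ℝ) < n := by exact_mod_cast hn
    set t : ℕ → ℝ := fun i => a + i * ((b - a) / n) with ht
    have hstep : 0 < (b - a) / n := div_pos (sub_pos.2 hab') hn'
    have htm : ∀ i ≤ n, t i ∈ Icc a b := by
      intro i hi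
      have hi' : (i : ℝ) ≤ n := by exact_mod_cast hi
      refine ⟨by simp only [ht]; nlinarith [(Nat.cast_nonneg i : (0 : ℝ) ≤ i)], ?_⟩
      calc t i ≤ a + n * ((b - a) / n) := by simp only [ht]; gcongr
        _ = b := by field_simp; ring
    have h0 : t 0 = a := by simp [ht]
    have hnb : t n = b := by simp only [ht]; field_simp; ring
    have hdiff : ∀ i, t (i + 1) - t i = (b - a) / n := fun i => by
      simp only [ht]; push_cast; ring
    calc |H b - H a| = |∑ i ∈ Finset.range n, (H (t (i + 1)) - H (t i))| := by
          rw [Finset.sum_range_sub (fun i => H (t i)), h0, hnb]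
      _ ≤ ∑ i ∈ Finset.range n, |H (t (i + 1)) - H (t i)| := Finset.abs_sum_le_sum_abs _ _
      _ ≤ ∑ i ∈ Finset.range n, (b - a) / n * (m (t (i + 1)) - m (t i)) := by
          refine Finset.sum_le_sum fun i hi => ?_
          have hi' := Finset.mem_range.1 hi
          have := h _ (htm i hi'.le) _ (htm (i + 1) hi') (by linarith [hdiff i])
          rwa [hdiff i] at this
      _ = (b - a) / n * (m b - m a) := by
          rw [← Finset.mul_sum, Finset.sum_range_sub (fun i => m (t i)), h0, hnb]
  have hzero : |H b - H a| ≤ 0 := by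
    refine le_of_forall_pos_le_add fun ε hε => ?_
    obtain ⟨n, hn⟩ := exists_nat_gt (max 0 ((b - a) * (m b - m a) / ε))
    have hn0 : (0 : ℝ) < n := (le_max_left _ _).trans_lt hn
    have := key n (by exact_mod_cast hn0)
    have h2 := (le_max_right _ _).trans_lt hn
    rw [div_lt_iff₀ hε] at h2
    have : (b - a) / n * (m b - m a) ≤ ε := by
      rw [div_mul_eq_mul_div, div_le_iff₀ hn0]; linarith
    linarith
  have := abs_nonpos_iff.1 hzero
  linarith

/-- A version of the fundamental theorem of calculus, for functions whose increments are controlled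
by a function which differs from a monotone one by a monotone one. -/
theorem integral_eq_sub_of_increment_bounds {a b : ℝ} (hab : a ≤ b) {f p g : ℝ → ℝ}
    (hg : MonotoneOn g (Icc a b))
    (hlow : ∀ x ∈ Icc a b, ∀ y ∈ Icc a b, x < y → (y - x) * (p x - (g y - g x)) ≤ f y - f x)
    (hup : ∀ x ∈ Icc a b, ∀ y ∈ Icc a b, x < y → f y - f x ≤ (y - x) * (p y + (g y - g x))) :
    IntervalIntegrable p volume a b ∧ ∫ x in a..b, p x = f b - f a := by
  -- The two bounds together give `p x - Δg ≤ p y + Δg`. So `p` is a difference of monotone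
  -- functions, hence integrable.
  have hm : MonotoneOn (fun x => p x + 2 * g x) (Icc a b) := by
    intro x hx y hy hxy
    rcases eq_or_lt_of_le hxy with rfl | hlt
    · rfl
    have := (hlow x hx y hy hlt).trans (hup x hx y hy hlt)
    have := le_of_mul_le_mul_left this (sub_pos.2 hlt)
    simp only; linarith
  have hint : ∀ x ∈ Icc a b, ∀ y ∈ Icc a b, x ≤ y → IntervalIntegrable p volume x y := by
    intro x hx y hy hxy
    have hsub : uIcc x y ⊆ Icc a b := by
      rw [uIcc_of_le hxy]; exact Icc_subset_Icc hx.1 hy.2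
    have h1 := (hm.mono hsub).intervalIntegrable (μ := volume)
    have h2 := ((hg.mono hsub).intervalIntegrable (μ := volume)).const_mul 2
    refine (h1.sub h2).congr ?_
    exact fun t _ => by simp
  refine ⟨hint a (left_mem_Icc.2 hab) b (right_mem_Icc.2 hab) hab, ?_⟩
  -- The increments of `f` are within `Δg` of the bounds by `p x` and `p y`, those of the integral
  -- within `2 Δg`; the constant `3` is their sum.
  have hH := eq_of_abs_sub_le_mul hab (H := fun y => f y - ∫ t in a..y, p t)
    (m := fun x => p x + 3 * g x) ?_
  · simp only [intervalIntegral.integral_same] at hH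
    linarith
  · intro x hx y hy hxy
    have ha := left_mem_Icc.2 hab
    have hsplit := intervalIntegral.integral_interval_sub_left
      (hint a ha y hy hy.1) (hint a ha x hx hx.1)
    have hxyi := hint x hx y hy hxy.le
    have hptm : ∀ t ∈ Icc x y, t ∈ Icc a b := fun t ht => ⟨hx.1.trans ht.1, ht.2.trans hy.2⟩
    have hub : ∫ t in x..y, p t ≤ (y - x) * (p y + 2 * g y - 2 * g x) := by
      have := intervalIntegral.integral_mono_on hxy.le hxyi
        (intervalIntegrable_const (c := p y + 2 * g y - 2 * g x)) (fun t ht => by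
          have h1 := hm (hptm t ht) hy ht.2
          have h2 := hg hx (hptm t ht) ht.1
          simp only at h1; linarith)
      simpa only [intervalIntegral.integral_const, smul_eq_mul] using this
    have hlb : (y - x) * (p x + 2 * g x - 2 * g y) ≤ ∫ t in x..y, p t := by
      have := intervalIntegral.integral_mono_on hxy.le
        (intervalIntegrable_const (c := p x + 2 * g x - 2 * g y)) hxyi (fun t ht => by
          have h1 := hm hx (hptm t ht) ht.1
          have h2 := hg (hptm t ht) hy ht.2
          simp only at h1; linarith)
      simpa only [intervalIntegral.integral_const, smul_eq_mul] using this
    have e1 := hlow x hx y hy hxy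
    have e2 := hup x hx y hy hxy
    rw [abs_le]
    constructor <;> nlinarith

/-! ### The largest convex minorant -/

/-- The minorant `h` makes the set of values nonempty; otherwise the supremum would be the default
value `0`. -/
theorem convexHullFn_le {f h : ℝ → ℝ} (hh : ConvexOn ℝ univ h) (hf : ∀ x, h x ≤ f x) (y : ℝ) :
    convexHullFn f y ≤ f y := by
  refine csSup_le ⟨_, h, hh, hf, rfl⟩ ?_
  rintro _ ⟨h', -, hle, rfl⟩
  exact hle y

theorem le_convexHullFn {f h : ℝ → ℝ} (hh : ConvexOn ℝ univ h) (hf : ∀ x, h x ≤ f x) (y : ℝ) :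
    h y ≤ convexHullFn f y := by
  refine le_csSup ⟨f y, ?_⟩ ⟨h, hh, hf, rfl⟩
  rintro _ ⟨h', -, hle, rfl⟩
  exact hle y

theorem convexOn_convexHullFn {f h : ℝ → ℝ} (hh : ConvexOn ℝ univ h) (hf : ∀ x, h x ≤ f x) :
    ConvexOn ℝ univ (convexHullFn f) := by
  refine ⟨convex_univ, fun x _ y _ s t hs ht hst => csSup_le ⟨_, h, hh, hf, rfl⟩ ?_⟩
  rintro _ ⟨h', hc, hle, rfl⟩
  refine (hc.2 (mem_univ x) (mem_univ y) hs ht hst).trans ?_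
  simp only [smul_eq_mul]
  have h1 := le_convexHullFn hc hle x
  have h2 := le_convexHullFn hc hle y
  gcongr

end LeftCurtain

namespace LeftCurtain

open Filter Topology

/-! ### The shape of the functions `𝓔_u` -/

/-- The properties of `E = 𝓔_u`, with `G = G(u)` and `σ = 1 - u`, from which the geometric
construction is derived. -/
structure ExcessShape (E : ℝ → ℝ) (G σ : ℝ) : Prop where
  nonneg : ∀ x, 0 ≤ E x
  cont : Continuous E
  tendsto_atBot : Tendsto E atBot (𝓝 0)
  subgrad : ∀ x, G ≤ x → ∃ p, ∀ y, G ≤ y → E x + p * (y - x) ≤ E y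
  coercive : ∀ s < σ, Tendsto (fun x => E x - s * x) atTop atTop
  pos : 0 < σ
  line_le : ∀ c s, σ ≤ s → (∀ x, G ≤ x → c + s * (x - G) ≤ E x) → c ≤ 0

namespace ExcessShape

variable {E : ℝ → ℝ} {G σ : ℝ}

theorem hull_le (h : ExcessShape E G σ) (x : ℝ) : convexHullFn E x ≤ E x :=
  convexHullFn_le (convexOn_const 0 convex_univ) h.nonneg x

theorem hull_nonneg (h : ExcessShape E G σ) (x : ℝ) : 0 ≤ convexHullFn E x :=
  le_convexHullFn (convexOn_const 0 convex_univ) h.nonneg x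

theorem hull_convexOn (h : ExcessShape E G σ) : ConvexOn ℝ univ (convexHullFn E) :=
  convexOn_convexHullFn (convexOn_const 0 convex_univ) h.nonneg

theorem line_le_hull {a b x₀ : ℝ} (hle : ∀ x, a + b * (x - x₀) ≤ E x) (x : ℝ) :
    a + b * (x - x₀) ≤ convexHullFn E x :=
  le_convexHullFn (convexOn_affine a b x₀) hle x

theorem hull_continuous (h : ExcessShape E G σ) : Continuous (convexHullFn E) :=
  continuous_of_convexOn h.hull_convexOn

/-- A supporting line of negative slope would rise towards `-∞`, where `E` tends to `0`. -/
theorem subdiff_nonneg (h : ExcessShape E G σ) {x p : ℝ} (hp : p ∈ subdiff (convexHullFn E) x) :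
    0 ≤ p := by
  by_contra! hneg
  have h1 : ∀ᶠ y in atBot, E y < 1 := h.tendsto_atBot.eventually (gt_mem_nhds one_pos)
  obtain ⟨y, hy1, hy2⟩ := (h1.and (eventually_le_atBot (x + 1 / p))).exists
  have h2 := (hp y).trans (h.hull_le y)
  have h3 := h.hull_nonneg x
  have h4 : p * (1 / p) ≤ p * (y - x) := mul_le_mul_of_nonpos_left (by linarith) hneg.le
  have h5 : p * (1 / p) = 1 := mul_one_div_cancel hneg.ne
  linarith

theorem hull_mono (h : ExcessShape E G σ) : Monotone (convexHullFn E) := by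
  intro x y hxy
  obtain ⟨p, hp⟩ := exists_mem_subdiff h.hull_convexOn x
  have := hp y
  have h0 := h.subdiff_nonneg hp
  nlinarith [mul_nonneg h0 (sub_nonneg.2 hxy)]

theorem slope_mem (h : ExcessShape E G σ) :
    sInf (subdiff (convexHullFn E) G) ∈ subdiff (convexHullFn E) G :=
  (isClosed_subdiff _ _).csInf_mem (exists_mem_subdiff h.hull_convexOn G)
    ⟨0, fun _ hp => h.subdiff_nonneg hp⟩

theorem slope_le (h : ExcessShape E G σ) {p : ℝ} (hp : p ∈ subdiff (convexHullFn E) G) :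
    sInf (subdiff (convexHullFn E) G) ≤ p :=
  csInf_le ⟨0, fun _ hp => h.subdiff_nonneg hp⟩ hp

theorem slope_nonneg (h : ExcessShape E G σ) : 0 ≤ sInf (subdiff (convexHullFn E) G) :=
  h.subdiff_nonneg h.slope_mem

/-- With a slope of at least `σ`, `line_le` would make the hull vanish at `G`. Then `0` would be a
subgradient there, and the smallest one would not be positive. -/
theorem slope_lt (h : ExcessShape E G σ) : sInf (subdiff (convexHullFn E) G) < σ := by
  by_contra! hge
  have h0 : convexHullFn E G ≤ 0 :=
    h.line_le _ _ hge fun x _ => (h.slope_mem x).trans (h.hull_le x)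
  have hmem : (0 : ℝ) ∈ subdiff (convexHullFn E) G := fun y => by
    have := h.hull_nonneg y
    linarith
  have := h.slope_le hmem
  linarith [h.pos]

/-- The supporting line of smallest slope at `G`. -/
theorem line_le_hull_apply (h : ExcessShape E G σ) (x : ℝ) :
    convexHullFn E G + sInf (subdiff (convexHullFn E) G) * (x - G) ≤ convexHullFn E x :=
  h.slope_mem x

/-- Without contact on `[G, ∞)` there is by continuity none on some `[a, ∞)` with `a < G`. Since the
slope is less than `σ`, the line can be rotated slightly upwards about its point over `a` and stays
below `E`. The rotated line exceeds the hull at `G`. -/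
theorem exists_touch_right (h : ExcessShape E G σ) :
    ∃ z, G ≤ z ∧ E z = convexHullFn E G + sInf (subdiff (convexHullFn E) G) * (z - G) := by
  by_contra! hne
  set p := sInf (subdiff (convexHullFn E) G) with hp
  set c := convexHullFn E G with hc
  have hle : ∀ x, c + p * (x - G) ≤ E x := fun x => (h.slope_mem x).trans (h.hull_le x)
  have hpos : ∀ x, G ≤ x → 0 < E x - (c + p * (x - G)) := fun x hx =>
    sub_pos.2 (lt_of_le_of_ne (hle x) (Ne.symm (hne x hx)))
  have hcont : Continuous fun x => E x - (c + p * (x - G)) := by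
    have := h.cont
    fun_prop
  obtain ⟨η, hη, hball⟩ := Metric.eventually_nhds_iff.1
    (hcont.continuousAt.eventually (lt_mem_nhds (hpos G le_rfl)))
  obtain ⟨a, haG, hapos⟩ : ∃ a, a < G ∧ ∀ x, a ≤ x → 0 < E x - (c + p * (x - G)) := by
    refine ⟨G - η / 2, by linarith, fun x hx => ?_⟩
    rcases le_or_gt G x with hGx | hGx
    · exact hpos x hGx
    · exact hball (by rw [Real.dist_eq, abs_lt]; constructor <;> linarith)
  have hσ : p < σ := h.slope_lt
  -- The threshold says exactly that `E` lies above the line of slope `(p + σ) / 2` through the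
  -- pivot `(a, c + p * (a - G))`.
  have hev := (h.coercive ((p + σ) / 2) (by linarith)).eventually_ge_atTop
    (c - p * G - (σ - p) / 2 * a)
  obtain ⟨N, hN⟩ := eventually_atTop.1 (hev.and (eventually_gt_atTop a))
  have haN : a < N := (hN N le_rfl).2
  obtain ⟨x₀, hx₀, hmin⟩ := (isCompact_Icc (a := a) (b := N)).exists_isMinOn
    (nonempty_Icc.2 haN.le) hcont.continuousOn
  set ε := E x₀ - (c + p * (x₀ - G)) with hε
  have hεpos : 0 < ε := hapos x₀ hx₀.1
  set δ := min ((σ - p) / 2) (ε / (N - a)) with hδ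
  have hδpos : 0 < δ := lt_min (by linarith) (div_pos hεpos (sub_pos.2 haN))
  have hδ1 : δ ≤ (σ - p) / 2 := min_le_left _ _
  have hδ2 : δ * (N - a) ≤ ε := by
    rw [← le_div_iff₀ (sub_pos.2 haN)]; exact min_le_right _ _
  have hline : ∀ x, (c + p * (a - G)) + (p + δ) * (x - a) ≤ E x := by
    intro x
    rcases le_or_gt x a with hxa | hxa
    · have := hle x
      nlinarith
    rcases le_or_gt x N with hxN | hxN
    · have h1 : ε ≤ E x - (c + p * (x - G)) := hmin ⟨hxa.le, hxN⟩
      have h2 : δ * (x - a) ≤ δ * (N - a) := by gcongr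
      nlinarith
    · have h1 := (hN x hxN.le).1
      have h2 : δ * (x - a) ≤ (σ - p) / 2 * (x - a) :=
        mul_le_mul_of_nonneg_right hδ1 (by linarith)
      nlinarith
  have := line_le_hull hline G
  nlinarith [mul_pos hδpos (sub_pos.2 haG)]

/-- Without contact on the left, a line of positive slope could be rotated about `(G, c)` to a
smaller slope, against minimality. -/
theorem slope_eq_zero_of_forall_ne (h : ExcessShape E G σ)
    (hne : ∀ k ≤ G, E k ≠ convexHullFn E G + sInf (subdiff (convexHullFn E) G) * (k - G)) :
    sInf (subdiff (convexHullFn E) G) = 0 := by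
  set p := sInf (subdiff (convexHullFn E) G) with hp
  set c := convexHullFn E G with hc
  by_contra hp0
  have hppos : 0 < p := lt_of_le_of_ne h.slope_nonneg (Ne.symm hp0)
  have hle : ∀ x, c + p * (x - G) ≤ E x := fun x => (h.slope_mem x).trans (h.hull_le x)
  have hpos : ∀ x, x ≤ G → 0 < E x - (c + p * (x - G)) := fun x hx =>
    sub_pos.2 (lt_of_le_of_ne (hle x) (Ne.symm (hne x hx)))
  have hcont : Continuous fun x => E x - (c + p * (x - G)) := by
    have := h.cont
    fun_prop
  have hc0 : 0 ≤ c := h.hull_nonneg G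
  -- To the left of `N` even the line of slope `p / 2` through `(G, c)` is negative, so
  -- nonnegativity of `E` suffices there.
  set N := G - 2 * c / p - 1 with hN
  have hNp : p / 2 * (N - G) = - c - p / 2 := by rw [hN]; field_simp; ring
  have hNG : N < G := by
    have : 0 ≤ 2 * c / p := by positivity
    linarith
  obtain ⟨x₀, hx₀, hmin⟩ := (isCompact_Icc (a := N) (b := G)).exists_isMinOn
    (nonempty_Icc.2 hNG.le) hcont.continuousOn
  set ε := E x₀ - (c + p * (x₀ - G)) with hε
  have hεpos : 0 < ε := hpos x₀ hx₀.2
  set δ := min (p / 2) (ε / (G - N)) with hδ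
  have hδpos : 0 < δ := lt_min (by linarith) (div_pos hεpos (sub_pos.2 hNG))
  have hδ1 : δ ≤ p / 2 := min_le_left _ _
  have hδ2 : δ * (G - N) ≤ ε := by
    rw [← le_div_iff₀ (sub_pos.2 hNG)]; exact min_le_right _ _
  have hline : ∀ x, c + (p - δ) * (x - G) ≤ E x := by
    intro x
    rcases le_or_gt G x with hxG | hxG
    · have := hle x
      nlinarith
    rcases le_or_gt N x with hxN | hxN
    · have h1 : ε ≤ E x - (c + p * (x - G)) := hmin ⟨hxN, hxG.le⟩
      have h2 : δ * (G - x) ≤ δ * (G - N) := by gcongr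
      nlinarith
    · have h1 := h.nonneg x
      have h2 : (p - δ) * (x - G) ≤ p / 2 * (x - G) :=
        mul_le_mul_of_nonpos_right (by linarith) (by linarith)
      have h3 : p / 2 * (x - G) ≤ p / 2 * (N - G) := by gcongr
      linarith
  have := h.slope_le (p := p - δ) fun y => line_le_hull hline y
  linarith

theorem hull_eq_zero_of_slope_eq_zero (h : ExcessShape E G σ)
    (hp : sInf (subdiff (convexHullFn E) G) = 0) : convexHullFn E G = 0 := by
  refine le_antisymm ?_ (h.hull_nonneg G)
  refine ge_of_tendsto' h.tendsto_atBot fun x => ?_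
  have := (h.slope_mem x).trans (h.hull_le x)
  rw [hp] at this
  linarith

/-- A line of positive slope is negative far to the left, where it cannot meet the nonnegative `E`.
-/
theorem slope_eq_zero_of_not_bddBelow (h : ExcessShape E G σ)
    (hb : ¬ BddBelow {k | k ≤ G ∧
      E k = convexHullFn E G + sInf (subdiff (convexHullFn E) G) * (k - G)}) :
    sInf (subdiff (convexHullFn E) G) = 0 := by
  set p := sInf (subdiff (convexHullFn E) G) with hp
  set c := convexHullFn E G with hc
  by_contra hp0
  have hppos : 0 < p := lt_of_le_of_ne h.slope_nonneg (Ne.symm hp0)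
  refine hb ⟨G - c / p, fun k hk => ?_⟩
  have h1 := h.nonneg k
  rw [hk.2] at h1
  by_contra! hlt
  have h2 : p * (k - G) < p * (-(c / p)) := by
    apply mul_lt_mul_of_pos_left _ hppos
    linarith
  have h3 : p * (-(c / p)) = -c := by field_simp
  linarith

theorem slope_eq_zero_of_not (h : ExcessShape E G σ)
    (hb : ¬ (({k | k ≤ G ∧
      E k = convexHullFn E G + sInf (subdiff (convexHullFn E) G) * (k - G)} : Set ℝ).Nonempty ∧
      BddBelow {k | k ≤ G ∧
      E k = convexHullFn E G + sInf (subdiff (convexHullFn E) G) * (k - G)})) :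
    sInf (subdiff (convexHullFn E) G) = 0 := by
  by_cases hn : ({k | k ≤ G ∧
      E k = convexHullFn E G + sInf (subdiff (convexHullFn E) G) * (k - G)} : Set ℝ).Nonempty
  · exact h.slope_eq_zero_of_not_bddBelow fun hB => hb ⟨hn, hB⟩
  · exact h.slope_eq_zero_of_forall_ne fun k hk he => hn ⟨k, hk, he⟩

theorem lower_mem (h : ExcessShape E G σ) {L : Set ℝ} (hL : L = {k | k ≤ G ∧
      E k = convexHullFn E G + sInf (subdiff (convexHullFn E) G) * (k - G)})
    (hn : L.Nonempty) (hb : BddBelow L) : sInf L ∈ L := by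
  refine IsClosed.csInf_mem ?_ hn hb
  rw [hL]
  have := h.cont
  exact (isClosed_le continuous_id continuous_const).inter
    (isClosed_eq this (by fun_prop))

theorem exists_mem_upper (h : ExcessShape E G σ) :
    ∃ z, G ≤ z ∧ convexHullFn E z = E z ∧
      E z = convexHullFn E G + sInf (subdiff (convexHullFn E) G) * (z - G) := by
  obtain ⟨z, hz, he⟩ := h.exists_touch_right
  refine ⟨z, hz, le_antisymm (h.hull_le z) ?_, he⟩
  rw [he]
  exact h.slope_mem z

theorem upper_mem (h : ExcessShape E G σ) :
    sInf {z | G ≤ z ∧ convexHullFn E z = E z} ∈ {z | G ≤ z ∧ convexHullFn E z = E z} := by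
  refine IsClosed.csInf_mem ?_ ?_ ⟨G, fun z hz => hz.1⟩
  · exact (isClosed_le continuous_const continuous_id).inter
      (isClosed_eq h.hull_continuous h.cont)
  · obtain ⟨z, hz, he, -⟩ := h.exists_mem_upper
    exact ⟨z, hz, he⟩

/-- A convex function that meets one of its supporting lines at two points agrees with it in
between. -/
theorem _root_.LeftCurtain.eq_line_of_mem_Icc {C : ℝ → ℝ} (hC : ConvexOn ℝ univ C)
    {c p x₀ a b x : ℝ} (hle : ∀ y, c + p * (y - x₀) ≤ C y) (ha : C a = c + p * (a - x₀))
    (hb : C b = c + p * (b - x₀)) (hx : x ∈ Icc a b) : C x = c + p * (x - x₀) := by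
  rcases eq_or_lt_of_le (hx.1.trans hx.2) with hab | hab
  · obtain rfl : x = a := le_antisymm (hab ▸ hx.2) hx.1
    exact ha
  refine le_antisymm ?_ (hle x)
  have := three_point_le hC hx.1 hx.2
  rw [ha, hb] at this
  refine le_of_mul_le_mul_right (this.trans (le_of_eq ?_)) (sub_pos.2 hab)
  ring

/-- The first contact point of hull and `E` comes no later than the contact of the line with `E`,
and up to the latter the hull is the line. -/
theorem hull_upper (h : ExcessShape E G σ) :
    convexHullFn E (sInf {z | G ≤ z ∧ convexHullFn E z = E z}) = convexHullFn E G +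
      sInf (subdiff (convexHullFn E) G) * (sInf {z | G ≤ z ∧ convexHullFn E z = E z} - G) := by
  obtain ⟨z, hz, he, hl⟩ := h.exists_mem_upper
  exact eq_line_of_mem_Icc h.hull_convexOn (a := G) (b := z) h.slope_mem (by simp) (he.trans hl)
    ⟨h.upper_mem.1, csInf_le ⟨G, fun z hz => hz.1⟩ ⟨hz, he⟩⟩

theorem hull_eq_line (h : ExcessShape E G σ) {r k : ℝ}
    (hr : E r = convexHullFn E G + sInf (subdiff (convexHullFn E) G) * (r - G)) (hrk : r ≤ k)
    (hk : k ≤ sInf {z | G ≤ z ∧ convexHullFn E z = E z}) :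
    convexHullFn E k = convexHullFn E G + sInf (subdiff (convexHullFn E) G) * (k - G) := by
  refine eq_line_of_mem_Icc h.hull_convexOn h.slope_mem (le_antisymm ?_ (h.slope_mem r))
    h.hull_upper ⟨hrk, hk⟩
  rw [← hr]
  exact h.hull_le r

/-- A line supporting `E` on `[G, ∞)` at `k` is at least as steep as a supporting line of the hull
at the contact point `s`. Hence it also stays below the latter, and so below `E`, on the left of
`G`. -/
theorem hull_eq_of_upper_le (h : ExcessShape E G σ) {k : ℝ}
    (hk : sInf {z | G ≤ z ∧ convexHullFn E z = E z} ≤ k) : convexHullFn E k = E k := by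
  set s := sInf {z | G ≤ z ∧ convexHullFn E z = E z} with hs
  have hsm := h.upper_mem
  rw [← hs] at hsm
  rcases eq_or_lt_of_le hk with rfl | hlt
  · exact hsm.2
  obtain ⟨p, hp⟩ := h.subgrad k (hsm.1.trans hk)
  obtain ⟨q, hq⟩ := exists_mem_subdiff h.hull_convexOn s
  have hline : ∀ x, E k + p * (x - k) ≤ E x := by
    intro x
    rcases le_or_gt G x with hGx | hGx
    · exact hp x hGx
    have h1 := hp s hsm.1
    have h2 := (hq k).trans (h.hull_le k)
    have h3 := (hq x).trans (h.hull_le x)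
    have h4 := hsm.2
    have h5 : q ≤ p := by
      refine le_of_mul_le_mul_right ?_ (sub_pos.2 hlt)
      linarith
    have h6 := hsm.1
    nlinarith [mul_nonneg (sub_nonneg.2 h5) (by linarith : 0 ≤ s - x)]
  refine le_antisymm (h.hull_le k) ?_
  have := line_le_hull hline k
  simpa using this

/-- Comparison on a half-line is enough when the hull touches `E` at its end point. If the bound
failed at `k`, a supporting line of `g` at `k` would be no steeper than one of the hull at `c`;
lowered by `e`, it would be a minorant of `E` on the whole line. -/
theorem le_hull_add_of_touch (h : ExcessShape E G σ) {g : ℝ → ℝ} (hg : ConvexOn ℝ univ g)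
    {e c k : ℝ} (hle : ∀ x ≤ c, g x ≤ E x + e) (hc : convexHullFn E c = E c) (hk : k ≤ c) :
    g k ≤ convexHullFn E k + e := by
  by_contra! hlt
  have hkc : k < c := by
    refine lt_of_le_of_ne hk ?_
    rintro rfl
    have := hle k le_rfl
    linarith
  obtain ⟨p, hp⟩ := exists_mem_subdiff hg k
  obtain ⟨q, hq⟩ := exists_mem_subdiff h.hull_convexOn c
  have h1 := hp c
  have h2 := hle c le_rfl
  have h3 := hq k
  have hpq : p ≤ q := by
    refine le_of_mul_le_mul_right ?_ (sub_pos.2 hkc)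
    linarith
  have hline : ∀ x, (g k - e) + p * (x - k) ≤ E x := by
    intro x
    rcases le_or_gt x c with hx | hx
    · have := hp x
      have := hle x hx
      linarith
    · have h4 := (hq x).trans (h.hull_le x)
      nlinarith [mul_nonneg (sub_nonneg.2 hpq) (by linarith : 0 ≤ x - c)]
  have := line_le_hull hline k
  simp only [sub_self, mul_zero, add_zero] at this
  linarith

end ExcessShape

end LeftCurtain

namespace LeftCurtain

open Filter Topology

/-! ### Potentials -/

section Potential

variable {η χ : Measure ℝ}

theorem integrable_posPart [IsFiniteMeasure η] (hη : Integrable (fun x : ℝ => x) η) (k : ℝ) :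
    Integrable (fun x : ℝ => max (k - x) 0) η :=
  ((integrable_const k).sub hη).pos_part

theorem potential_nonneg (k : ℝ) : 0 ≤ potential η k :=
  integral_nonneg fun _ => le_max_right _ _

theorem potential_convexOn [IsFiniteMeasure η] (hη : Integrable (fun x : ℝ => x) η) :
    ConvexOn ℝ univ (potential η) := by
  refine ⟨convex_univ, fun x _ y _ a b ha hb hab => ?_⟩
  simp only [potential, smul_eq_mul]
  rw [← integral_const_mul, ← integral_const_mul,
    ← integral_add ((integrable_posPart hη x).const_mul a) ((integrable_posPart hη y).const_mul b)]
  refine integral_mono (integrable_posPart hη _)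
    (((integrable_posPart hη x).const_mul a).add ((integrable_posPart hη y).const_mul b))
    fun z => ?_
  have h1 := mul_le_mul_of_nonneg_left (le_max_left (x - z) 0) ha
  have h2 := mul_le_mul_of_nonneg_left (le_max_left (y - z) 0) hb
  have h3 := mul_nonneg ha (le_max_right (x - z) 0)
  have h4 := mul_nonneg hb (le_max_right (y - z) 0)
  obtain rfl : b = 1 - a := by linarith
  exact max_le (by simp only; linarith) (by simp only; linarith)

theorem potential_continuous [IsFiniteMeasure η] (hη : Integrable (fun x : ℝ => x) η) : Continuous (potential η) :=
  continuous_of_convexOn (potential_convexOn hη)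

theorem potential_mono [IsFiniteMeasure η] (hη : Integrable (fun x : ℝ => x) η) : Monotone (potential η) := by
  intro x y hxy
  refine integral_mono (integrable_posPart hη _) (integrable_posPart hη _) fun z => ?_
  exact max_le_max (by simpa using hxy) le_rfl

theorem le_potential [IsFiniteMeasure η] (hη : Integrable (fun x : ℝ => x) η) (k : ℝ) :
    η.real univ * k - ∫ x, x ∂η ≤ potential η k := by
  have : ∫ x, (k - x) ∂η = η.real univ * k - ∫ x, x ∂η := by
    rw [integral_sub (integrable_const k) hη, integral_const, smul_eq_mul]
  rw [← this]
  exact integral_mono ((integrable_const k).sub hη) (integrable_posPart hη k)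
    fun _ => le_max_left _ _

theorem potential_tendsto_atBot (hη : Integrable (fun x : ℝ => x) η) :
    Tendsto (potential η) atBot (𝓝 0) := by
  have h0 : (0 : ℝ) = ∫ _, (0 : ℝ) ∂η := by simp
  rw [h0]
  refine tendsto_integral_filter_of_dominated_convergence (fun x => |x|) ?_ ?_ hη.abs ?_
  · exact Eventually.of_forall fun k => by fun_prop
  · filter_upwards [eventually_le_atBot (0 : ℝ)] with k hk
    refine Eventually.of_forall fun x => ?_
    rw [Real.norm_of_nonneg (le_max_right _ _)]
    exact max_le (by linarith [neg_abs_le x]) (abs_nonneg x)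
  · refine Eventually.of_forall fun x => ?_
    refine tendsto_const_nhds.congr' ?_
    filter_upwards [eventually_le_atBot x] with k hk
    rw [max_eq_right (by linarith)]

/-- Put-call parity, by which puts, mass and mean control calls. -/
theorem integral_callPart [IsFiniteMeasure η] (hη : Integrable (fun x : ℝ => x) η) (k : ℝ) :
    ∫ x, max (x - k) 0 ∂η = potential η k - (η.real univ * k - ∫ x, x ∂η) := by
  have : ∫ x, (k - x) ∂η = η.real univ * k - ∫ x, x ∂η := by
    rw [integral_sub (integrable_const k) hη, integral_const, smul_eq_mul]
  rw [← this, potential, ← integral_sub (integrable_posPart hη k) (by exact (integrable_const k).sub hη)]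
  refine integral_congr_ae (Eventually.of_forall fun x => ?_)
  simp only
  rcases le_total k x with h | h
  · rw [max_eq_left (by linarith), max_eq_right (by linarith)]; ring
  · rw [max_eq_right (by linarith), max_eq_left (by linarith)]; ring

theorem potential_tendsto_atTop [IsFiniteMeasure η] (hη : Integrable (fun x : ℝ => x) η) :
    Tendsto (fun k => potential η k - (η.real univ * k - ∫ x, x ∂η)) atTop (𝓝 0) := by
  simp_rw [← integral_callPart hη]
  rw [show 𝓝 (0 : ℝ) = 𝓝 (∫ _, (0 : ℝ) ∂η) by simp]
  refine tendsto_integral_filter_of_dominated_convergence (fun x => |x|) ?_ ?_ hη.abs ?_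
  · exact Eventually.of_forall fun k => by fun_prop
  · filter_upwards [eventually_ge_atTop (0 : ℝ)] with k hk
    refine Eventually.of_forall fun x => ?_
    rw [Real.norm_of_nonneg (le_max_right _ _)]
    exact max_le (by linarith [le_abs_self x]) (abs_nonneg x)
  · refine Eventually.of_forall fun x => ?_
    refine tendsto_const_nhds.congr' ?_
    filter_upwards [eventually_ge_atTop x] with k hk
    rw [max_eq_right (by linarith)]

theorem potential_add [IsFiniteMeasure η] [IsFiniteMeasure χ] (hη : Integrable (fun x : ℝ => x) η) (hχ : Integrable (fun x : ℝ => x) χ)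
    (k : ℝ) : potential (η + χ) k = potential η k + potential χ k :=
  integral_add_measure (integrable_posPart hη k) (integrable_posPart hχ k)

/-! ### Potentials determine measures -/

/-- The slope of a potential on `[k, r]` lies between the masses of `Iic k` and `Iic r`; then `r`
decreases to `k`. -/
theorem measure_Iic_le_of_potential_eq [IsFiniteMeasure η] [IsFiniteMeasure χ]
    (hη : ∀ k, Integrable (fun x : ℝ => max (k - x) 0) η)
    (hχ : ∀ k, Integrable (fun x : ℝ => max (k - x) 0) χ)
    (h : ∀ k, potential η k = potential χ k) (k : ℝ) : η (Iic k) ≤ χ (Iic k) := by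
  have key : ∀ r > k, η (Iic k) ≤ χ (Iic r) := by
    intro r hr
    have h1 : (r - k) * η.real (Iic k) ≤ potential η r - potential η k := by
      rw [potential, potential, ← integral_sub (hη r) (hη k)]
      have : (r - k) * η.real (Iic k) = ∫ x, (Iic k).indicator (fun _ => r - k) x ∂η := by
        rw [integral_indicator_const _ measurableSet_Iic, smul_eq_mul, mul_comm]
      rw [this]
      refine integral_mono ((integrable_const _).indicator measurableSet_Iic)
        ((hη r).sub (hη k)) fun x => ?_
      simp only [indicator, mem_Iic]
      split_ifs with hx
      · rw [max_eq_left (by linarith), max_eq_left (by linarith)]; linarith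
      · exact sub_nonneg.2 (max_le_max (by linarith) le_rfl)
    have h2 : potential χ r - potential χ k ≤ (r - k) * χ.real (Iic r) := by
      rw [potential, potential, ← integral_sub (hχ r) (hχ k)]
      have : (r - k) * χ.real (Iic r) = ∫ x, (Iic r).indicator (fun _ => r - k) x ∂χ := by
        rw [integral_indicator_const _ measurableSet_Iic, smul_eq_mul, mul_comm]
      rw [this]
      refine integral_mono ((hχ r).sub (hχ k))
        ((integrable_const _).indicator measurableSet_Iic) fun x => ?_
      simp only [indicator, mem_Iic]
      split_ifs with hx
      · rw [max_eq_left (by linarith : 0 ≤ r - x)]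
        linarith [le_max_left (k - x) 0]
      · rw [max_eq_right (by linarith), max_eq_right (by linarith)]; simp
    rw [h r, h k] at h1
    have h3 := le_of_mul_le_mul_left (h1.trans h2) (sub_pos.2 hr)
    rwa [measureReal_def, measureReal_def,
      ENNReal.toReal_le_toReal (measure_ne_top _ _) (measure_ne_top _ _)] at h3
  have hlim := tendsto_measure_biInter_gt (μ := χ) (s := fun r : ℝ => Iic r) (a := k)
    (fun r _ => measurableSet_Iic.nullMeasurableSet) (fun i j _ hij => Iic_subset_Iic.2 hij)
    ⟨k + 1, by simp, measure_ne_top _ _⟩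
  have hInter : ⋂ r > k, Iic r = Iic k := by
    ext x
    simp only [mem_iInter, mem_Iic]
    exact ⟨fun hx => le_of_forall_gt_imp_ge_of_dense hx, fun hx r hr => hx.trans hr.le⟩
  rw [hInter] at hlim
  exact ge_of_tendsto hlim (eventually_mem_nhdsWithin.mono fun r hr => key r hr)

/-- Only put functions are assumed integrable, because this is applied to the law of `Y` before `Y`
is known to be integrable. -/
theorem eq_of_potential_eq [IsFiniteMeasure η] [IsFiniteMeasure χ]
    (hη : ∀ k, Integrable (fun x : ℝ => max (k - x) 0) η)
    (hχ : ∀ k, Integrable (fun x : ℝ => max (k - x) 0) χ)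
    (h : ∀ k, potential η k = potential χ k) : η = χ :=
  Measure.ext_of_Iic _ _ fun k => le_antisymm (measure_Iic_le_of_potential_eq hη hχ h k)
    (measure_Iic_le_of_potential_eq hχ hη (fun k => (h k).symm) k)

/-! ### Convex order and potentials -/

theorem ConvexOrder.refl (η : Measure ℝ) : ConvexOrder η η := fun _ _ hf => ⟨hf, le_rfl⟩

theorem ConvexOrder.real_univ_eq [IsFiniteMeasure η] [IsFiniteMeasure χ] (h : ConvexOrder η χ) : η.real univ = χ.real univ := by
  have h1 := (h (fun _ => 1) (convexOn_const 1 convex_univ) (integrable_const 1)).2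
  have h2 := (h (fun _ => -1) (convexOn_const (-1) convex_univ) (integrable_const (-1))).2
  simp at h1 h2
  linarith

theorem ConvexOrder.integral_id_eq (h : ConvexOrder η χ) (hχ : Integrable (fun x : ℝ => x) χ) :
    ∫ x, x ∂η = ∫ x, x ∂χ := by
  have h1 := (h (fun x => x) (convexOn_id convex_univ) hχ).2
  have h2 := (h (fun x => -x) (by
    have := convexOn_affine 0 (-1) 0
    simpa using this) hχ.neg).2
  rw [integral_neg, integral_neg] at h2
  linarith

theorem convexOn_put (k : ℝ) : ConvexOn ℝ univ fun x : ℝ => max (k - x) 0 := by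
  have h1 : ConvexOn ℝ univ fun x : ℝ => k - x := by
    have := convexOn_affine k (-1) 0
    simpa [sub_eq_add_neg] using this
  exact h1.sup (convexOn_const 0 convex_univ)

theorem ConvexOrder.potential_le [IsFiniteMeasure χ] (h : ConvexOrder η χ) (hχ : Integrable (fun x : ℝ => x) χ)
    (k : ℝ) : potential η k ≤ potential χ k :=
  (h _ (convexOn_put k) (integrable_posPart hχ k)).2

end Potential

end LeftCurtain

/-! ### Convex functions as mixtures of calls and puts; convex order from potentials -/

namespace LeftCurtain

open Filter Topology

/-- Any selection of subgradients is monotone and integrates to `f`; its right-continuous version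
differs from it only at countably many points. -/
theorem exists_stieltjes_of_convexOn {f : ℝ → ℝ} (hf : ConvexOn ℝ univ f) :
    ∃ H : StieltjesFunction ℝ, ∀ a b, a ≤ b → ∫ t in a..b, H t = f b - f a := by
  choose h hh using exists_mem_subdiff hf
  have hmono : Monotone h := by
    intro x y hxy
    rcases eq_or_lt_of_le hxy with rfl | hlt
    · rfl
    · exact subdiff_mono hlt (hh x) (hh y)
  refine ⟨hmono.stieltjesFunction, fun a b hab => ?_⟩
  have hae : ∀ᵐ t : ℝ, hmono.stieltjesFunction t = h t := by
    have := hmono.countable_not_continuousAt.ae_notMem volume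
    filter_upwards [this] with t ht
    rw [hmono.stieltjesFunction_eq]
    exact (not_not.1 ht).continuousWithinAt.rightLim_eq
  rw [intervalIntegral.integral_congr_ae (hae.mono fun t ht _ => ht)]
  refine (integral_eq_sub_of_increment_bounds hab (g := fun _ => 0) monotoneOn_const ?_ ?_).2
  · intro x _ y _ _
    have := hh x y
    linarith
  · intro x _ y _ _
    have := hh y x
    linarith

/-- The representation of a convex function as an affine function plus a mixture of call and put
functions. -/
theorem ofReal_sub_affine_eq_lintegral {f : ℝ → ℝ} {H : StieltjesFunction ℝ}
    (hH : ∀ a b, a ≤ b → ∫ t in a..b, H t = f b - f a) (x : ℝ) :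
    0 ≤ f x - f 0 - H 0 * x ∧ ENNReal.ofReal (f x - f 0 - H 0 * x) =
      ∫⁻ s in Ioi 0, ENNReal.ofReal (x - s) ∂H.measure +
      ∫⁻ s in Iic 0, ENNReal.ofReal (s - x) ∂H.measure := by
  have hint : ∀ a b, IntervalIntegrable H volume a b := fun a b =>
    H.mono.intervalIntegrable
  rcases le_total 0 x with hx | hx
  · have heq : f x - f 0 - H 0 * x = ∫ t in Ioc 0 x, (H t - H 0) := by
      rw [← intervalIntegral.integral_of_le hx, intervalIntegral.integral_sub (hint _ _)
        intervalIntegrable_const, hH 0 x hx, intervalIntegral.integral_const, smul_eq_mul]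
      ring
    have hnn : ∀ t ∈ Ioc 0 x, 0 ≤ H t - H 0 := fun t ht => sub_nonneg.2 (H.mono ht.1.le)
    have hI : IntegrableOn (fun t => H t - H 0) (Ioc 0 x) :=
      ((intervalIntegrable_iff_integrableOn_Ioc_of_le hx).1 (hint 0 x)).sub
        (integrable_const _)
    refine ⟨heq ▸ setIntegral_nonneg measurableSet_Ioc hnn, ?_⟩
    rw [heq, ofReal_integral_eq_lintegral_ofReal hI
      ((ae_restrict_iff' measurableSet_Ioc).2 (Eventually.of_forall hnn))]
    have h2 : ∫⁻ s in Iic 0, ENNReal.ofReal (s - x) ∂H.measure = 0 := by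
      rw [setLIntegral_congr_fun measurableSet_Iic (g := fun _ => 0) fun s hs => by
        exact ENNReal.ofReal_of_nonpos (by linarith [mem_Iic.1 hs])]
      simp
    rw [h2, add_zero]
    have hset : MeasurableSet {p : ℝ × ℝ | 0 < p.2 ∧ p.2 ≤ p.1 ∧ p.1 ≤ x} :=
      (measurableSet_lt measurable_const measurable_snd).inter
        ((measurableSet_le measurable_snd measurable_fst).inter
          (measurableSet_le measurable_fst measurable_const))
    -- Tonelli on the triangle `0 < s ≤ t ≤ x`: integrating in `s` first gives `H t - H 0`, in `t`
    -- first gives `x - s`.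
    set F : ℝ → ℝ → ENNReal := fun t s =>
      {p : ℝ × ℝ | 0 < p.2 ∧ p.2 ≤ p.1 ∧ p.1 ≤ x}.indicator 1 (t, s) with hF
    have hswap := lintegral_lintegral_swap (μ := (volume : Measure ℝ)) (ν := H.measure) (f := F)
      (measurable_one.indicator hset).aemeasurable
    have hl : ∀ t, ∫⁻ s, F t s ∂H.measure =
        (Ioc 0 x).indicator (fun t => ENNReal.ofReal (H t - H 0)) t := by
      intro t
      by_cases ht : t ∈ Ioc 0 x
      · rw [indicator_of_mem ht, ← H.measure_Ioc, ← lintegral_indicator_one measurableSet_Ioc]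
        refine lintegral_congr fun s => ?_
        simp only [hF, indicator, mem_ofPred_eq, mem_Ioc]
        congr 1
        exact propext ⟨fun h => ⟨h.1, h.2.1⟩, fun h => ⟨h.1, h.2, ht.2⟩⟩
      · rw [indicator_of_notMem ht]
        have : ∀ s, F t s = 0 := fun s => indicator_of_notMem
          (fun h => ht ⟨h.1.trans_le h.2.1, h.2.2⟩) _
        simp [this]
    have hr : ∀ s, ∫⁻ t, F t s = (Ioi 0).indicator (fun s => ENNReal.ofReal (x - s)) s := by
      intro s
      by_cases hs : s ∈ Ioi (0 : ℝ)
      · rw [indicator_of_mem hs, ← Real.volume_Icc, ← lintegral_indicator_one measurableSet_Icc]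
        refine lintegral_congr fun t => ?_
        simp only [hF, indicator, mem_ofPred_eq, mem_Icc]
        congr 1
        exact propext ⟨fun h => h.2, fun h => ⟨hs, h⟩⟩
      · rw [indicator_of_notMem hs]
        have : ∀ t, F t s = 0 := fun t => indicator_of_notMem (fun h => hs h.1) _
        simp [this]
    simp_rw [hl, hr] at hswap
    rwa [lintegral_indicator measurableSet_Ioc, lintegral_indicator measurableSet_Ioi] at hswap
  · have heq : f x - f 0 - H 0 * x = ∫ t in Ioc x 0, (H 0 - H t) := by
      rw [← intervalIntegral.integral_of_le hx, intervalIntegral.integral_sub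
        intervalIntegrable_const (hint _ _), hH x 0 hx, intervalIntegral.integral_const,
        smul_eq_mul]
      ring
    have hnn : ∀ t ∈ Ioc x 0, 0 ≤ H 0 - H t := fun t ht => sub_nonneg.2 (H.mono ht.2)
    have hI : IntegrableOn (fun t => H 0 - H t) (Ioc x 0) :=
      (integrable_const _).sub
        ((intervalIntegrable_iff_integrableOn_Ioc_of_le hx).1 (hint x 0))
    refine ⟨heq ▸ setIntegral_nonneg measurableSet_Ioc hnn, ?_⟩
    rw [heq, ofReal_integral_eq_lintegral_ofReal hI
      ((ae_restrict_iff' measurableSet_Ioc).2 (Eventually.of_forall hnn))]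
    have h2 : ∫⁻ s in Ioi 0, ENNReal.ofReal (x - s) ∂H.measure = 0 := by
      rw [setLIntegral_congr_fun measurableSet_Ioi (g := fun _ => 0) fun s hs => by
        exact ENNReal.ofReal_of_nonpos (by linarith [mem_Ioi.1 hs])]
      simp
    rw [h2, zero_add]
    have hset : MeasurableSet {p : ℝ × ℝ | x < p.1 ∧ p.1 < p.2 ∧ p.2 ≤ 0} :=
      (measurableSet_lt measurable_const measurable_fst).inter
        ((measurableSet_lt measurable_fst measurable_snd).inter
          (measurableSet_le measurable_snd measurable_const))
    -- Here the triangle is `x < t < s ≤ 0`. The strict `t < s` makes its section in `s` the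
    -- interval `Ioc t 0`, of measure `H 0 - H t`.
    set F : ℝ → ℝ → ENNReal := fun t s =>
      {p : ℝ × ℝ | x < p.1 ∧ p.1 < p.2 ∧ p.2 ≤ 0}.indicator 1 (t, s) with hF
    have hswap := lintegral_lintegral_swap (μ := (volume : Measure ℝ)) (ν := H.measure) (f := F)
      (measurable_one.indicator hset).aemeasurable
    have hl : ∀ t, ∫⁻ s, F t s ∂H.measure =
        (Ioc x 0).indicator (fun t => ENNReal.ofReal (H 0 - H t)) t := by
      intro t
      by_cases ht : t ∈ Ioc x 0
      · rw [indicator_of_mem ht, ← H.measure_Ioc, ← lintegral_indicator_one measurableSet_Ioc]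
        refine lintegral_congr fun s => ?_
        simp only [hF, indicator, mem_ofPred_eq, mem_Ioc]
        congr 1
        exact propext ⟨fun h => h.2, fun h => ⟨ht.1, h⟩⟩
      · rw [indicator_of_notMem ht]
        have : ∀ s, F t s = 0 := fun s => indicator_of_notMem
          (fun h => ht ⟨h.1, (h.2.1.trans_le h.2.2).le⟩) _
        simp [this]
    have hr : ∀ s, ∫⁻ t, F t s = (Iic 0).indicator (fun s => ENNReal.ofReal (s - x)) s := by
      intro s
      by_cases hs : s ∈ Iic (0 : ℝ)
      · rw [indicator_of_mem hs, ← Real.volume_Ioo, ← lintegral_indicator_one measurableSet_Ioo]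
        refine lintegral_congr fun t => ?_
        simp only [hF, indicator, mem_ofPred_eq, mem_Ioo]
        congr 1
        exact propext ⟨fun h => ⟨h.1, h.2.1⟩, fun h => ⟨h.1, h.2, hs⟩⟩
      · rw [indicator_of_notMem hs]
        have : ∀ t, F t s = 0 := fun t => indicator_of_notMem (fun h => hs h.2.2) _
        simp [this]
    simp_rw [hl, hr] at hswap
    rwa [lintegral_indicator measurableSet_Ioc, lintegral_indicator measurableSet_Iic] at hswap

theorem lintegral_put_eq {η : Measure ℝ} [IsFiniteMeasure η]
    (hη : Integrable (fun x : ℝ => x) η) (k : ℝ) :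
    ∫⁻ x, ENNReal.ofReal (k - x) ∂η = ENNReal.ofReal (potential η k) := by
  rw [potential, ofReal_integral_eq_lintegral_ofReal (integrable_posPart hη k)
    (Eventually.of_forall fun _ => le_max_right _ _)]
  refine lintegral_congr fun x => ?_
  rw [ENNReal.ofReal_max, ENNReal.ofReal_zero, max_eq_left zero_le]

theorem lintegral_call_eq {η : Measure ℝ} [IsFiniteMeasure η]
    (hη : Integrable (fun x : ℝ => x) η) (k : ℝ) :
    ∫⁻ x, ENNReal.ofReal (x - k) ∂η =
      ENNReal.ofReal (potential η k - (η.real univ * k - ∫ x, x ∂η)) := by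
  have hint : Integrable (fun x => max (x - k) 0) η := (hη.sub (integrable_const k)).pos_part
  rw [← integral_callPart hη, ofReal_integral_eq_lintegral_ofReal hint
    (Eventually.of_forall fun _ => le_max_right _ _)]
  refine lintegral_congr fun x => ?_
  rw [ENNReal.ofReal_max, ENNReal.ofReal_zero, max_eq_left zero_le]

/-- Measures with equal masses and means and ordered potentials are in convex order. -/
theorem convexOrder_of_potential_le {η χ : Measure ℝ} [IsFiniteMeasure η] [IsFiniteMeasure χ]
    (hη : Integrable (fun x : ℝ => x) η) (hχ : Integrable (fun x : ℝ => x) χ)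
    (hmass : η.real univ = χ.real univ) (hmean : ∫ x, x ∂η = ∫ x, x ∂χ)
    (hP : ∀ k, potential η k ≤ potential χ k) : ConvexOrder η χ := by
  intro f hf hfχ
  obtain ⟨H, hH⟩ := exists_stieltjes_of_convexOn hf
  have hrep := fun x => ofReal_sub_affine_eq_lintegral hH x
  set g : ℝ → ℝ := fun x => f x - f 0 - H 0 * x with hg
  have hgm : Measurable g := by
    have := (continuous_of_convexOn hf).measurable
    fun_prop
  have hgl : ∀ θ : Measure ℝ, IsFiniteMeasure θ → ∫⁻ x, ENNReal.ofReal (g x) ∂θ =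
      ∫⁻ s in Ioi 0, ∫⁻ x, ENNReal.ofReal (x - s) ∂θ ∂H.measure +
      ∫⁻ s in Iic 0, ∫⁻ x, ENNReal.ofReal (s - x) ∂θ ∂H.measure := by
    intro θ hθ
    rw [lintegral_congr fun x => (hrep x).2, lintegral_add_left]
    · congr 1
      · exact lintegral_lintegral_swap (by fun_prop)
      · exact lintegral_lintegral_swap (by fun_prop)
    · exact Measurable.lintegral_prod_right' (f := fun p : ℝ × ℝ => ENNReal.ofReal (p.1 - p.2))
        (by fun_prop)
  have hle : ∫⁻ x, ENNReal.ofReal (g x) ∂η ≤ ∫⁻ x, ENNReal.ofReal (g x) ∂χ := by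
    rw [hgl η inferInstance, hgl χ inferInstance]
    -- With equal masses and means, calls differ from puts by the same affine term, so both kinds
    -- are ordered by `hP`.
    simp_rw [lintegral_put_eq hη, lintegral_put_eq hχ, lintegral_call_eq hη, lintegral_call_eq hχ,
      hmass, hmean]
    gcongr with s s
    · exact hP s
    · exact hP s
  have hgχ : Integrable g χ :=
    (hfχ.sub (integrable_const _)).sub (hχ.const_mul _)
  have hfin : ∫⁻ x, ENNReal.ofReal (g x) ∂χ ≠ ⊤ :=
    (lintegral_ofReal_ne_top_iff_integrable hgm.aestronglyMeasurable
      (Eventually.of_forall fun x => (hrep x).1)).2 hgχ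
  have hgη : Integrable g η :=
    (lintegral_ofReal_ne_top_iff_integrable hgm.aestronglyMeasurable
      (Eventually.of_forall fun x => (hrep x).1)).1 (ne_top_of_le_ne_top hfin hle)
  have hgint : ∫ x, g x ∂η ≤ ∫ x, g x ∂χ := by
    rw [integral_eq_lintegral_of_nonneg_ae (Eventually.of_forall fun x => (hrep x).1)
      hgm.aestronglyMeasurable, integral_eq_lintegral_of_nonneg_ae
      (Eventually.of_forall fun x => (hrep x).1) hgm.aestronglyMeasurable]
    exact ENNReal.toReal_mono hfin hle
  have hfg : f = fun x => g x + (f 0 + H 0 * x) := by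
    ext x; simp only [hg]; ring
  have haff : ∀ θ : Measure ℝ, IsFiniteMeasure θ → Integrable (fun x : ℝ => x) θ →
      Integrable (fun x => f 0 + H 0 * x) θ ∧
      ∫ x, (f 0 + H 0 * x) ∂θ = θ.real univ * f 0 + H 0 * ∫ x, x ∂θ := by
    intro θ hθ hid
    refine ⟨(integrable_const _).add (hid.const_mul _), ?_⟩
    rw [integral_add (integrable_const _) (hid.const_mul _), integral_const, smul_eq_mul,
      integral_const_mul]
  have hfη : Integrable f η := by
    rw [hfg]; exact hgη.add (haff η inferInstance hη).1
  refine ⟨hfη, ?_⟩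
  rw [hfg, integral_add hgη (haff η inferInstance hη).1,
    integral_add hgχ (haff χ inferInstance hχ).1, (haff η inferInstance hη).2,
    (haff χ inferInstance hχ).2, hmass, hmean]
  linarith

/-! ### Shadows -/

/-- Two least elements dominate each other in convex order, so their potentials agree. -/
theorem IsShadow.unique {η χ θ θ' : Measure ℝ} [IsFiniteMeasure χ]
    (hχ : Integrable (fun x : ℝ => x) χ) (h : IsShadow η χ θ) (h' : IsShadow η χ θ') :
    θ = θ' := by
  have hf : IsFiniteMeasure θ := isFiniteMeasure_of_le χ h.1
  have hf' : IsFiniteMeasure θ' := isFiniteMeasure_of_le χ h'.1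
  have hi := hχ.mono_measure h.1
  have hi' := hχ.mono_measure h'.1
  exact eq_of_potential_eq (integrable_posPart hi) (integrable_posPart hi') fun k =>
    le_antisymm ((h.2.2 θ' h'.2.1 h'.1).potential_le hi' k)
      ((h'.2.2 θ h.2.1 h.1).potential_le hi k)

/-- A measure below `χ` whose potential is `P_χ - (P_χ - P_η)^c` is the shadow of `η` in `χ`. -/
theorem isShadow_of_potential_eq {η χ θ : Measure ℝ} [IsFiniteMeasure η] [IsFiniteMeasure χ]
    (hη : Integrable (fun x : ℝ => x) η) (hχ : Integrable (fun x : ℝ => x) χ) (hle : θ ≤ χ)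
    (hmass : η.real univ = θ.real univ) (hmean : ∫ x, x ∂η = ∫ x, x ∂θ)
    (hconv : ∃ h, ConvexOn ℝ univ h ∧ ∀ k, h k ≤ potential χ k - potential η k)
    (hP : ∀ k, potential θ k =
      potential χ k - convexHullFn (fun k => potential χ k - potential η k) k) :
    IsShadow η χ θ := by
  have hf : IsFiniteMeasure θ := isFiniteMeasure_of_le χ hle
  have hi := hχ.mono_measure hle
  obtain ⟨h, hc, hh⟩ := hconv
  have hηθ : ConvexOrder η θ := by
    refine convexOrder_of_potential_le hη hi hmass hmean fun k => ?_
    have := convexHullFn_le hc hh k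
    rw [hP]
    linarith
  refine ⟨hle, hηθ, fun θ' hcx hle' => ?_⟩
  have hf' : IsFiniteMeasure θ' := isFiniteMeasure_of_le χ hle'
  have hi' := hχ.mono_measure hle'
  refine convexOrder_of_potential_le hi hi' (hmass.symm.trans hcx.real_univ_eq)
    (hmean.symm.trans (hcx.integral_id_eq hi')) fun k => ?_
  -- Minimality: `P_χ - P_θ'` is convex, being the potential of the measure `χ - θ'`, and lies below
  -- `P_χ - P_η`. Hence it lies below the convex hull of the latter.
  have hsub : Integrable (fun x : ℝ => x) (χ - θ') := hχ.mono_measure Measure.sub_le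
  have hadd : ∀ k, potential (χ - θ') k = potential χ k - potential θ' k := fun k => by
    have := potential_add hsub hi' k
    rw [Measure.sub_add_cancel_of_le hle'] at this
    linarith
  have := le_convexHullFn (f := fun k => potential χ k - potential η k)
    (potential_convexOn hsub) (fun x => by
      have := hcx.potential_le hi' x
      rw [hadd]; linarith) k
  rw [hadd] at this
  rw [hP]
  linarith

end LeftCurtain

namespace LeftCurtain

open Filter Topology

/-! ### The quantile function -/

section Quantile

variable {μ : Measure ℝ} [IsProbabilityMeasure μ]

/-- Right-continuity of the distribution function makes the defining infimum attained. -/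
theorem quantile_le_iff {u : ℝ} (hu : u ∈ Ioo (0 : ℝ) 1) {x : ℝ} :
    quantile μ u ≤ x ↔ u ≤ μ.real (Iic x) := by
  have hset : {x : ℝ | u ≤ μ.real (Iic x)} = {x : ℝ | u ≤ cdf μ x} := by
    simp_rw [cdf_eq_real]
  have hne : {x : ℝ | u ≤ cdf μ x}.Nonempty :=
    ((tendsto_cdf_atTop μ).eventually (le_mem_nhds hu.2)).exists
  have hbdd : BddBelow {x : ℝ | u ≤ cdf μ x} := by
    obtain ⟨y, hy⟩ := ((tendsto_cdf_atBot μ).eventually (gt_mem_nhds hu.1)).exists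
    refine ⟨y, fun x hx => ?_⟩
    by_contra! hlt
    have := (cdf μ).mono hlt.le
    have := mem_ofPred.1 hx
    linarith
  rw [quantile, hset, ← cdf_eq_real]
  refine ⟨fun h => ?_, fun h => csInf_le hbdd h⟩
  have hmem : u ≤ cdf μ (sInf {x : ℝ | u ≤ cdf μ x}) := by
    have hc := ((cdf μ).right_continuous (sInf {x : ℝ | u ≤ cdf μ x})).mono Ioi_subset_Ici_self
    refine ge_of_tendsto hc (eventually_mem_nhdsWithin.mono fun y hy => ?_)
    obtain ⟨z, hz, hzy⟩ := (csInf_lt_iff hbdd hne).1 (mem_Ioi.1 hy)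
    exact (mem_ofPred.1 hz).trans ((cdf μ).mono hzy.le)
  exact hmem.trans ((cdf μ).mono h)

theorem quantile_monotoneOn : MonotoneOn (quantile μ) (Ioo 0 1) := fun _ hx _ hy hxy =>
  (quantile_le_iff hx).2 (hxy.trans ((quantile_le_iff hy).1 le_rfl))

theorem measure_Iio_quantile_le {u : ℝ} (hu : u ∈ Ioo (0 : ℝ) 1) :
    μ (Iio (quantile μ u)) ≤ ENNReal.ofReal u := by
  obtain ⟨s, hs, hlt, hlim⟩ := exists_seq_strictMono_tendsto (quantile μ u)
  have hU : Iio (quantile μ u) = ⋃ n, Iic (s n) := by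
    ext x
    simp only [mem_Iio, mem_iUnion, mem_Iic]
    refine ⟨fun hx => ?_, fun ⟨n, hn⟩ => hn.trans_lt (hlt n)⟩
    exact (hlim.eventually (le_mem_nhds hx)).exists
  have hm : Monotone fun n => Iic (s n) := fun i j hij => Iic_subset_Iic.2 (hs.monotone hij)
  rw [hU, hm.measure_iUnion]
  refine iSup_le fun n => ?_
  have : ¬ u ≤ μ.real (Iic (s n)) := fun h => absurd ((quantile_le_iff hu).2 h) (not_le.2 (hlt n))
  rw [← ofReal_measureReal]
  exact ENNReal.ofReal_le_ofReal (not_le.1 this).le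

theorem aemeasurable_quantile {s : Set ℝ} (hs : MeasurableSet s) (h : s ⊆ Ioo 0 1) :
    AEMeasurable (quantile μ) (volume.restrict s) :=
  aemeasurable_restrict_of_monotoneOn hs (quantile_monotoneOn.mono h)

theorem Ioc_subset_Ioo_one {a u : ℝ} (ha : 0 ≤ a) (hu : u < 1) : Ioc a u ⊆ Ioo (0 : ℝ) 1 :=
  fun _ hx => ⟨ha.trans_lt hx.1, hx.2.trans_lt hu⟩

theorem quantile_preimage_inter {s : Set ℝ} (h : s ⊆ Ioo 0 1) (x : ℝ) :
    quantile μ ⁻¹' Iic x ∩ s = s ∩ Iic (μ.real (Iic x)) := by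
  ext w
  simp only [mem_inter_iff, mem_preimage, mem_Iic]
  exact ⟨fun ⟨h1, h2⟩ => ⟨h2, (quantile_le_iff (h h2)).1 h1⟩,
    fun ⟨h1, h2⟩ => ⟨(quantile_le_iff (h h1)).2 h2, h1⟩⟩

theorem map_quantile : (volume.restrict (Ioo (0 : ℝ) 1)).map (quantile μ) = μ := by
  have : IsFiniteMeasure ((volume.restrict (Ioo (0 : ℝ) 1)).map (quantile μ)) := inferInstance
  refine Measure.ext_of_Iic _ _ fun x => ?_
  rw [Measure.map_apply_of_aemeasurable (aemeasurable_quantile measurableSet_Ioo le_rfl)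
    measurableSet_Iic, Measure.restrict_apply' measurableSet_Ioo, quantile_preimage_inter le_rfl,
    ← ofReal_measureReal (μ := μ)]
  have h1 : μ.real (Iic x) ≤ 1 := measureReal_le_one
  refine le_antisymm ?_ ?_
  · calc volume (Ioo 0 1 ∩ Iic (μ.real (Iic x))) ≤ volume (Ioc 0 (μ.real (Iic x))) :=
        measure_mono fun y hy => ⟨hy.1.1, hy.2⟩
      _ = _ := by rw [Real.volume_Ioc, sub_zero]
  · calc ENNReal.ofReal (μ.real (Iic x)) = volume (Ioo 0 (μ.real (Iic x))) := by
          rw [Real.volume_Ioo, sub_zero]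
      _ ≤ volume (Ioo 0 1 ∩ Iic (μ.real (Iic x))) :=
          measure_mono fun y hy => ⟨⟨hy.1, hy.2.trans_le h1⟩, hy.2.le⟩

/-- Splitting the atom at `G(u)` becomes cutting the level interval, so integrals against `μ_u` turn
into integrals over `(0, u]` and those of different levels can be subtracted. -/
theorem leftPart_eq_map {u : ℝ} (hu : u ∈ Ioo (0 : ℝ) 1) :
    leftPart μ u = (volume.restrict (Ioc 0 u)).map (quantile μ) := by
  have hsub := Ioc_subset_Ioo_one le_rfl hu.2
  symm
  refine Measure.ext_of_Iic _ _ fun x => ?_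
  rw [Measure.map_apply_of_aemeasurable (aemeasurable_quantile measurableSet_Ioc hsub)
    measurableSet_Iic, Measure.restrict_apply' measurableSet_Ioc, quantile_preimage_inter hsub,
    Ioc_inter_Iic, Real.volume_Ioc, sub_zero, leftPart, Measure.add_apply,
    Measure.restrict_apply measurableSet_Iic, Measure.smul_apply, smul_eq_mul,
    Measure.dirac_apply' _ measurableSet_Iic]
  rcases le_or_gt (quantile μ u) x with hx | hx
  · have h1 : Iic x ∩ Iio (quantile μ u) = Iio (quantile μ u) :=
      inter_eq_right.2 fun y hy => (mem_Iio.1 hy).le.trans hx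
    have h2 : μ.real (Iio (quantile μ u)) ≤ u := by
      rw [measureReal_def]
      exact ENNReal.toReal_le_of_le_ofReal hu.1.le (measure_Iio_quantile_le hu)
    rw [h1, indicator_of_mem (mem_Iic.2 hx), min_eq_left ((quantile_le_iff hu).1 hx),
      Pi.one_apply, mul_one, ← ofReal_measureReal (μ := μ),
      ← ENNReal.ofReal_add measureReal_nonneg (by linarith)]
    congr 1
    ring
  · have h1 : Iic x ∩ Iio (quantile μ u) = Iic x :=
      inter_eq_left.2 fun y hy => (mem_Iic.1 hy).trans_lt hx
    have h2 : μ.real (Iic x) < u := by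
      by_contra! h
      exact absurd ((quantile_le_iff hu).2 h) (not_le.2 hx)
    rw [h1, indicator_of_notMem (by simpa using hx), min_eq_right h2.le, mul_zero, add_zero,
      ofReal_measureReal]

theorem restrict_Iic_eq_leftPart {x : ℝ} (hx : μ.real (Iic x) ∈ Ioo (0 : ℝ) 1) :
    μ.restrict (Iic x) = leftPart μ (μ.real (Iic x)) := by
  rw [leftPart_eq_map hx]
  have hsub := Ioc_subset_Ioo_one le_rfl hx.2
  refine Measure.ext_of_Iic _ _ fun y => ?_
  rw [Measure.map_apply_of_aemeasurable (aemeasurable_quantile measurableSet_Ioc hsub)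
    measurableSet_Iic, Measure.restrict_apply' measurableSet_Ioc, quantile_preimage_inter hsub,
    Ioc_inter_Iic, Real.volume_Ioc, sub_zero, Measure.restrict_apply measurableSet_Iic,
    Iic_inter_Iic, ← ofReal_measureReal]
  congr 1
  rcases le_total x y with h | h
  · rw [min_eq_right h, min_eq_left (measureReal_mono (Iic_subset_Iic.2 h))]
  · rw [min_eq_left h, min_eq_right (measureReal_mono (Iic_subset_Iic.2 h))]

instance isFiniteMeasure_leftPart (u : ℝ) : IsFiniteMeasure (leftPart μ u) := by
  have : IsFiniteMeasure (ENNReal.ofReal (u - μ.real (Iio (quantile μ u))) •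
      Measure.dirac (quantile μ u)) := Measure.smul_finite _ ENNReal.ofReal_ne_top
  unfold leftPart
  infer_instance

theorem leftPart_real_univ {u : ℝ} (hu : u ∈ Ioo (0 : ℝ) 1) : (leftPart μ u).real univ = u := by
  rw [leftPart_eq_map hu, measureReal_def, Measure.map_apply_of_aemeasurable
    (aemeasurable_quantile measurableSet_Ioc (Ioc_subset_Ioo_one le_rfl hu.2)) MeasurableSet.univ]
  simp [hu.1.le]

theorem integrableOn_quantile (hμ : Integrable (fun x : ℝ => x) μ) :
    IntegrableOn (quantile μ) (Ioo 0 1) := by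
  have h := hμ
  rw [← map_quantile (μ := μ)] at h
  exact (integrable_map_measure (by fun_prop)
    (aemeasurable_quantile measurableSet_Ioo le_rfl)).1 h

theorem integrableOn_put_quantile (hμ : Integrable (fun x : ℝ => x) μ) (k : ℝ) :
    IntegrableOn (fun w => max (k - quantile μ w) 0) (Ioo 0 1) :=
  ((integrable_const k).sub (integrableOn_quantile hμ)).pos_part

theorem integral_leftPart {u : ℝ} (hu : u ∈ Ioo (0 : ℝ) 1) {f : ℝ → ℝ} (hf : Continuous f) :
    ∫ x, f x ∂(leftPart μ u) = ∫ w in Ioc 0 u, f (quantile μ w) := by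
  rw [leftPart_eq_map hu, integral_map
    (aemeasurable_quantile measurableSet_Ioc (Ioc_subset_Ioo_one le_rfl hu.2))
    hf.aestronglyMeasurable]

theorem integrable_id_leftPart (hμ : Integrable (fun x : ℝ => x) μ) {u : ℝ}
    (hu : u ∈ Ioo (0 : ℝ) 1) : Integrable (fun x : ℝ => x) (leftPart μ u) := by
  have hsub := Ioc_subset_Ioo_one le_rfl hu.2
  rw [leftPart_eq_map hu]
  exact (integrable_map_measure (by fun_prop) (aemeasurable_quantile measurableSet_Ioc hsub)).2
    ((integrableOn_quantile hμ).mono_set hsub)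

theorem potential_leftPart {u : ℝ} (hu : u ∈ Ioo (0 : ℝ) 1) (k : ℝ) :
    potential (leftPart μ u) k = ∫ w in Ioc 0 u, max (k - quantile μ w) 0 :=
  integral_leftPart hu (f := fun x => max (k - x) 0) (by fun_prop)

theorem potential_eq_setIntegral (k : ℝ) :
    potential μ k = ∫ w in Ioo (0 : ℝ) 1, max (k - quantile μ w) 0 := by
  conv_lhs => rw [potential, ← map_quantile (μ := μ)]
  rw [integral_map (aemeasurable_quantile measurableSet_Ioo le_rfl) (by fun_prop)]

theorem integral_id_eq_setIntegral : ∫ x, x ∂μ = ∫ w in Ioo (0 : ℝ) 1, quantile μ w := by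
  conv_lhs => rw [← map_quantile (μ := μ)]
  rw [integral_map (aemeasurable_quantile measurableSet_Ioo le_rfl) (by fun_prop)]

theorem Ioo_eq_Ioc_union {u : ℝ} (hu : u ∈ Ioo (0 : ℝ) 1) :
    Ioo (0 : ℝ) 1 = Ioc 0 u ∪ Ioo u 1 := (Ioc_union_Ioo_eq_Ioo hu.1.le hu.2).symm

theorem disjoint_Ioc_Ioo (u : ℝ) : Disjoint (Ioc (0 : ℝ) u) (Ioo u 1) :=
  disjoint_left.2 fun _ h1 h2 => absurd h1.2 (not_le.2 h2.1)

theorem potential_sub_leftPart (hμ : Integrable (fun x : ℝ => x) μ) {u : ℝ}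
    (hu : u ∈ Ioo (0 : ℝ) 1) (k : ℝ) : potential μ k - potential (leftPart μ u) k =
      ∫ w in Ioo u 1, max (k - quantile μ w) 0 := by
  have hi := integrableOn_put_quantile hμ k
  rw [potential_eq_setIntegral, potential_leftPart hu, Ioo_eq_Ioc_union hu,
    setIntegral_union (disjoint_Ioc_Ioo u) measurableSet_Ioo
    (hi.mono_set (Ioc_subset_Ioo_one le_rfl hu.2))
    (hi.mono_set (Ioo_subset_Ioo_left hu.1.le))]
  ring

theorem potential_leftPart_le (hμ : Integrable (fun x : ℝ => x) μ) {u : ℝ}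
    (hu : u ∈ Ioo (0 : ℝ) 1) (k : ℝ) : potential (leftPart μ u) k ≤ potential μ k := by
  rw [← sub_nonneg, potential_sub_leftPart hμ hu]
  exact integral_nonneg fun _ => le_max_right _ _

/-- The levels above `u` carry mass at or to the right of `G(u)` only, which puts with strike `k ≤
G(u)` do not see. Thus `𝓔_u` is `D` up to `G(u)`. -/
theorem potential_leftPart_of_le (hμ : Integrable (fun x : ℝ => x) μ) {u k : ℝ}
    (hu : u ∈ Ioo (0 : ℝ) 1) (hk : k ≤ quantile μ u) :
    potential (leftPart μ u) k = potential μ k := by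
  have : potential μ k - potential (leftPart μ u) k = 0 := by
    rw [potential_sub_leftPart hμ hu]
    refine setIntegral_eq_zero_of_forall_eq_zero fun w hw => max_eq_right ?_
    have := quantile_monotoneOn (μ := μ) hu ⟨hu.1.trans hw.1, hw.2⟩ hw.1.le
    linarith
  linarith

/-- Being affine here, this potential leaves `𝓔_u` convex on `[G(u), ∞)`. -/
theorem potential_leftPart_of_ge (hμ : Integrable (fun x : ℝ => x) μ) {u k : ℝ}
    (hu : u ∈ Ioo (0 : ℝ) 1) (hk : quantile μ u ≤ k) :
    potential (leftPart μ u) k = u * k - ∫ x, x ∂(leftPart μ u) := by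
  have hsub := Ioc_subset_Ioo_one le_rfl hu.2
  rw [potential_leftPart hu, integral_leftPart hu (f := fun x => x) continuous_id]
  have : ∫ w in Ioc 0 u, max (k - quantile μ w) 0 = ∫ w in Ioc 0 u, (k - quantile μ w) := by
    refine setIntegral_congr_fun measurableSet_Ioc fun w hw => max_eq_left ?_
    have := quantile_monotoneOn (μ := μ) (hsub hw) hu hw.2
    linarith
  rw [this, integral_sub (integrable_const _) ((integrableOn_quantile hμ).mono_set hsub)]
  simp [hu.1.le]

end Quantile

/-! ### The functions `𝓔_u` -/

section Excess

variable {μ ν : Measure ℝ}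

theorem potDiff_nonneg [IsProbabilityMeasure ν]
    (hν : Integrable (fun x : ℝ => x) ν) (hcx : ConvexOrder μ ν) (k : ℝ) :
    0 ≤ potDiff μ ν k := sub_nonneg.2 (hcx.potential_le hν k)

theorem potDiff_le_excess [IsProbabilityMeasure μ]
    (hμ : Integrable (fun x : ℝ => x) μ) {u : ℝ} (hu : u ∈ Ioo (0 : ℝ) 1)
    (k : ℝ) : potDiff μ ν k ≤ excess μ ν u k :=
  sub_le_sub_left (potential_leftPart_le hμ hu k) _

theorem excess_eq_potDiff [IsProbabilityMeasure μ]
    (hμ : Integrable (fun x : ℝ => x) μ) {u k : ℝ}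
    (hu : u ∈ Ioo (0 : ℝ) 1) (hk : k ≤ quantile μ u) : excess μ ν u k = potDiff μ ν k := by
  rw [excess, potDiff, potential_leftPart_of_le hμ hu hk]

theorem excess_of_ge [IsProbabilityMeasure μ]
    (hμ : Integrable (fun x : ℝ => x) μ) {u k : ℝ}
    (hu : u ∈ Ioo (0 : ℝ) 1) (hk : quantile μ u ≤ k) :
    excess μ ν u k = potential ν k - (u * k - ∫ x, x ∂(leftPart μ u)) := by
  rw [excess, potential_leftPart_of_ge hμ hu hk]

theorem excess_sub_excess [IsProbabilityMeasure μ]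
    (hμ : Integrable (fun x : ℝ => x) μ) {u u' : ℝ}
    (hu : u ∈ Ioo (0 : ℝ) 1) (hu' : u' ∈ Ioo (0 : ℝ) 1) (huu' : u ≤ u') (k : ℝ) :
    excess μ ν u k - excess μ ν u' k = ∫ w in Ioc u u', max (k - quantile μ w) 0 := by
  have hi := integrableOn_put_quantile hμ k
  rw [excess, excess, potential_leftPart hu, potential_leftPart hu',
    ← Ioc_union_Ioc_eq_Ioc hu.1.le huu', setIntegral_union
      (disjoint_left.2 fun _ h1 h2 => absurd h1.2 (not_le.2 h2.1)) measurableSet_Ioc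
      (hi.mono_set (Ioc_subset_Ioo_one le_rfl hu.2))
      (hi.mono_set (Ioc_subset_Ioo_one hu.1.le hu'.2))]
  ring

theorem excessShape [IsProbabilityMeasure μ] [IsProbabilityMeasure ν]
    (hμ : Integrable (fun x : ℝ => x) μ) (hν : Integrable (fun x : ℝ => x) ν)
    (hcx : ConvexOrder μ ν) {u : ℝ} (hu : u ∈ Ioo (0 : ℝ) 1) :
    ExcessShape (excess μ ν u) (quantile μ u) (1 - u) where
  nonneg x := (potDiff_nonneg hν hcx x).trans (potDiff_le_excess hμ hu x)
  cont := (potential_continuous hν).sub (potential_continuous (integrable_id_leftPart hμ hu))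
  tendsto_atBot := by
    have := (potential_tendsto_atBot hν).sub
      (potential_tendsto_atBot (integrable_id_leftPart hμ hu))
    rwa [sub_zero] at this
  subgrad x hx := by
    obtain ⟨p, hp⟩ := exists_mem_subdiff (potential_convexOn hν) x
    refine ⟨p - u, fun y hy => ?_⟩
    rw [excess_of_ge hμ hu hx, excess_of_ge hμ hu hy]
    have := hp y
    linarith
  coercive s hs := by
    have hlin : Tendsto (fun x : ℝ => (1 - u - s) * x + (∫ x, x ∂(leftPart μ u) - ∫ x, x ∂ν))
        atTop atTop :=
      tendsto_atTop_add_const_right _ _ (tendsto_id.const_mul_atTop (by linarith))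
    refine tendsto_atTop_mono' _ ?_ hlin
    filter_upwards [eventually_ge_atTop (quantile μ u)] with x hx
    have := le_potential hν x
    rw [probReal_univ] at this
    rw [excess_of_ge hμ hu hx]
    linarith
  pos := by linarith [hu.2]
  -- As `x → ∞`, `𝓔_u(x) - (1 - u)(x - G(u))` tends to `(1 - u) G(u) - ∫_u^1 G` because the means
  -- agree, and this limit is at most `0` because `G` increases.
  line_le c s hs hle := by
    have hlim := potential_tendsto_atTop hν
    have hmean : ∫ x, x ∂μ = ∫ x, x ∂ν := hcx.integral_id_eq hν
    have hsub := Ioc_subset_Ioo_one (le_refl (0 : ℝ)) hu.2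
    have hG := integrableOn_quantile hμ
    have hconst : (1 - u) * quantile μ u - ∫ x, x ∂ν + ∫ x, x ∂(leftPart μ u) ≤ 0 := by
      have h1 : ∫ x, x ∂μ = ∫ x, x ∂(leftPart μ u) + ∫ w in Ioo u 1, quantile μ w := by
        rw [integral_id_eq_setIntegral, integral_leftPart hu (f := fun x => x)
          continuous_id, Ioo_eq_Ioc_union hu,
          setIntegral_union (disjoint_Ioc_Ioo u) measurableSet_Ioo (hG.mono_set hsub)
          (hG.mono_set (Ioo_subset_Ioo_left hu.1.le))]
      have h2 : ∫ _ in Ioo u 1, quantile μ u ≤ ∫ w in Ioo u 1, quantile μ w := by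
        refine setIntegral_mono_on (integrable_const _)
          (hG.mono_set (Ioo_subset_Ioo_left hu.1.le)) measurableSet_Ioo fun w hw => ?_
        exact quantile_monotoneOn hu ⟨hu.1.trans hw.1, hw.2⟩ hw.1.le
      rw [setIntegral_const, smul_eq_mul, measureReal_def, Real.volume_Ioo,
        ENNReal.toReal_ofReal (by linarith [hu.2])] at h2
      linarith
    refine le_trans ?_ hconst
    rw [← zero_add ((1 - u) * quantile μ u - ∫ x, x ∂ν + ∫ x, x ∂(leftPart μ u))]
    refine ge_of_tendsto (hlim.add_const _) ?_
    filter_upwards [eventually_ge_atTop (quantile μ u)] with x hx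
    have h1 := hle x hx
    rw [excess_of_ge hμ hu hx] at h1
    have h2 : (1 - u) * (x - quantile μ u) ≤ s * (x - quantile μ u) :=
      mul_le_mul_of_nonneg_right hs (by linarith)
    rw [probReal_univ]
    linarith

end Excess

end LeftCurtain

namespace LeftCurtain

open Filter Topology

section Construction

set_option linter.unusedSectionVars false

variable {μ ν : Measure ℝ} [IsProbabilityMeasure μ] [IsProbabilityMeasure ν]

/-! ### The functions `R` and `S` -/

theorem lowerSet_eq (hμ : Integrable (fun x : ℝ => x) μ) {u : ℝ} (hu : u ∈ Ioo (0 : ℝ) 1) :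
    lowerSet μ ν u = {k | k ≤ quantile μ u ∧ excess μ ν u k =
      convexHullFn (excess μ ν u) (quantile μ u) +
      sInf (subdiff (convexHullFn (excess μ ν u)) (quantile μ u)) * (k - quantile μ u)} := by
  ext k
  refine and_congr_right fun hk => ?_
  rw [excess_eq_potDiff hμ hu hk]
  rfl

theorem quantile_le_upperFn (hμ : Integrable (fun x : ℝ => x) μ)
    (hν : Integrable (fun x : ℝ => x) ν) (hcx : ConvexOrder μ ν) {u : ℝ}
    (hu : u ∈ Ioo (0 : ℝ) 1) : quantile μ u ≤ upperFn μ ν u :=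
  (excessShape hμ hν hcx hu).upper_mem.1

theorem hull_upperFn_eq_excess (hμ : Integrable (fun x : ℝ => x) μ)
    (hν : Integrable (fun x : ℝ => x) ν) (hcx : ConvexOrder μ ν) {u : ℝ}
    (hu : u ∈ Ioo (0 : ℝ) 1) :
    excessHull μ ν u (upperFn μ ν u) = excess μ ν u (upperFn μ ν u) :=
  (excessShape hμ hν hcx hu).upper_mem.2

theorem upperFn_le {u z : ℝ} (hz : z ∈ upperSet μ ν u) : upperFn μ ν u ≤ z :=
  csInf_le ⟨quantile μ u, fun _ h => h.1⟩ hz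

theorem lowerFn_mem (hμ : Integrable (fun x : ℝ => x) μ)
    (hν : Integrable (fun x : ℝ => x) ν) (hcx : ConvexOrder μ ν) {u : ℝ}
    (hu : u ∈ lowerDomain μ ν) : lowerFn μ ν u ∈ lowerSet μ ν u :=
  (excessShape hμ hν hcx hu.1).lower_mem (lowerSet_eq hμ hu.1) hu.2.1 hu.2.2

theorem excess_lowerFn (hμ : Integrable (fun x : ℝ => x) μ)
    (hν : Integrable (fun x : ℝ => x) ν) (hcx : ConvexOrder μ ν) {u : ℝ}
    (hu : u ∈ lowerDomain μ ν) : excess μ ν u (lowerFn μ ν u) =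
      excessHull μ ν u (quantile μ u) + slope μ ν u * (lowerFn μ ν u - quantile μ u) := by
  have h := lowerFn_mem hμ hν hcx hu
  rw [excess_eq_potDiff hμ hu.1 h.1]
  exact h.2

theorem hull_eq_line_of_mem_Icc (hμ : Integrable (fun x : ℝ => x) μ)
    (hν : Integrable (fun x : ℝ => x) ν) (hcx : ConvexOrder μ ν) {u k : ℝ}
    (hu : u ∈ lowerDomain μ ν) (hk : k ∈ Icc (lowerFn μ ν u) (upperFn μ ν u)) :
    excessHull μ ν u k =
      excessHull μ ν u (quantile μ u) + slope μ ν u * (k - quantile μ u) :=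
  (excessShape hμ hν hcx hu.1).hull_eq_line (excess_lowerFn hμ hν hcx hu) hk.1 hk.2

theorem hull_lowerFn_eq_excess (hμ : Integrable (fun x : ℝ => x) μ)
    (hν : Integrable (fun x : ℝ => x) ν) (hcx : ConvexOrder μ ν) {u : ℝ}
    (hu : u ∈ lowerDomain μ ν) :
    excessHull μ ν u (lowerFn μ ν u) = excess μ ν u (lowerFn μ ν u) := by
  have h := lowerFn_mem hμ hν hcx hu
  rw [excess_lowerFn hμ hν hcx hu]
  exact hull_eq_line_of_mem_Icc hμ hν hcx hu
    ⟨le_rfl, h.1.trans (quantile_le_upperFn hμ hν hcx hu.1)⟩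

theorem slope_eq_zero_of_notMem (hμ : Integrable (fun x : ℝ => x) μ)
    (hν : Integrable (fun x : ℝ => x) ν) (hcx : ConvexOrder μ ν) {u : ℝ}
    (hu : u ∈ Ioo (0 : ℝ) 1) (hJ : u ∉ lowerDomain μ ν) : slope μ ν u = 0 := by
  refine (excessShape hμ hν hcx hu).slope_eq_zero_of_not fun h => hJ ⟨hu, ?_⟩
  rwa [lowerSet_eq hμ hu]

theorem hull_eq_zero_of_notMem (hμ : Integrable (fun x : ℝ => x) μ)
    (hν : Integrable (fun x : ℝ => x) ν) (hcx : ConvexOrder μ ν) {u k : ℝ}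
    (hu : u ∈ Ioo (0 : ℝ) 1) (hJ : u ∉ lowerDomain μ ν) (hk : k ≤ upperFn μ ν u) :
    excessHull μ ν u k = 0 := by
  have hE := excessShape hμ hν hcx hu
  have h0 := slope_eq_zero_of_notMem hμ hν hcx hu hJ
  have h1 := hE.hull_upper
  have h2 : excessHull μ ν u (upperFn μ ν u) = 0 := by
    refine h1.trans ?_
    rw [hE.hull_eq_zero_of_slope_eq_zero h0]
    change 0 + slope μ ν u * _ = 0
    rw [h0]
    ring
  exact le_antisymm ((hE.hull_mono hk).trans h2.le) (hE.hull_nonneg k)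

/-! ### Comparison of two levels -/

theorem le_excess_sub_excess (hμ : Integrable (fun x : ℝ => x) μ) {u u' : ℝ}
    (hu : u ∈ Ioo (0 : ℝ) 1) (hu' : u' ∈ Ioo (0 : ℝ) 1) (huu' : u ≤ u') (k : ℝ) :
    (u' - u) * max (k - quantile μ u') 0 ≤ excess μ ν u k - excess μ ν u' k := by
  have hsub := Ioc_subset_Ioo_one hu.1.le hu'.2
  rw [excess_sub_excess hμ hu hu' huu']
  have h : ∫ _ in Ioc u u', max (k - quantile μ u') 0 = (u' - u) * max (k - quantile μ u') 0 := by
    rw [setIntegral_const, measureReal_def, Real.volume_Ioc, smul_eq_mul,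
      ENNReal.toReal_ofReal (sub_nonneg.2 huu')]
  rw [← h]
  refine setIntegral_mono_on (integrable_const _)
    ((integrableOn_put_quantile hμ k).mono_set hsub) measurableSet_Ioc fun w hw => ?_
  have := quantile_monotoneOn (μ := μ) (hsub hw) hu' hw.2
  exact max_le_max (by linarith) le_rfl

theorem excess_sub_excess_le (hμ : Integrable (fun x : ℝ => x) μ) {u u' : ℝ}
    (hu : u ∈ Ioo (0 : ℝ) 1) (hu' : u' ∈ Ioo (0 : ℝ) 1) (huu' : u ≤ u') (k : ℝ) :
    excess μ ν u k - excess μ ν u' k ≤ (u' - u) * max (k - quantile μ u) 0 := by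
  have hsub := Ioc_subset_Ioo_one hu.1.le hu'.2
  rw [excess_sub_excess hμ hu hu' huu']
  have h : ∫ _ in Ioc u u', max (k - quantile μ u) 0 = (u' - u) * max (k - quantile μ u) 0 := by
    rw [setIntegral_const, measureReal_def, Real.volume_Ioc, smul_eq_mul,
      ENNReal.toReal_ofReal (sub_nonneg.2 huu')]
  rw [← h]
  refine setIntegral_mono_on ((integrableOn_put_quantile hμ k).mono_set hsub)
    (integrable_const _) measurableSet_Ioc fun w hw => ?_
  have := quantile_monotoneOn (μ := μ) hu (hsub hw) hw.1.le
  exact max_le_max (by linarith) le_rfl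

theorem excess_sub_excess_mono (hμ : Integrable (fun x : ℝ => x) μ) {u u' : ℝ}
    (hu : u ∈ Ioo (0 : ℝ) 1) (hu' : u' ∈ Ioo (0 : ℝ) 1) (huu' : u ≤ u') :
    Monotone fun k => excess μ ν u k - excess μ ν u' k := by
  have hsub := Ioc_subset_Ioo_one hu.1.le hu'.2
  intro x y hxy
  simp only [excess_sub_excess hμ hu hu' huu']
  refine setIntegral_mono_on ((integrableOn_put_quantile hμ x).mono_set hsub)
    ((integrableOn_put_quantile hμ y).mono_set hsub) measurableSet_Ioc fun w _ => ?_
  exact max_le_max (by linarith) le_rfl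

theorem excess_sub_excess_convexOn (hμ : Integrable (fun x : ℝ => x) μ) {u u' : ℝ}
    (hu : u ∈ Ioo (0 : ℝ) 1) (hu' : u' ∈ Ioo (0 : ℝ) 1) (huu' : u ≤ u') :
    ConvexOn ℝ univ fun k => excess μ ν u k - excess μ ν u' k := by
  have hsub := Ioc_subset_Ioo_one hu.1.le hu'.2
  have hi := fun k => (integrableOn_put_quantile hμ k).mono_set hsub
  simp only [excess_sub_excess hμ hu hu' huu']
  refine ⟨convex_univ, fun x _ y _ a b ha hb hab => ?_⟩
  simp only [smul_eq_mul]
  rw [← integral_const_mul, ← integral_const_mul,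
    ← integral_add ((hi x).const_mul a) ((hi y).const_mul b)]
  refine integral_mono (hi _) (((hi x).const_mul a).add ((hi y).const_mul b)) fun w => ?_
  exact (convexOn_put_swap w).2 (mem_univ x) (mem_univ y) ha hb hab
where
  convexOn_put_swap (w : ℝ) : ConvexOn ℝ univ fun k : ℝ => max (k - quantile μ w) 0 := by
    have h1 : ConvexOn ℝ univ fun k : ℝ => k - quantile μ w := by
      have := convexOn_affine 0 1 (quantile μ w)
      simpa using this
    exact h1.sup (convexOn_const 0 convex_univ)

/-- Adding the convex function `𝓔_u - 𝓔_{u'}` to the hull at `u'` gives a convex minorant of `𝓔_u`.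
-/
theorem hull_add_le_hull (hμ : Integrable (fun x : ℝ => x) μ)
    (hν : Integrable (fun x : ℝ => x) ν) (hcx : ConvexOrder μ ν) {u u' : ℝ}
    (hu : u ∈ Ioo (0 : ℝ) 1) (hu' : u' ∈ Ioo (0 : ℝ) 1) (huu' : u ≤ u') (k : ℝ) :
    excessHull μ ν u' k + (excess μ ν u k - excess μ ν u' k) ≤ excessHull μ ν u k := by
  have hE := excessShape hμ hν hcx hu'
  refine le_convexHullFn (f := excess μ ν u)
    (h := fun k => excessHull μ ν u' k + (excess μ ν u k - excess μ ν u' k))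
    (hE.hull_convexOn.add (excess_sub_excess_convexOn hμ hu hu' huu')) (fun x => ?_) k
  have : excessHull μ ν u' x ≤ excess μ ν u' x := hE.hull_le x
  linarith

theorem excess_anti (hμ : Integrable (fun x : ℝ => x) μ) {u u' : ℝ}
    (hu : u ∈ Ioo (0 : ℝ) 1) (hu' : u' ∈ Ioo (0 : ℝ) 1) (huu' : u ≤ u') (k : ℝ) :
    excess μ ν u' k ≤ excess μ ν u k := by
  have h1 := le_excess_sub_excess (ν := ν) hμ hu hu' huu' k
  have h2 := mul_nonneg (sub_nonneg.2 huu') (le_max_right (k - quantile μ u') 0)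
  linarith

/-- Contact points persist when the level decreases; this is the source of the monotonicity of `S`
and of the condition on `R`. -/
theorem hull_eq_excess_of_hull_eq_excess (hμ : Integrable (fun x : ℝ => x) μ)
    (hν : Integrable (fun x : ℝ => x) ν) (hcx : ConvexOrder μ ν) {u u' : ℝ}
    (hu : u ∈ Ioo (0 : ℝ) 1) (hu' : u' ∈ Ioo (0 : ℝ) 1) (huu' : u ≤ u') {k : ℝ}
    (hk : excessHull μ ν u' k = excess μ ν u' k) : excessHull μ ν u k = excess μ ν u k := by
  refine le_antisymm ((excessShape hμ hν hcx hu).hull_le k) ?_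
  have := hull_add_le_hull hμ hν hcx hu hu' huu' k
  linarith

theorem upperFn_monotoneOn (hμ : Integrable (fun x : ℝ => x) μ)
    (hν : Integrable (fun x : ℝ => x) ν) (hcx : ConvexOrder μ ν) :
    MonotoneOn (upperFn μ ν) (Ioo 0 1) := fun _ hu _ hu' huu' =>
  upperFn_le ⟨(quantile_monotoneOn hu hu' huu').trans (quantile_le_upperFn hμ hν hcx hu'),
    hull_eq_excess_of_hull_eq_excess hμ hν hcx hu hu' huu'
      (hull_upperFn_eq_excess hμ hν hcx hu')⟩

/-- `𝓔_u` vanishes at `S(u)`. Were `S(u) > G(u')`, passing to level `u'` would make `𝓔_{u'}`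
negative there. -/
theorem upperFn_le_quantile_of_notMem (hμ : Integrable (fun x : ℝ => x) μ)
    (hν : Integrable (fun x : ℝ => x) ν) (hcx : ConvexOrder μ ν) {u u' : ℝ}
    (hu : u ∈ Ioo (0 : ℝ) 1) (hJ : u ∉ lowerDomain μ ν) (hu' : u' ∈ Ioo (0 : ℝ) 1)
    (huu' : u < u') : upperFn μ ν u ≤ quantile μ u' := by
  have h0 := hull_eq_zero_of_notMem hμ hν hcx hu hJ le_rfl
  rw [hull_upperFn_eq_excess hμ hν hcx hu] at h0
  have h1 := le_excess_sub_excess (ν := ν) hμ hu hu' huu'.le (upperFn μ ν u)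
  have h2 := (excessShape hμ hν hcx hu').nonneg (upperFn μ ν u)
  by_contra! hlt
  rw [max_eq_left (by linarith)] at h1
  nlinarith [mul_pos (sub_pos.2 huu') (sub_pos.2 hlt)]

/-- The nonempty open intervals `(G(u), S(u))` of these levels are pairwise disjoint. -/
theorem countable_notMem_lowerDomain (hμ : Integrable (fun x : ℝ => x) μ)
    (hν : Integrable (fun x : ℝ => x) ν) (hcx : ConvexOrder μ ν) :
    {u ∈ Ioo (0 : ℝ) 1 \ lowerDomain μ ν | upperFn μ ν u ≠ quantile μ u}.Countable := by
  refine PairwiseDisjoint.countable_of_isOpen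
    (s := fun u => Ioo (quantile μ u) (upperFn μ ν u)) ?_ (fun _ _ => isOpen_Ioo) ?_
  · have key : ∀ u ∈ {u ∈ Ioo (0 : ℝ) 1 \ lowerDomain μ ν | upperFn μ ν u ≠ quantile μ u},
        ∀ u' ∈ {u ∈ Ioo (0 : ℝ) 1 \ lowerDomain μ ν | upperFn μ ν u ≠ quantile μ u}, u < u' →
        Disjoint (Ioo (quantile μ u) (upperFn μ ν u)) (Ioo (quantile μ u') (upperFn μ ν u')) := by
      intro u hu u' hu' h
      refine disjoint_left.2 fun x hx hx' => ?_
      have := upperFn_le_quantile_of_notMem hμ hν hcx hu.1.1 hu.1.2 hu'.1.1 h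
      exact absurd (hx.2.trans_le this) (not_lt.2 hx'.1.le)
    intro u hu u' hu' hne
    rcases lt_or_gt_of_ne hne with h | h
    · exact key u hu u' hu' h
    · exact (key u' hu' u hu h).symm
  · intro u hu
    exact nonempty_Ioo.2
      (lt_of_le_of_ne (quantile_le_upperFn hμ hν hcx hu.1.1) (Ne.symm hu.2))

/-- If `R(u)` were not real, `D` would vanish at `s = S(u)`, so the interval `{D > 0}`, and with it
all of `μ`, would lie on one side of `s`. But `G(u) ≤ s ≤ G(u')` for `u < u' < 1` leaves mass on
`Iic s` and not full mass on `Iio s`. -/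
theorem lowerDomain_eq_of_irreducible (hμ : Integrable (fun x : ℝ => x) μ)
    (hν : Integrable (fun x : ℝ => x) ν) (hcx : ConvexOrder μ ν)
    (hI : OrdConnected {k : ℝ | 0 < potDiff μ ν k}) (hI1 : μ {k : ℝ | 0 < potDiff μ ν k} = 1) :
    lowerDomain μ ν = Ioo (0 : ℝ) 1 := by
  refine Subset.antisymm (fun u hu => hu.1) fun u hu => ?_
  by_contra hJ
  set s := upperFn μ ν u with hs
  have h0 := hull_eq_zero_of_notMem hμ hν hcx hu hJ le_rfl
  rw [hull_upperFn_eq_excess hμ hν hcx hu] at h0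
  have hsI : s ∉ {k : ℝ | 0 < potDiff μ ν k} := fun h => by
    have h1 := potDiff_le_excess (ν := ν) hμ hu s
    have h2 : 0 < potDiff μ ν s := h
    linarith
  by_cases hIs : {k : ℝ | 0 < potDiff μ ν k} ⊆ Iio s
  · obtain ⟨u', hu'⟩ := exists_between hu.2
    have hu'' : u' ∈ Ioo (0 : ℝ) 1 := ⟨hu.1.trans hu'.1, hu'.2⟩
    have h1 : (1 : ENNReal) ≤ ENNReal.ofReal u' := by
      rw [← hI1]
      refine (measure_mono (hIs.trans (Iio_subset_Iio ?_))).trans (measure_Iio_quantile_le hu'')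
      exact upperFn_le_quantile_of_notMem hμ hν hcx hu hJ hu'' hu'.1
    rw [ENNReal.one_le_ofReal] at h1
    linarith [hu'.2]
  · obtain ⟨y, hy, hys⟩ := not_subset.1 hIs
    have hsub : {k : ℝ | 0 < potDiff μ ν k} ⊆ (Iic s)ᶜ := fun x hx hxs =>
      hsI (hI.out hx hy ⟨hxs, not_lt.1 hys⟩)
    have h1 : μ (Iic s)ᶜ = 1 := le_antisymm prob_le_one (hI1 ▸ measure_mono hsub)
    have h2 : μ (Iic s) = 0 := (prob_compl_eq_one_iff measurableSet_Iic).1 h1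
    have h3 := (quantile_le_iff hu).1 (quantile_le_upperFn hμ hν hcx hu)
    rw [measureReal_def, ← hs, h2, ENNReal.toReal_zero] at h3
    linarith [hu.1]

theorem leftMonotoneOn (hμ : Integrable (fun x : ℝ => x) μ)
    (hν : Integrable (fun x : ℝ => x) ν) (hcx : ConvexOrder μ ν) :
    LeftMonotoneOn (quantile μ) (lowerFn μ ν) (upperFn μ ν) (lowerDomain μ ν) := by
  refine ⟨fun u hu => ⟨(lowerFn_mem hμ hν hcx hu).1, quantile_le_upperFn hμ hν hcx hu.1⟩,
    fun u hu u' hu' huu' => ⟨upperFn_monotoneOn hμ hν hcx hu.1 hu'.1 huu'.le, fun hr => ?_⟩⟩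
  set r := lowerFn μ ν u with hrdef
  set r' := lowerFn μ ν u' with hr'def
  have hE := excessShape hμ hν hcx hu.1
  have hE' := excessShape hμ hν hcx hu'.1
  have htouch' := hull_lowerFn_eq_excess hμ hν hcx hu'
  have htouch := hull_eq_excess_of_hull_eq_excess hμ hν hcx hu.1 hu'.1 huu'.le htouch'
  rw [← hr'def] at htouch htouch'
  -- The contact at `r'` persists at level `u`. A contact at or beyond `G(u)` would not come before
  -- `S(u)`.
  have hr'G : r' < quantile μ u := by
    by_contra! h
    exact absurd (upperFn_le ⟨h, htouch⟩) (not_le.2 hr.2)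
  have hmem := lowerFn_mem hμ hν hcx hu
  have hmem' := lowerFn_mem hμ hν hcx hu'
  have hGS := quantile_le_upperFn hμ hν hcx hu.1
  have hGG := quantile_monotoneOn (μ := μ) hu.1 hu'.1 huu'.le
  -- the supporting line at `u'` lies below the one at `u` on `[r, G u]` and meets it at `r'`
  have hle : ∀ x, excessHull μ ν u' (quantile μ u') + slope μ ν u' * (x - quantile μ u') ≤
      excessHull μ ν u x := fun x => by
    have h1 : excessHull μ ν u' (quantile μ u') + slope μ ν u' * (x - quantile μ u') ≤
      excessHull μ ν u' x := hE'.line_le_hull_apply x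
    have h2 := hull_add_le_hull hμ hν hcx hu.1 hu'.1 huu'.le x
    have h3 := excess_anti (ν := ν) hμ hu.1 hu'.1 huu'.le x
    linarith
  have e1 := hull_eq_line_of_mem_Icc hμ hν hcx hu ⟨hr.1.le, hr.2.le⟩
  have e2 := hull_eq_line_of_mem_Icc hμ hν hcx hu (k := r) ⟨le_rfl, hmem.1.trans hGS⟩
  have e3 := excess_eq_potDiff (ν := ν) hμ hu.1 hr'G.le
  have e4 := hmem'.2
  have l1 := hle r
  have l2 := hle (quantile μ u)
  rw [← hr'def] at e4
  -- Below the other line at `r` and at `G(u)`, and equal to it at `r'` in between: the two lines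
  -- coincide. Then `D` meets the line of `u'` at `r` too, against the minimality of `r'`.
  have hslope : slope μ ν u' = slope μ ν u := by
    refine le_antisymm ?_ ?_
    · refine le_of_mul_le_mul_right ?_ (sub_pos.2 hr'G)
      linarith
    · refine le_of_mul_le_mul_right ?_ (sub_pos.2 hr.1)
      linarith
  have hrmem : r ∈ lowerSet μ ν u' := by
    refine ⟨hmem.1.trans hGG, ?_⟩
    rw [hmem.2, hslope]
    rw [hslope] at e4
    linarith
  exact absurd (csInf_le hu'.2.2 hrmem) (not_le.2 hr.1)

end Construction

end LeftCurtain

/-! ### Increments of the hull in the level -/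

namespace LeftCurtain

open Filter Topology

section Increments

set_option linter.unusedSectionVars false

variable {μ ν : Measure ℝ} [IsProbabilityMeasure μ] [IsProbabilityMeasure ν]

open Classical in
/-- The potential at `k` of the law of `Y(u, V)`, for `u ∈ J`. For the other `u` it is the limit
of such potentials for `R → -∞`. -/
noncomputable def targetPotential (μ ν : Measure ℝ) (k u : ℝ) : ℝ :=
  if upperFn μ ν u ≤ k then k - quantile μ u
  else if u ∈ lowerDomain μ ν then
    if k ≤ lowerFn μ ν u then 0
    else (k - lowerFn μ ν u) * (upperFn μ ν u - quantile μ u) / (upperFn μ ν u - lowerFn μ ν u)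
  else upperFn μ ν u - quantile μ u

theorem targetPotential_nonneg (hμ : Integrable (fun x : ℝ => x) μ)
    (hν : Integrable (fun x : ℝ => x) ν) (hcx : ConvexOrder μ ν) {u : ℝ}
    (hu : u ∈ Ioo (0 : ℝ) 1) (k : ℝ) : 0 ≤ targetPotential μ ν k u := by
  have hGS := quantile_le_upperFn hμ hν hcx hu
  unfold targetPotential
  split_ifs with h1 h2 h3
  · linarith
  · exact le_rfl
  · have h4 := (lowerFn_mem hμ hν hcx h2).1
    have h5 := not_le.1 h3
    exact div_nonneg (mul_nonneg (by linarith) (by linarith)) (by linarith)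
  · linarith

/-- The decrease of the hull from level `u` to `u'` dominates the potential of the fibre law at `u`,
up to the increment of the quantile function. -/
theorem mul_sub_le_hull_sub_hull (hμ : Integrable (fun x : ℝ => x) μ)
    (hν : Integrable (fun x : ℝ => x) ν) (hcx : ConvexOrder μ ν) {u u' : ℝ}
    (hu : u ∈ Ioo (0 : ℝ) 1) (hu' : u' ∈ Ioo (0 : ℝ) 1) (huu' : u < u') (k : ℝ) :
    (u' - u) * (targetPotential μ ν k u - (quantile μ u' - quantile μ u)) ≤
      excessHull μ ν u k - excessHull μ ν u' k := by
  have hGS := quantile_le_upperFn hμ hν hcx hu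
  have hGG := quantile_monotoneOn (μ := μ) hu hu' huu'.le
  have hE' := excessShape hμ hν hcx hu'
  have hΔ := sub_pos.2 huu'
  have hq := le_excess_sub_excess (ν := ν) hμ hu hu' huu'.le
  have hadd := hull_add_le_hull hμ hν hcx hu hu' huu'.le k
  have hmono : 0 ≤ excessHull μ ν u k - excessHull μ ν u' k := by
    have := excess_anti (ν := ν) hμ hu hu' huu'.le k
    linarith
  unfold targetPotential
  split_ifs with h1 h2 h3
  · have h4 := mul_le_mul_of_nonneg_left (le_max_left (k - quantile μ u') 0) hΔ.le
    have h5 := hq k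
    nlinarith
  · have := mul_nonneg hΔ.le (sub_nonneg.2 hGG)
    linarith
  · have hRG := (lowerFn_mem hμ hν hcx h2).1
    set r := lowerFn μ ν u
    set s := upperFn μ ν u
    have hkr := not_le.1 h3
    have hks := not_le.1 h1
    have hrs : 0 < s - r := by linarith
    -- On `[r, s]` the hull at `u` is a chord of `𝓔_u`, while the hull at `u'` lies below the chord
    -- of `𝓔_{u'}`. So the drop at `k` is at least the interpolated drop at the end points.
    have c1 := three_point_le hE'.hull_convexOn hkr.le hks.le
    have c2 : convexHullFn (excess μ ν u') r ≤ excess μ ν u' r := hE'.hull_le r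
    have c3 : convexHullFn (excess μ ν u') s ≤ excess μ ν u' s := hE'.hull_le s
    have c4 := excess_anti (ν := ν) hμ hu hu' huu'.le r
    have c5 := (mul_le_mul_of_nonneg_left (le_max_left (s - quantile μ u') 0) hΔ.le).trans (hq s)
    have l1 := hull_eq_line_of_mem_Icc hμ hν hcx h2 ⟨hkr.le, hks.le⟩
    have l2 := hull_eq_line_of_mem_Icc hμ hν hcx h2 (k := r) ⟨le_rfl, by linarith⟩
    have l3 := hull_eq_line_of_mem_Icc hμ hν hcx h2 (k := s) ⟨by linarith, le_rfl⟩
    rw [hull_lowerFn_eq_excess hμ hν hcx h2] at l2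
    rw [hull_upperFn_eq_excess hμ hν hcx hu] at l3
    set d := quantile μ u' - quantile μ u with hd
    have hp : (k - r) * (s - quantile μ u) / (s - r) * (s - r) = (k - r) * (s - quantile μ u) :=
      div_mul_cancel₀ _ hrs.ne'
    set p := (k - r) * (s - quantile μ u) / (s - r)
    refine le_of_mul_le_mul_right ?_ hrs
    have m1 := mul_le_mul_of_nonneg_right (c2.trans c4) (sub_nonneg.2 hks.le)
    have m2 := mul_le_mul_of_nonneg_right
      (c3.trans (by linarith : excess μ ν u' s ≤ excess μ ν u s - (u' - u) * (s - quantile μ u')))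
      (sub_nonneg.2 hkr.le)
    have m3 : (excessHull μ ν u k - excessHull μ ν u' k) * (s - r) ≥
        (u' - u) * ((s - quantile μ u') * (k - r)) := by
      have : excessHull μ ν u' k * (s - r) ≤ excess μ ν u r * (s - k) +
          (excess μ ν u s - (u' - u) * (s - quantile μ u')) * (k - r) := c1.trans (add_le_add m1 m2)
      rw [show excess μ ν u r = _ from l2, show excess μ ν u s = _ from l3] at this
      rw [l1]
      linarith
    have m4 : (u' - u) * ((p - d) * (s - r)) ≤ (u' - u) * ((s - quantile μ u') * (k - r)) := by
      refine mul_le_mul_of_nonneg_left ?_ hΔ.le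
      rw [sub_mul, hp]
      have : d * (k - r) ≤ d * (s - r) :=
        mul_le_mul_of_nonneg_left (by linarith) (sub_nonneg.2 hGG)
      have e : quantile μ u' = quantile μ u + d := by rw [hd]; ring
      rw [e]
      linarith
    linarith
  -- Outside `J` the left-hand side is not positive, since `S(u) ≤ G(u')`.
  · have h4 := upperFn_le_quantile_of_notMem hμ hν hcx hu h2 hu' huu'
    have := mul_nonneg hΔ.le (sub_nonneg.2 h4)
    linarith

/-- The counterpart of `mul_sub_le_hull_sub_hull`, now with the geometry of the larger level `u'`,
whose contact points control the hull at `u` from above. -/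
theorem hull_sub_hull_le_mul (hμ : Integrable (fun x : ℝ => x) μ)
    (hν : Integrable (fun x : ℝ => x) ν) (hcx : ConvexOrder μ ν) {u u' : ℝ}
    (hu : u ∈ Ioo (0 : ℝ) 1) (hu' : u' ∈ Ioo (0 : ℝ) 1) (huu' : u < u') (k : ℝ) :
    excessHull μ ν u k - excessHull μ ν u' k ≤
      (u' - u) * (targetPotential μ ν k u' + (quantile μ u' - quantile μ u)) := by
  have hGS := quantile_le_upperFn hμ hν hcx hu'
  have hGG := quantile_monotoneOn (μ := μ) hu hu' huu'.le
  have hE := excessShape hμ hν hcx hu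
  have hE' := excessShape hμ hν hcx hu'
  have hΔ := sub_pos.2 huu'
  have hq := excess_sub_excess_le (ν := ν) hμ hu hu' huu'.le
  have hqm := excess_sub_excess_mono (ν := ν) hμ hu hu' huu'.le
  -- To the left of a contact point `c`, the increasing function `𝓔_u - 𝓔_{u'}` is at most its value
  -- at `c`. The cases below take `c` to be `k`, `R(u')` or `S(u')`; strictly between the last two,
  -- in `J`, chords are compared instead.
  have hleft : ∀ c, k ≤ c → excessHull μ ν u' c = excess μ ν u' c →
      excessHull μ ν u k ≤ excessHull μ ν u' k + (excess μ ν u c - excess μ ν u' c) := by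
    intro c hkc hc
    refine hE'.le_hull_add_of_touch hE.hull_convexOn (fun x hx => ?_) hc hkc
    have h1 := hqm hx
    have h2 : convexHullFn (excess μ ν u) x ≤ excess μ ν u x := hE.hull_le x
    simp only at h1
    linarith
  unfold targetPotential
  split_ifs with h1 h2 h3
  · have h4 : excessHull μ ν u' k = excess μ ν u' k := hE'.hull_eq_of_upper_le h1
    have h5 := hleft k le_rfl h4
    have h6 := hq k
    rw [max_eq_left (by linarith)] at h6
    linarith
  · have hRG := (lowerFn_mem hμ hν hcx h2).1
    have h4 := hleft _ h3 (hull_lowerFn_eq_excess hμ hν hcx h2)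
    have h5 := (hqm hRG).trans (hq (quantile μ u'))
    rw [max_eq_left (by linarith)] at h5
    simp only at h5
    linarith
  · have hRG := (lowerFn_mem hμ hν hcx h2).1
    set r := lowerFn μ ν u'
    set s := upperFn μ ν u'
    have hkr := not_le.1 h3
    have hks := not_le.1 h1
    have hrs : 0 < s - r := by linarith
    have c1 := three_point_le hE.hull_convexOn hkr.le hks.le
    have c2 : convexHullFn (excess μ ν u) r ≤ excess μ ν u r := hE.hull_le r
    have c3 : convexHullFn (excess μ ν u) s ≤ excess μ ν u s := hE.hull_le s
    have c4 := hq r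
    have c5 := hq s
    have l1 := hull_eq_line_of_mem_Icc hμ hν hcx h2 ⟨hkr.le, hks.le⟩
    have l2 := hull_eq_line_of_mem_Icc hμ hν hcx h2 (k := r) ⟨le_rfl, by linarith⟩
    have l3 := hull_eq_line_of_mem_Icc hμ hν hcx h2 (k := s) ⟨by linarith, le_rfl⟩
    rw [hull_lowerFn_eq_excess hμ hν hcx h2] at l2
    rw [hull_upperFn_eq_excess hμ hν hcx hu'] at l3
    set d := quantile μ u' - quantile μ u with hd
    have hp : (k - r) * (s - quantile μ u') / (s - r) * (s - r) = (k - r) * (s - quantile μ u') :=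
      div_mul_cancel₀ _ hrs.ne'
    set p := (k - r) * (s - quantile μ u') / (s - r)
    refine le_of_mul_le_mul_right ?_ hrs
    rw [max_eq_left (by linarith)] at c5
    have c4' : (u' - u) * max (r - quantile μ u) 0 ≤ (u' - u) * d :=
      mul_le_mul_of_nonneg_left (max_le (by linarith) (sub_nonneg.2 hGG)) hΔ.le
    have m1 := mul_le_mul_of_nonneg_right
      (c2.trans (by linarith : excess μ ν u r ≤ excess μ ν u' r + (u' - u) * d))
      (sub_nonneg.2 hks.le)
    have m2 := mul_le_mul_of_nonneg_right
      (c3.trans (by linarith : excess μ ν u s ≤ excess μ ν u' s + (u' - u) * (s - quantile μ u)))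
      (sub_nonneg.2 hkr.le)
    have m3 : excessHull μ ν u k * (s - r) ≤ (excess μ ν u' r + (u' - u) * d) * (s - k) +
        (excess μ ν u' s + (u' - u) * (s - quantile μ u)) * (k - r) := c1.trans (add_le_add m1 m2)
    have m4 : (u' - u) * (p + d) * (s - r) =
        (u' - u) * (d * (s - k) + (s - quantile μ u) * (k - r)) := by
      have e : quantile μ u = quantile μ u' - d := by rw [hd]; ring
      rw [mul_assoc, add_mul, hp, e]
      ring
    rw [m4, l1]
    rw [show excess μ ν u' r = _ from l2, show excess μ ν u' s = _ from l3] at m3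
    linarith
  · have h4 := hleft _ (not_le.1 h1).le (hull_upperFn_eq_excess hμ hν hcx hu')
    have h5 := hq (upperFn μ ν u')
    rw [max_eq_left (by linarith)] at h5
    linarith

end Increments

end LeftCurtain

/-! ### Integration over the levels and limits at `0` and `1` -/

namespace LeftCurtain

open Filter Topology

theorem continuousOn_setIntegral_Ioc {φ : ℝ → ℝ} (hφ : IntegrableOn φ (Ioo 0 1)) :
    ContinuousOn (fun u => ∫ w in Ioc 0 u, φ w) (Icc 0 1) := by
  have h : IntegrableOn φ (uIcc 0 1) := by
    rw [uIcc_of_le zero_le_one]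
    exact (integrableOn_Icc_iff_integrableOn_Ioo).2 hφ
  have := intervalIntegral.continuousOn_primitive_interval h
  rw [uIcc_of_le zero_le_one] at this
  exact this.congr fun u hu => (intervalIntegral.integral_of_le hu.1).symm

theorem tendsto_setIntegral_Ioc_zero {φ : ℝ → ℝ} (hφ : IntegrableOn φ (Ioo 0 1)) :
    Tendsto (fun u => ∫ w in Ioc 0 u, φ w) (𝓝[>] 0) (𝓝 0) := by
  have h := (continuousOn_setIntegral_Ioc hφ).continuousWithinAt (left_mem_Icc.2 zero_le_one)
  have h2 := h.tendsto.mono_left (nhdsWithin_mono 0 (Ioo_subset_Icc_self (a := (0 : ℝ)) (b := 1)))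
  rw [nhdsWithin_Ioo_eq_nhdsGT zero_lt_one] at h2
  simpa using h2

theorem tendsto_setIntegral_Ioc_one {φ : ℝ → ℝ} (hφ : IntegrableOn φ (Ioo 0 1)) :
    Tendsto (fun u => ∫ w in Ioc 0 u, φ w) (𝓝[<] 1) (𝓝 (∫ w in Ioo 0 1, φ w)) := by
  have h := (continuousOn_setIntegral_Ioc hφ).continuousWithinAt (right_mem_Icc.2 zero_le_one)
  have h2 := h.tendsto.mono_left (nhdsWithin_mono 1 (Ioo_subset_Icc_self (a := (0 : ℝ)) (b := 1)))
  rw [nhdsWithin_Ioo_eq_nhdsLT zero_lt_one, integral_Ioc_eq_integral_Ioo] at h2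
  exact h2

section Limits

variable {μ ν : Measure ℝ} [IsProbabilityMeasure μ] [IsProbabilityMeasure ν]

theorem integral_targetPotential (hμ : Integrable (fun x : ℝ => x) μ)
    (hν : Integrable (fun x : ℝ => x) ν) (hcx : ConvexOrder μ ν) (k : ℝ) {a b : ℝ}
    (ha : 0 < a) (hab : a ≤ b) (hb : b < 1) :
    IntervalIntegrable (targetPotential μ ν k) volume a b ∧
    ∫ w in a..b, targetPotential μ ν k w = excessHull μ ν a k - excessHull μ ν b k := by
  have hsub : Icc a b ⊆ Ioo 0 1 := fun x hx => ⟨ha.trans_le hx.1, hx.2.trans_lt hb⟩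
  have h := integral_eq_sub_of_increment_bounds hab (f := fun u => - excessHull μ ν u k)
    (p := targetPotential μ ν k) (g := quantile μ) (quantile_monotoneOn.mono hsub)
    (fun x hx y hy hxy => by
      have := mul_sub_le_hull_sub_hull hμ hν hcx (hsub hx) (hsub hy) hxy k
      linarith)
    (fun x hx y hy hxy => by
      have := hull_sub_hull_le_mul hμ hν hcx (hsub hx) (hsub hy) hxy k
      linarith)
  refine ⟨h.1, h.2.trans (by ring)⟩

/-- On `(-∞, c]` one has `P_ν ≤ 𝓔_u + P_{μ_u}(c)`, and the hull touches `𝓔_u` at `c`. The error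
`P_{μ_u}(c)` vanishes as `u → 0`. -/
theorem potential_leftPart_le_max (hμ : Integrable (fun x : ℝ => x) μ)
    (hν : Integrable (fun x : ℝ => x) ν) (hcx : ConvexOrder μ ν) {u : ℝ}
    (hu : u ∈ Ioo (0 : ℝ) 1) {k c : ℝ} (hk : k ≤ c) (hc : upperFn μ ν u ≤ c) :
    potential ν k ≤ excessHull μ ν u k + potential (leftPart μ u) c := by
  have hE := excessShape hμ hν hcx hu
  refine hE.le_hull_add_of_touch (potential_convexOn hν) (fun x hx => ?_)
    (hE.hull_eq_of_upper_le hc) hk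
  have := potential_mono (integrable_id_leftPart hμ hu) hx
  rw [excess]
  linarith

theorem tendsto_excessHull_zero (hμ : Integrable (fun x : ℝ => x) μ)
    (hν : Integrable (fun x : ℝ => x) ν) (hcx : ConvexOrder μ ν) (k : ℝ) :
    Tendsto (fun u => excessHull μ ν u k) (𝓝[>] 0) (𝓝 (potential ν k)) := by
  -- Monotonicity of `S` makes one `c` serve for all levels below `1 / 2`.
  set c := max k (upperFn μ ν (1 / 2))
  have hlim := tendsto_setIntegral_Ioc_zero (integrableOn_put_quantile hμ c)
  have hmem : ∀ᶠ u : ℝ in 𝓝[>] 0, u ∈ Ioo (0 : ℝ) (1 / 2) := Ioo_mem_nhdsGT (by norm_num)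
  have hlow : Tendsto (fun u => potential ν k - ∫ w in Ioc 0 u, max (c - quantile μ w) 0)
      (𝓝[>] 0) (𝓝 (potential ν k)) := by
    simpa using hlim.const_sub (potential ν k)
  refine tendsto_of_tendsto_of_tendsto_of_le_of_le' hlow tendsto_const_nhds ?_ ?_
  · filter_upwards [hmem] with u hu
    have hu' : u ∈ Ioo (0 : ℝ) 1 := ⟨hu.1, hu.2.trans (by norm_num)⟩
    have h1 := potential_leftPart_le_max hμ hν hcx hu' (le_max_left k (upperFn μ ν (1 / 2)))
      ((upperFn_monotoneOn hμ hν hcx hu' (by norm_num) hu.2.le).trans (le_max_right k _))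
    rw [potential_leftPart hu'] at h1
    linarith
  · filter_upwards [hmem] with u hu
    have hu' : u ∈ Ioo (0 : ℝ) 1 := ⟨hu.1, hu.2.trans (by norm_num)⟩
    have h1 : excessHull μ ν u k ≤ excess μ ν u k := (excessShape hμ hν hcx hu').hull_le k
    have h2 := potential_nonneg (η := leftPart μ u) k
    rw [excess] at h1
    linarith

theorem potDiff_tendsto_atTop (hμ : Integrable (fun x : ℝ => x) μ)
    (hν : Integrable (fun x : ℝ => x) ν) (hcx : ConvexOrder μ ν) :
    Tendsto (potDiff μ ν) atTop (𝓝 0) := by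
  have h := (potential_tendsto_atTop hν).sub (potential_tendsto_atTop hμ)
  rw [sub_zero] at h
  refine h.congr fun k => ?_
  rw [hcx.integral_id_eq hν, probReal_univ, probReal_univ, potDiff]
  ring

/-- The hull is increasing in its argument, so its value at `k` is at most `𝓔_u(x)` for any `x ≥ k`.
This tends to `D(x)` as `u → 1`, and `D(x)` is small for large `x`. -/
theorem tendsto_excessHull_one (hμ : Integrable (fun x : ℝ => x) μ)
    (hν : Integrable (fun x : ℝ => x) ν) (hcx : ConvexOrder μ ν) (k : ℝ) :
    Tendsto (fun u => excessHull μ ν u k) (𝓝[<] 1) (𝓝 0) := by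
  have hmem : ∀ᶠ u : ℝ in 𝓝[<] 1, u ∈ Ioo (0 : ℝ) 1 := Ioo_mem_nhdsLT (by norm_num)
  refine tendsto_order.2 ⟨fun b hb => ?_, fun b hb => ?_⟩
  · filter_upwards [hmem] with u hu
    exact hb.trans_le ((excessShape hμ hν hcx hu).hull_nonneg k)
  · obtain ⟨x, hx, hkx⟩ := (((potDiff_tendsto_atTop hμ hν hcx).eventually
      (gt_mem_nhds (half_pos hb))).and (eventually_ge_atTop k)).exists
    have hlim := tendsto_setIntegral_Ioc_one (integrableOn_put_quantile hμ x)
    rw [← potential_eq_setIntegral] at hlim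
    filter_upwards [hmem, hlim.eventually (lt_mem_nhds (sub_lt_self _ (half_pos hb)))] with u hu h
    have hE := excessShape hμ hν hcx hu
    have h1 : excessHull μ ν u k ≤ excess μ ν u x := (hE.hull_mono hkx).trans (hE.hull_le x)
    rw [← potential_leftPart hu] at h
    rw [excess] at h1
    rw [potDiff] at hx
    linarith

/-- A nonnegative function whose integrals over an exhaustion of `(0, 1)` are differences of hulls,
hence at most `P_ν(k)`. The factor `1 / 2` in the end points keeps them ordered and inside `(0, 1)`
already for `n = 0`. -/
theorem integrableOn_targetPotential (hμ : Integrable (fun x : ℝ => x) μ)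
    (hν : Integrable (fun x : ℝ => x) ν) (hcx : ConvexOrder μ ν) (k : ℝ) :
    IntegrableOn (targetPotential μ ν k) (Ioo 0 1) := by
  have hlim : Tendsto (fun n : ℕ => 1 / ((n : ℝ) + 1) / 2) atTop (𝓝 0) := by
    simpa using (tendsto_one_div_add_atTop_nhds_zero_nat (𝕜 := ℝ)).div_const 2
  have hpos : ∀ n : ℕ, 0 < 1 / ((n : ℝ) + 1) / 2 := fun n => by positivity
  have hle : ∀ n : ℕ, 1 / ((n : ℝ) + 1) / 2 ≤ 1 / 2 := fun n => by
    have : 1 / ((n : ℝ) + 1) ≤ 1 := by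
      rw [div_le_one (by positivity)]
      linarith [(Nat.cast_nonneg n : (0 : ℝ) ≤ n)]
    linarith
  have hint := fun n : ℕ => integral_targetPotential hμ hν hcx k (hpos n)
    (b := 1 - 1 / ((n : ℝ) + 1) / 2) (by linarith [hle n]) (by linarith [hpos n])
  have hab : ∀ n : ℕ, 1 / ((n : ℝ) + 1) / 2 ≤ 1 - 1 / ((n : ℝ) + 1) / 2 := fun n => by
    linarith [hle n]
  refine (integrableOn_Ioc_of_intervalIntegral_norm_bounded (I := potential ν k) (l := atTop)
    (a := fun n : ℕ => 1 / ((n : ℝ) + 1) / 2) (b := fun n : ℕ => 1 - 1 / ((n : ℝ) + 1) / 2)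
    (fun n => ((hint n).1.1)) hlim (by simpa using hlim.const_sub 1)
    (Eventually.of_forall fun n => ?_)).mono_set Ioo_subset_Ioc_self
  have hsub : Ioc (1 / ((n : ℝ) + 1) / 2) (1 - 1 / ((n : ℝ) + 1) / 2) ⊆ Ioo 0 1 := fun x hx =>
    ⟨(hpos n).trans hx.1, hx.2.trans_lt (by linarith [hpos n])⟩
  rw [setIntegral_congr_fun measurableSet_Ioc (g := targetPotential μ ν k) fun x hx =>
    Real.norm_of_nonneg (targetPotential_nonneg hμ hν hcx (hsub hx) k),
    ← intervalIntegral.integral_of_le (hab n), (hint n).2]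
  have hu1 : 1 / ((n : ℝ) + 1) / 2 ∈ Ioo (0 : ℝ) 1 := ⟨hpos n, by linarith [hle n]⟩
  have hu2 : 1 - 1 / ((n : ℝ) + 1) / 2 ∈ Ioo (0 : ℝ) 1 :=
    ⟨by linarith [hle n], by linarith [hpos n]⟩
  have h1 : excessHull μ ν _ k ≤ excess μ ν _ k := (excessShape hμ hν hcx hu1).hull_le k
  have h2 : 0 ≤ excessHull μ ν _ k := (excessShape hμ hν hcx hu2).hull_nonneg k
  have h3 := potential_nonneg (η := leftPart μ (1 / ((n : ℝ) + 1) / 2)) k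
  rw [excess] at h1
  linarith

theorem setIntegral_targetPotential (hμ : Integrable (fun x : ℝ => x) μ)
    (hν : Integrable (fun x : ℝ => x) ν) (hcx : ConvexOrder μ ν) (k : ℝ) {u : ℝ}
    (hu : u ∈ Ioo (0 : ℝ) 1) :
    ∫ w in Ioc 0 u, targetPotential μ ν k w = potential ν k - excessHull μ ν u k := by
  have hI := integrableOn_targetPotential hμ hν hcx k
  have h1 := tendsto_setIntegral_Ioc_zero hI
  have h2 : Tendsto (fun a => ∫ w in Ioc 0 a, targetPotential μ ν k w) (𝓝[>] 0)
      (𝓝 ((∫ w in Ioc 0 u, targetPotential μ ν k w) -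
        (potential ν k - excessHull μ ν u k))) := by
    refine Tendsto.congr' ?_ (((tendsto_excessHull_zero hμ hν hcx k).sub_const
      (excessHull μ ν u k)).const_sub _)
    filter_upwards [Ioo_mem_nhdsGT hu.1] with a ha
    rw [← (integral_targetPotential hμ hν hcx k ha.1 ha.2.le hu.2).2,
      intervalIntegral.integral_of_le ha.2.le, ← Ioc_union_Ioc_eq_Ioc ha.1.le ha.2.le,
      setIntegral_union (disjoint_left.2 fun _ h1 h2 => absurd h1.2 (not_le.2 h2.1))
      measurableSet_Ioc (hI.mono_set (Ioc_subset_Ioo_one le_rfl (ha.2.trans hu.2)))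
      (hI.mono_set (Ioc_subset_Ioo_one ha.1.le hu.2))]
    ring
  have := tendsto_nhds_unique h1 h2
  linarith

theorem setIntegral_targetPotential_Ioo (hμ : Integrable (fun x : ℝ => x) μ)
    (hν : Integrable (fun x : ℝ => x) ν) (hcx : ConvexOrder μ ν) (k : ℝ) :
    ∫ w in Ioo 0 1, targetPotential μ ν k w = potential ν k := by
  have h1 := tendsto_setIntegral_Ioc_one (integrableOn_targetPotential hμ hν hcx k)
  have h2 : Tendsto (fun u => ∫ w in Ioc 0 u, targetPotential μ ν k w) (𝓝[<] 1)
      (𝓝 (potential ν k - 0)) := by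
    refine Tendsto.congr' ?_ ((tendsto_excessHull_one hμ hν hcx k).const_sub _)
    filter_upwards [Ioo_mem_nhdsLT zero_lt_one] with u hu
    exact (setIntegral_targetPotential hμ hν hcx k hu).symm
  rw [sub_zero] at h2
  exact tendsto_nhds_unique h1 h2

end Limits

end LeftCurtain

namespace LeftCurtain

open Filter Topology

section Law

set_option linter.unusedSectionVars false

variable {μ ν : Measure ℝ} [IsProbabilityMeasure μ] [IsProbabilityMeasure ν]

/-! ### Measurability of `Y` -/

theorem measurable_coe_of_monotoneOn {f : ℝ → ℝ} (hf : MonotoneOn f (Ioo 0 1)) :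
    Measurable fun u : Ioo (0 : ℝ) 1 => f u :=
  Monotone.measurable fun u v huv => hf u.2 v.2 huv

/-- By the increment bounds, the function becomes monotone after adding `2 G`. -/
theorem measurable_targetPotential (hμ : Integrable (fun x : ℝ => x) μ)
    (hν : Integrable (fun x : ℝ => x) ν) (hcx : ConvexOrder μ ν) (k : ℝ) :
    Measurable fun u : Ioo (0 : ℝ) 1 => targetPotential μ ν k u := by
  have h1 : MonotoneOn (fun u => targetPotential μ ν k u + 2 * quantile μ u) (Ioo 0 1) := by
    intro u hu u' hu' huu'
    rcases eq_or_lt_of_le huu' with rfl | hlt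
    · rfl
    have := (mul_sub_le_hull_sub_hull hμ hν hcx hu hu' hlt k).trans
      (hull_sub_hull_le_mul hμ hν hcx hu hu' hlt k)
    have := le_of_mul_le_mul_left this (sub_pos.2 hlt)
    simp only
    linarith
  have h2 := (measurable_coe_of_monotoneOn h1).sub
    ((measurable_coe_of_monotoneOn (quantile_monotoneOn (μ := μ))).const_mul 2)
  have h3 : (fun u : Ioo (0 : ℝ) 1 => targetPotential μ ν k u) = fun u : Ioo (0 : ℝ) 1 =>
      (targetPotential μ ν k u + 2 * quantile μ u) - 2 * quantile μ u := by
    ext u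
    ring
  rw [h3]
  exact h2

/-- `R(u)` is the left end point of the fibre law, so measurability of `R` can be read off its
potentials. -/
theorem targetPotential_pos_iff (hμ : Integrable (fun x : ℝ => x) μ)
    (hν : Integrable (fun x : ℝ => x) ν) (hcx : ConvexOrder μ ν) {u : ℝ}
    (hu : u ∈ lowerDomain μ ν) (hne : upperFn μ ν u ≠ quantile μ u) (k : ℝ) :
    0 < targetPotential μ ν k u ↔ lowerFn μ ν u < k := by
  have hRG := (lowerFn_mem hμ hν hcx hu).1
  have hGS := lt_of_le_of_ne (quantile_le_upperFn hμ hν hcx hu.1) (Ne.symm hne)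
  unfold targetPotential
  rw [if_pos hu]
  split_ifs with h1 h2
  · exact ⟨fun _ => by linarith, fun _ => by linarith⟩
  · exact ⟨fun h => absurd h (lt_irrefl 0), fun h => absurd h2 (not_le.2 h)⟩
  · have h3 := not_le.1 h2
    exact ⟨fun _ => h3, fun _ => div_pos (mul_pos (by linarith) (by linarith)) (by linarith)⟩

/-- The threshold for `v` is then `0`, so the value of `R(u)` is irrelevant, even when it is only a
default. -/
theorem target_of_eq {u v : ℝ} (h : upperFn μ ν u = quantile μ u) (hv : 0 < v) :
    target μ ν u v = quantile μ u := by
  unfold target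
  rw [h, sub_self, zero_div, if_neg (not_le.2 hv)]
  split_ifs <;> rfl

theorem measurable_target (hμ : Integrable (fun x : ℝ => x) μ)
    (hν : Integrable (fun x : ℝ => x) ν) (hcx : ConvexOrder μ ν) :
    Measurable fun p : Ioo (0 : ℝ) 1 × Ioo (0 : ℝ) 1 => target μ ν p.1 p.2 := by
  classical
  have hG := measurable_coe_of_monotoneOn (quantile_monotoneOn (μ := μ))
  have hS := measurable_coe_of_monotoneOn (upperFn_monotoneOn hμ hν hcx)
  have hE : MeasurableSet {u : Ioo (0 : ℝ) 1 | upperFn μ ν u = quantile μ u} :=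
    measurableSet_eq_fun hS hG
  have hB : {u : Ioo (0 : ℝ) 1 | upperFn μ ν u ≠ quantile μ u ∧
      (u : ℝ) ∉ lowerDomain μ ν}.Countable := by
    refine ((countable_notMem_lowerDomain hμ hν hcx).preimage
      Subtype.val_injective).mono fun u hu => ?_
    exact ⟨⟨u.2, hu.2⟩, hu.1⟩
  -- `R` is replaced by `0` where it does not matter. The remaining levels outside `J` are
  -- countable, and on the rest `targetPotential_pos_iff` describes `{R < k}`.
  have hR : Measurable fun u : Ioo (0 : ℝ) 1 =>
      if upperFn μ ν u = quantile μ u then 0 else lowerFn μ ν u := by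
    refine measurable_of_Iio fun k => ?_
    set B := {u : Ioo (0 : ℝ) 1 | upperFn μ ν u ≠ quantile μ u ∧ (u : ℝ) ∉ lowerDomain μ ν}
    set E := {u : Ioo (0 : ℝ) 1 | upperFn μ ν u = quantile μ u}
    have heq : (fun u : Ioo (0 : ℝ) 1 =>
        if upperFn μ ν u = quantile μ u then 0 else lowerFn μ ν u) ⁻¹' Iio k =
        (E ∩ {_u | 0 < k}) ∪ ((B ∩ {u | lowerFn μ ν u < k}) ∪
          ((Eᶜ ∩ Bᶜ) ∩ {u | 0 < targetPotential μ ν k u})) := by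
      ext u
      simp only [mem_preimage, mem_Iio, mem_union, mem_inter_iff, mem_compl_iff, E, B,
        mem_ofPred_eq]
      by_cases h1 : upperFn μ ν u = quantile μ u
      · simp [h1]
      · by_cases h2 : (u : ℝ) ∈ lowerDomain μ ν
        · simp [h1, h2, targetPotential_pos_iff hμ hν hcx h2 h1]
        · simp [h1, h2]
    rw [heq]
    refine (hE.inter (MeasurableSet.const _)).union ((hB.mono inter_subset_left).measurableSet.union
      ((hE.compl.inter hB.measurableSet.compl).inter ?_))
    exact measurableSet_lt measurable_const (measurable_targetPotential hμ hν hcx k)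
  have heq : (fun p : Ioo (0 : ℝ) 1 × Ioo (0 : ℝ) 1 => target μ ν p.1 p.2) = fun p =>
      if upperFn μ ν p.1 = quantile μ p.1 then quantile μ p.1 else
      if (if upperFn μ ν p.1 = quantile μ p.1 then 0 else lowerFn μ ν p.1) = upperFn μ ν p.1
        then quantile μ p.1
      else if (p.2 : ℝ) ≤ (upperFn μ ν p.1 - quantile μ p.1) / (upperFn μ ν p.1 -
        (if upperFn μ ν p.1 = quantile μ p.1 then 0 else lowerFn μ ν p.1))
      then (if upperFn μ ν p.1 = quantile μ p.1 then 0 else lowerFn μ ν p.1)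
      else upperFn μ ν p.1 := by
    ext p
    by_cases h : upperFn μ ν p.1 = quantile μ p.1
    · rw [if_pos h, target_of_eq h p.2.2.1]
    · simp only [if_neg h, target]
  rw [heq]
  have hfst : Measurable (Prod.fst : Ioo (0 : ℝ) 1 × Ioo (0 : ℝ) 1 → _) := measurable_fst
  have hG' := hG.comp hfst
  have hS' := hS.comp hfst
  have hR' := hR.comp hfst
  refine Measurable.ite (measurableSet_eq_fun hS' hG') hG'
    (Measurable.ite (measurableSet_eq_fun hR' hS') hG' (Measurable.ite ?_ hR' hS'))
  exact measurableSet_le (measurable_subtype_coe.comp measurable_snd)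
    ((hS'.sub hG').div (hS'.sub hR'))

theorem exists_measurable_quantile :
    ∃ G : ℝ → ℝ, Measurable G ∧ ∀ u ∈ Ioo (0 : ℝ) 1, G u = quantile μ u := by
  obtain ⟨G, hG, he⟩ := (MeasurableEmbedding.subtype_coe
    (measurableSet_Ioo (a := (0 : ℝ)) (b := 1))).exists_measurable_extend
    (measurable_coe_of_monotoneOn (quantile_monotoneOn (μ := μ))) (fun _ => ⟨0⟩)
  exact ⟨G, hG, fun u hu => congrFun he ⟨u, hu⟩⟩

/-- A version measurable on the whole plane, so that laws can be computed as images of `unitLaw.prod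
unitLaw`. -/
theorem exists_measurable_target (hμ : Integrable (fun x : ℝ => x) μ)
    (hν : Integrable (fun x : ℝ => x) ν) (hcx : ConvexOrder μ ν) :
    ∃ T : ℝ × ℝ → ℝ, Measurable T ∧
      ∀ u ∈ Ioo (0 : ℝ) 1, ∀ v ∈ Ioo (0 : ℝ) 1, T (u, v) = target μ ν u v := by
  have hemb := MeasurableEmbedding.subtype_coe (measurableSet_Ioo (a := (0 : ℝ)) (b := 1))
  obtain ⟨T, hT, he⟩ := (hemb.prodMap hemb).exists_measurable_extend
    (measurable_target hμ hν hcx) (fun _ => ⟨0⟩)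
  exact ⟨T, hT, fun u hu v hv => congrFun he (⟨u, hu⟩, ⟨v, hv⟩)⟩

/-! ### The conditional law of `Y` given `U = u` -/

theorem setIntegral_two_values {p a b : ℝ} (hp : p ∈ Icc (0 : ℝ) 1) {f : ℝ → ℝ}
    (h1 : ∀ v ∈ Ioo (0 : ℝ) 1, v ≤ p → f v = a) (h2 : ∀ v ∈ Ioo (0 : ℝ) 1, p < v → f v = b) :
    IntegrableOn f (Ioo 0 1) ∧ ∫ v in Ioo 0 1, f v = p * a + (1 - p) * b := by
  have i1 : IntegrableOn f (Ioo 0 p) := (integrableOn_const (C := a) (by simp)).congr_fun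
    (fun v hv => (h1 v ⟨hv.1, hv.2.trans_le hp.2⟩ hv.2.le).symm) measurableSet_Ioo
  have i2 : IntegrableOn f (Ioo p 1) := (integrableOn_const (C := b) (by simp)).congr_fun
    (fun v hv => (h2 v ⟨hp.1.trans_lt hv.1, hv.2⟩ hv.1).symm) measurableSet_Ioo
  have i1' : IntegrableOn f (Ioc 0 p) := (integrableOn_Ioc_iff_integrableOn_Ioo (by simp)).2 i1
  have i2' : IntegrableOn f (Ioc p 1) := (integrableOn_Ioc_iff_integrableOn_Ioo (by simp)).2 i2
  have e1 : ∫ v in Ioo 0 p, f v = p * a := by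
    rw [setIntegral_congr_fun measurableSet_Ioo (g := fun _ => a)
      (fun v hv => h1 v ⟨hv.1, hv.2.trans_le hp.2⟩ hv.2.le)]
    simp [hp.1]
  have e2 : ∫ v in Ioo p 1, f v = (1 - p) * b := by
    rw [setIntegral_congr_fun measurableSet_Ioo (g := fun _ => b)
      (fun v hv => h2 v ⟨hp.1.trans_lt hv.1, hv.2⟩ hv.1)]
    simp [hp.2]
  constructor
  · rw [← integrableOn_Ioc_iff_integrableOn_Ioo (by simp), ← Ioc_union_Ioc_eq_Ioc hp.1 hp.2]
    exact i1'.union i2'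
  · rw [← integral_Ioc_eq_integral_Ioo, ← Ioc_union_Ioc_eq_Ioc hp.1 hp.2,
      setIntegral_union (disjoint_left.2 fun _ h1 h2 => absurd h1.2 (not_le.2 h2.1))
      measurableSet_Ioc i1' i2', integral_Ioc_eq_integral_Ioo, integral_Ioc_eq_integral_Ioo, e1, e2]

theorem setIntegral_comp_target_of_eq {u : ℝ} (he : upperFn μ ν u = quantile μ u) (h : ℝ → ℝ) :
    IntegrableOn (fun v => h (target μ ν u v)) (Ioo 0 1) ∧
      ∫ v in Ioo 0 1, h (target μ ν u v) = h (quantile μ u) := by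
  have := setIntegral_two_values (p := 1) (a := h (quantile μ u)) (b := 0)
    (f := fun v => h (target μ ν u v)) (by simp)
    (fun v hv _ => by rw [target_of_eq he hv.1]) (fun v hv h1 => absurd h1 (not_lt.2 hv.2.le))
  simpa using this

theorem setIntegral_comp_target_of_ne (hμ : Integrable (fun x : ℝ => x) μ)
    (hν : Integrable (fun x : ℝ => x) ν) (hcx : ConvexOrder μ ν) {u : ℝ}
    (hu : u ∈ lowerDomain μ ν) (hne : upperFn μ ν u ≠ quantile μ u) (h : ℝ → ℝ) :
    IntegrableOn (fun v => h (target μ ν u v)) (Ioo 0 1) ∧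
      ∫ v in Ioo 0 1, h (target μ ν u v) =
        (upperFn μ ν u - quantile μ u) / (upperFn μ ν u - lowerFn μ ν u) * h (lowerFn μ ν u) +
        (1 - (upperFn μ ν u - quantile μ u) / (upperFn μ ν u - lowerFn μ ν u)) *
          h (upperFn μ ν u) := by
  have hRG := (lowerFn_mem hμ hν hcx hu).1
  have hGS := lt_of_le_of_ne (quantile_le_upperFn hμ hν hcx hu.1) (Ne.symm hne)
  have hRS : lowerFn μ ν u ≠ upperFn μ ν u := (hRG.trans_lt hGS).ne
  refine setIntegral_two_values ⟨div_nonneg (by linarith) (by linarith),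
    (div_le_one (by linarith)).2 (by linarith)⟩ (fun v _ hv => ?_) (fun v _ hv => ?_)
  · rw [target, if_neg hRS, if_pos hv]
  · rw [target, if_neg hRS, if_neg (not_le.2 hv)]

/-- This identifies the rate of decrease of the hull with the potential of the two-point fibre law,
for all but countably many levels. -/
theorem setIntegral_put_target (hμ : Integrable (fun x : ℝ => x) μ)
    (hν : Integrable (fun x : ℝ => x) ν) (hcx : ConvexOrder μ ν) {u : ℝ}
    (hu : u ∈ lowerDomain μ ν ∨ upperFn μ ν u = quantile μ u) (k : ℝ) :
    IntegrableOn (fun v => max (k - target μ ν u v) 0) (Ioo 0 1) ∧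
      ∫ v in Ioo 0 1, max (k - target μ ν u v) 0 = targetPotential μ ν k u := by
  by_cases he : upperFn μ ν u = quantile μ u
  · have h1 := setIntegral_comp_target_of_eq he fun x => max (k - x) 0
    refine ⟨h1.1, h1.2.trans ?_⟩
    unfold targetPotential
    rw [he]
    split_ifs with h2 h3 h4
    · exact max_eq_left (by linarith)
    · exact max_eq_right (by linarith)
    · rw [sub_self, mul_zero, zero_div]
      exact max_eq_right (by linarith)
    · rw [sub_self]
      exact max_eq_right (by linarith)
  · have hu' := hu.resolve_right he
    have hRG := (lowerFn_mem hμ hν hcx hu').1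
    have hGS := lt_of_le_of_ne (quantile_le_upperFn hμ hν hcx hu'.1) (Ne.symm he)
    have h1 := setIntegral_comp_target_of_ne hμ hν hcx hu' he fun x => max (k - x) 0
    refine ⟨h1.1, h1.2.trans ?_⟩
    unfold targetPotential
    rw [if_pos hu']
    have hpos : 0 < upperFn μ ν u - lowerFn μ ν u := by linarith
    split_ifs with h2 h3
    · rw [max_eq_left (by linarith), max_eq_left (by linarith)]
      field_simp
      ring
    · rw [max_eq_right (by linarith), max_eq_right (by linarith)]
      ring
    · rw [max_eq_left (by linarith), max_eq_right (by linarith)]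
      ring

theorem setIntegral_target (hμ : Integrable (fun x : ℝ => x) μ)
    (hν : Integrable (fun x : ℝ => x) ν) (hcx : ConvexOrder μ ν) {u : ℝ}
    (hu : u ∈ lowerDomain μ ν ∨ upperFn μ ν u = quantile μ u) :
    ∫ v in Ioo 0 1, target μ ν u v = quantile μ u := by
  by_cases he : upperFn μ ν u = quantile μ u
  · exact (setIntegral_comp_target_of_eq he fun x => x).2
  · have hu' := hu.resolve_right he
    have hRG := (lowerFn_mem hμ hν hcx hu').1
    have hGS := lt_of_le_of_ne (quantile_le_upperFn hμ hν hcx hu'.1) (Ne.symm he)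
    have hpos : 0 < upperFn μ ν u - lowerFn μ ν u := by linarith
    refine (setIntegral_comp_target_of_ne hμ hν hcx hu' he fun x => x).2.trans ?_
    field_simp
    ring

theorem ae_mem_lowerDomain_or (hμ : Integrable (fun x : ℝ => x) μ)
    (hν : Integrable (fun x : ℝ => x) ν) (hcx : ConvexOrder μ ν) :
    ∀ᵐ u ∂(volume.restrict (Ioo (0 : ℝ) 1)), u ∈ Ioo (0 : ℝ) 1 ∧
      (u ∈ lowerDomain μ ν ∨ upperFn μ ν u = quantile μ u) := by
  have h := (countable_notMem_lowerDomain hμ hν hcx).ae_notMem (volume.restrict (Ioo (0 : ℝ) 1))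
  filter_upwards [h, ae_restrict_mem measurableSet_Ioo] with u hu hu'
  refine ⟨hu', ?_⟩
  by_contra! hc
  exact hu ⟨⟨hu', hc.1⟩, hc.2⟩

end Law

end LeftCurtain

namespace LeftCurtain

open Filter Topology

/-- The uniform distribution on `(0,1)`. -/
noncomputable abbrev unitLaw : Measure ℝ := volume.restrict (Ioo (0 : ℝ) 1)

instance : IsProbabilityMeasure unitLaw := ⟨by simp [unitLaw]⟩

theorem unitLaw_restrict_Icc {u : ℝ} (hu : u < 1) :
    unitLaw.restrict (Icc 0 u) = volume.restrict (Ioc 0 u) := by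
  rw [unitLaw, Measure.restrict_restrict measurableSet_Icc]
  congr 1
  ext x
  simp only [mem_inter_iff, mem_Icc, mem_Ioo, mem_Ioc]
  exact ⟨fun h => ⟨h.2.1, h.1.2⟩, fun h => ⟨⟨h.1.le, h.2⟩, h.1, h.2.trans_lt hu⟩⟩

/-- Half-lines in the first variable suffice, and there the shadow conditions prescribe the second
marginal. -/
theorem ext_of_Iic_prod {m m' : Measure (ℝ × ℝ)} [IsFiniteMeasure m]
    (h : ∀ a B, MeasurableSet B → m (Iic a ×ˢ B) = m' (Iic a ×ˢ B)) : m = m' := by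
  refine Measure.ext_prod fun {s t} hs ht => ?_
  have key : ∀ (n : Measure (ℝ × ℝ)) (s : Set ℝ), MeasurableSet s →
      (n.restrict (univ ×ˢ t)).fst s = n (s ×ˢ t) := fun n s hs => by
    rw [Measure.fst_apply hs, Measure.restrict_apply (measurable_fst hs), ← prod_univ, prod_inter_prod,
      inter_univ, univ_inter]
  have : (m.restrict (univ ×ˢ t)).fst = (m'.restrict (univ ×ˢ t)).fst :=
    Measure.ext_of_Iic _ _ fun a => by
      rw [key m _ measurableSet_Iic, key m' _ measurableSet_Iic, h a t ht]
  rw [← key m s hs, ← key m' s hs, this]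

theorem restrict_prod_univ_snd_apply {α : Type*} [MeasurableSpace α] (n : Measure (α × ℝ))
    (s : Set α) {B : Set ℝ} (hB : MeasurableSet B) :
    (n.restrict (s ×ˢ univ)).snd B = n (s ×ˢ B) := by
  rw [Measure.snd_apply hB, Measure.restrict_apply (measurable_snd hB), ← univ_prod,
    prod_inter_prod, inter_univ, univ_inter]

section Law

set_option linter.unusedSectionVars false

variable {μ ν : Measure ℝ} [IsProbabilityMeasure μ] [IsProbabilityMeasure ν]

/-! ### The law of `Y` -/

section Target

variable {T : ℝ × ℝ → ℝ}

theorem integrable_put_target (hμ : Integrable (fun x : ℝ => x) μ)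
    (hν : Integrable (fun x : ℝ => x) ν) (hcx : ConvexOrder μ ν) (hT : Measurable T)
    (hTt : ∀ u ∈ Ioo (0 : ℝ) 1, ∀ v ∈ Ioo (0 : ℝ) 1, T (u, v) = target μ ν u v) (k : ℝ) :
    Integrable (fun p => max (k - T p) 0) (unitLaw.prod unitLaw) := by
  have hae := ae_mem_lowerDomain_or hμ hν hcx
  have hm : Measurable fun p => max (k - T p) 0 := by fun_prop
  refine (integrable_prod_iff hm.aestronglyMeasurable).2 ⟨?_, ?_⟩
  · filter_upwards [hae] with u hu
    exact ((setIntegral_put_target hμ hν hcx hu.2 k).1).congr_fun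
      (fun v hv => by simp only [hTt u hu.1 v hv]) measurableSet_Ioo
  · refine (integrableOn_targetPotential hμ hν hcx k).congr ?_
    filter_upwards [hae] with u hu
    rw [← (setIntegral_put_target hμ hν hcx hu.2 k).2]
    refine setIntegral_congr_fun measurableSet_Ioo fun v hv => ?_
    rw [Real.norm_of_nonneg (le_max_right _ _), hTt u hu.1 v hv]

theorem setIntegral_put_target_prod (hμ : Integrable (fun x : ℝ => x) μ)
    (hν : Integrable (fun x : ℝ => x) ν) (hcx : ConvexOrder μ ν) (hT : Measurable T)
    (hTt : ∀ u ∈ Ioo (0 : ℝ) 1, ∀ v ∈ Ioo (0 : ℝ) 1, T (u, v) = target μ ν u v) (k : ℝ)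
    (A : Set ℝ) : ∫ p in A ×ˢ univ, max (k - T p) 0 ∂(unitLaw.prod unitLaw) =
      ∫ u in A, targetPotential μ ν k u ∂unitLaw := by
  rw [setIntegral_prod _ (integrable_put_target hμ hν hcx hT hTt k).integrableOn]
  refine integral_congr_ae (ae_restrict_of_ae ?_)
  filter_upwards [ae_mem_lowerDomain_or hμ hν hcx] with u hu
  rw [← (setIntegral_put_target hμ hν hcx hu.2 k).2, Measure.restrict_univ]
  exact setIntegral_congr_fun measurableSet_Ioo fun v hv => by simp only [hTt u hu.1 v hv]

theorem map_target_eq (hμ : Integrable (fun x : ℝ => x) μ)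
    (hν : Integrable (fun x : ℝ => x) ν) (hcx : ConvexOrder μ ν) (hT : Measurable T)
    (hTt : ∀ u ∈ Ioo (0 : ℝ) 1, ∀ v ∈ Ioo (0 : ℝ) 1, T (u, v) = target μ ν u v) :
    (unitLaw.prod unitLaw).map T = ν := by
  have hfin : IsFiniteMeasure ((unitLaw.prod unitLaw).map T) := inferInstance
  refine eq_of_potential_eq (fun k => ?_) (integrable_posPart hν) fun k => ?_
  · exact (integrable_map_measure (by fun_prop) hT.aemeasurable).2
      (integrable_put_target hμ hν hcx hT hTt k)
  · rw [potential, integral_map hT.aemeasurable (by fun_prop)]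
    have := setIntegral_put_target_prod hμ hν hcx hT hTt k univ
    rw [univ_prod_univ, Measure.restrict_univ, Measure.restrict_univ] at this
    rw [this]
    exact setIntegral_targetPotential_Ioo hμ hν hcx k

/-- Integrability is inherited from `ν` once the law is known. -/
theorem integrable_target (hμ : Integrable (fun x : ℝ => x) μ)
    (hν : Integrable (fun x : ℝ => x) ν) (hcx : ConvexOrder μ ν) (hT : Measurable T)
    (hTt : ∀ u ∈ Ioo (0 : ℝ) 1, ∀ v ∈ Ioo (0 : ℝ) 1, T (u, v) = target μ ν u v) :
    Integrable T (unitLaw.prod unitLaw) := by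
  have h := hν
  rw [← map_target_eq hμ hν hcx hT hTt] at h
  exact (integrable_map_measure (by fun_prop) hT.aemeasurable).1 h

theorem setIntegral_target_prod (hμ : Integrable (fun x : ℝ => x) μ)
    (hν : Integrable (fun x : ℝ => x) ν) (hcx : ConvexOrder μ ν) (hT : Measurable T)
    (hTt : ∀ u ∈ Ioo (0 : ℝ) 1, ∀ v ∈ Ioo (0 : ℝ) 1, T (u, v) = target μ ν u v)
    (A : Set ℝ) : ∫ p in A ×ˢ univ, T p ∂(unitLaw.prod unitLaw) =
      ∫ u in A, quantile μ u ∂unitLaw := by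
  rw [setIntegral_prod _ (integrable_target hμ hν hcx hT hTt).integrableOn]
  refine integral_congr_ae (ae_restrict_of_ae ?_)
  filter_upwards [ae_mem_lowerDomain_or hμ hν hcx] with u hu
  rw [← setIntegral_target hμ hν hcx hu.2, Measure.restrict_univ]
  exact setIntegral_congr_fun measurableSet_Ioo fun v hv => hTt u hu.1 v hv

theorem isShadow_target (hμ : Integrable (fun x : ℝ => x) μ)
    (hν : Integrable (fun x : ℝ => x) ν) (hcx : ConvexOrder μ ν) (hT : Measurable T)
    (hTt : ∀ u ∈ Ioo (0 : ℝ) 1, ∀ v ∈ Ioo (0 : ℝ) 1, T (u, v) = target μ ν u v)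
    {u : ℝ} (hu : u ∈ Ioo (0 : ℝ) 1) :
    IsShadow (leftPart μ u) ν
      (((unitLaw.prod unitLaw).restrict (Icc 0 u ×ˢ univ)).map T) := by
  refine isShadow_of_potential_eq (integrable_id_leftPart hμ hu) hν ?_ ?_ ?_ ?_ fun k => ?_
  · rw [← map_target_eq hμ hν hcx hT hTt]
    exact Measure.map_mono Measure.restrict_le_self hT
  · rw [leftPart_real_univ hu, measureReal_def, Measure.map_apply hT MeasurableSet.univ,
      preimage_univ, Measure.restrict_apply_univ, Measure.prod_prod, measure_univ, mul_one,
      ← Measure.restrict_apply_univ, unitLaw_restrict_Icc hu.2, Measure.restrict_apply_univ,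
      Real.volume_Ioc, sub_zero, ENNReal.toReal_ofReal hu.1.le]
  · rw [integral_map hT.aemeasurable (by fun_prop), setIntegral_target_prod hμ hν hcx hT hTt,
      unitLaw_restrict_Icc hu.2]
    exact integral_leftPart hu (f := fun x => x) continuous_id
  · exact ⟨fun _ => 0, convexOn_const 0 convex_univ, (excessShape hμ hν hcx hu).nonneg⟩
  · rw [potential, integral_map hT.aemeasurable (by fun_prop),
      setIntegral_put_target_prod hμ hν hcx hT hTt, unitLaw_restrict_Icc hu.2,
      setIntegral_targetPotential hμ hν hcx k hu]
    rfl

end Target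

/-! ### The couplings -/

section Couplings

variable {T : ℝ × ℝ → ℝ} {G : ℝ → ℝ}

theorem quantileLift_eq_map (hGq : ∀ u ∈ Ioo (0 : ℝ) 1, G u = quantile μ u) :
    quantileLift μ = unitLaw.map fun u => (u, G u) := by
  refine Measure.map_congr ?_
  filter_upwards [ae_restrict_mem measurableSet_Ioo] with u hu
  rw [hGq u hu]

theorem map_quantile_version (hGq : ∀ u ∈ Ioo (0 : ℝ) 1, G u = quantile μ u) :
    unitLaw.map G = μ := by
  conv_rhs => rw [← map_quantile (μ := μ)]
  refine Measure.map_congr ?_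
  filter_upwards [ae_restrict_mem measurableSet_Ioo] with u hu
  exact hGq u hu

theorem fst_liftedLaw (hT : Measurable T) (hG : Measurable G)
    (hGq : ∀ u ∈ Ioo (0 : ℝ) 1, G u = quantile μ u) :
    ((unitLaw.prod unitLaw).map fun p => ((p.1, G p.1), T p)).fst = quantileLift μ := by
  rw [Measure.fst_map_prodMk hT, quantileLift_eq_map hGq,
    show (fun p : ℝ × ℝ => (p.1, G p.1)) = (fun u => (u, G u)) ∘ Prod.fst from rfl,
    ← Measure.map_map (by fun_prop) measurable_fst, Measure.map_fst_prod, measure_univ, one_smul]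

theorem leftPart_apply (hG : Measurable G) (hGq : ∀ u ∈ Ioo (0 : ℝ) 1, G u = quantile μ u)
    {u : ℝ} (hu : u ∈ Ioo (0 : ℝ) 1) {A : Set ℝ} (hA : MeasurableSet A) :
    quantileLift μ (Icc 0 u ×ˢ A) = leftPart μ u A := by
  rw [quantileLift_eq_map hGq, Measure.map_apply (by fun_prop) (measurableSet_Icc.prod hA),
    leftPart_eq_map hu, Measure.map_congr (g := G), Measure.map_apply hG hA,
    ← unitLaw_restrict_Icc hu.2, Measure.restrict_apply (hG hA)]
  · congr 1
    ext w
    simp only [mem_preimage, mem_prod, mem_inter_iff]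
    exact and_comm
  · filter_upwards [ae_restrict_mem measurableSet_Ioc] with w hw
    exact (hGq w (Ioc_subset_Ioo_one le_rfl hu.2 hw)).symm

theorem isLiftedLeftCurtain_law (hμ : Integrable (fun x : ℝ => x) μ)
    (hν : Integrable (fun x : ℝ => x) ν) (hcx : ConvexOrder μ ν) (hT : Measurable T)
    (hTt : ∀ u ∈ Ioo (0 : ℝ) 1, ∀ v ∈ Ioo (0 : ℝ) 1, T (u, v) = target μ ν u v)
    (hG : Measurable G) (hGq : ∀ u ∈ Ioo (0 : ℝ) 1, G u = quantile μ u) :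
    IsLiftedLeftCurtain μ ν ((unitLaw.prod unitLaw).map fun p => ((p.1, G p.1), T p)) := by
  set π := (unitLaw.prod unitLaw).map fun p => ((p.1, G p.1), T p) with hπ
  have hΦ : Measurable fun p : ℝ × ℝ => ((p.1, G p.1), T p) := by fun_prop
  have hfst : π.fst = quantileLift μ := fst_liftedLaw hT hG hGq
  have hint : Integrable (fun q : (ℝ × ℝ) × ℝ => q.2) π :=
    (integrable_map_measure (by fun_prop) hΦ.aemeasurable).2
      (integrable_target hμ hν hcx hT hTt)
  -- The disintegration is the conditional kernel; its barycentre is identified below through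
  -- integrals over sets `B ×ˢ univ`.
  refine ⟨hfst, ?_, ⟨π.condKernel, inferInstance, ?_, ?_⟩, fun u hu => ⟨fun A hA => ?_, ?_⟩⟩
  · rw [hπ, Measure.snd_map_prodMk (by fun_prop)]
    exact map_target_eq hμ hν hcx hT hTt
  · rw [← hfst]
    exact (π.disintegrate π.condKernel).symm
  · rw [← hfst]
    refine hint.condKernel_ae.and ?_
    have hid : Integrable (fun p : ℝ × ℝ => p.2) π.fst := by
      rw [hfst, quantileLift_eq_map hGq]
      refine (integrable_map_measure (by fun_prop) (by fun_prop)).2 ?_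
      exact (integrableOn_quantile hμ).congr_fun (fun u hu => (hGq u hu).symm) measurableSet_Ioo
    refine Integrable.ae_eq_of_forall_setIntegral_eq _ _ hint.integral_condKernel hid
      fun B hB _ => ?_
    rw [Measure.setIntegral_condKernel_univ_right hB (f := fun q : (ℝ × ℝ) × ℝ => q.2)
      hint.integrableOn, hπ, setIntegral_map (hB.prod MeasurableSet.univ) (by fun_prop)
      hΦ.aemeasurable, hfst, quantileLift_eq_map hGq, setIntegral_map hB (by fun_prop)
      (by fun_prop)]
    have h1 : (fun p : ℝ × ℝ => ((p.1, G p.1), T p)) ⁻¹' (B ×ˢ univ) =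
        ((fun u => (u, G u)) ⁻¹' B) ×ˢ univ := by
      ext p
      simp
    rw [h1, setIntegral_target_prod hμ hν hcx hT hTt]
    refine integral_congr_ae (ae_restrict_of_ae ?_)
    filter_upwards [ae_restrict_mem measurableSet_Ioo] with u hu
    exact (hGq u hu).symm
  · rw [← leftPart_apply hG hGq hu hA, ← hfst, Measure.fst_apply (measurableSet_Icc.prod hA),
      prod_univ]
  · have h1 : (π.restrict ((Icc 0 u ×ˢ univ) ×ˢ univ)).snd =
        ((unitLaw.prod unitLaw).restrict (Icc 0 u ×ˢ univ)).map T := by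
      rw [hπ, Measure.restrict_map hΦ
        ((measurableSet_Icc.prod MeasurableSet.univ).prod MeasurableSet.univ), Measure.snd,
        Measure.map_map measurable_snd hΦ, show (fun p : ℝ × ℝ => ((p.1, G p.1), T p)) ⁻¹'
          ((Icc 0 u ×ˢ univ) ×ˢ univ) = Icc 0 u ×ˢ univ by ext p; simp]
      rfl
    rw [h1]
    exact isShadow_target hμ hν hcx hT hTt hu

/-- Under the quantile lift `x` is a function of `u`, so only the law of `(u, y)` matters. On `{u ≤
a}` it is null for `a ≤ 0`, given by the shadow for `0 < a < 1`, and by `ν` for `a ≥ 1`. -/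
theorem IsLiftedLeftCurtain.unique (hν : Integrable (fun x : ℝ => x) ν)
    {π π' : Measure ((ℝ × ℝ) × ℝ)}
    (h : IsLiftedLeftCurtain μ ν π) (h' : IsLiftedLeftCurtain μ ν π') : π = π' := by
  obtain ⟨G, hG, hGq⟩ := exists_measurable_quantile (μ := μ)
  have hrep : ∀ π : Measure ((ℝ × ℝ) × ℝ), π.fst = quantileLift μ →
      π = (π.map fun q => (q.1.1, q.2)).map fun p => ((p.1, G p.1), p.2) := by
    intro π hπ
    rw [Measure.map_map (by fun_prop) (by fun_prop)]
    conv_lhs => rw [← Measure.map_id (μ := π)]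
    refine Measure.map_congr ?_
    have hae : ∀ᵐ p ∂π.fst, p.2 = G p.1 := by
      rw [hπ, quantileLift_eq_map hGq]
      refine (ae_map_iff (by fun_prop) (measurableSet_eq_fun measurable_snd
        (hG.comp measurable_fst))).2 (Eventually.of_forall fun u => rfl)
    have hae' := ae_of_ae_map measurable_fst.aemeasurable hae
    filter_upwards [hae'] with q hq
    simp only [id, Function.comp, ← hq]
  have hfin : ∀ π : Measure ((ℝ × ℝ) × ℝ), π.fst = quantileLift μ → IsFiniteMeasure π := by
    intro π hπ
    refine ⟨?_⟩
    rw [← Measure.fst_univ, hπ, quantileLift_eq_map hGq]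
    exact measure_lt_top _ _
  have := hfin π h.1
  rw [hrep π h.1, hrep π' h'.1]
  congr 1
  have happly : ∀ (π : Measure ((ℝ × ℝ) × ℝ)) (s B : Set ℝ), MeasurableSet s → MeasurableSet B →
      (π.map fun q => (q.1.1, q.2)) (s ×ˢ B) = π ((s ×ˢ univ) ×ˢ B) := by
    intro π s B hs hB
    rw [Measure.map_apply (by fun_prop) (hs.prod hB)]
    congr 1
    ext q
    simp
  have hcarrier : ∀ π : Measure ((ℝ × ℝ) × ℝ), π.fst = quantileLift μ →
      ∀ᵐ q ∂π, q.1.1 ∈ Ioo (0 : ℝ) 1 := by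
    intro π hπ
    have hae : ∀ᵐ p ∂π.fst, p.1 ∈ Ioo (0 : ℝ) 1 := by
      rw [hπ, quantileLift_eq_map hGq]
      exact (ae_map_iff (by fun_prop) (measurable_fst measurableSet_Ioo)).2
        (ae_restrict_mem measurableSet_Ioo)
    exact ae_of_ae_map measurable_fst.aemeasurable hae
  refine ext_of_Iic_prod fun a B hB => ?_
  rw [happly π _ B measurableSet_Iic hB, happly π' _ B measurableSet_Iic hB]
  rcases le_or_gt a 0 with ha0 | ha0
  · have hzero : ∀ π : Measure ((ℝ × ℝ) × ℝ), π.fst = quantileLift μ →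
        π ((Iic a ×ˢ univ) ×ˢ B) = 0 := fun π hπ => by
      refine measure_mono_null (fun q hq => ?_) (ae_iff.1 (hcarrier π hπ))
      have : q.1.1 ≤ a := hq.1.1
      exact fun h0 => absurd h0.1 (not_lt.2 (this.trans ha0))
    rw [hzero π h.1, hzero π' h'.1]
  rcases lt_or_ge a 1 with ha1 | ha1
  · have hIcc : ∀ π : Measure ((ℝ × ℝ) × ℝ), π.fst = quantileLift μ →
        π ((Iic a ×ˢ univ) ×ˢ B) = (π.restrict ((Icc 0 a ×ˢ univ) ×ˢ univ)).snd B := fun π hπ => by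
      rw [restrict_prod_univ_snd_apply π _ hB]
      refine measure_congr ?_
      filter_upwards [hcarrier π hπ] with q hq
      refine propext ⟨fun hq' => ⟨⟨⟨hq.1.le, hq'.1.1⟩, trivial⟩, hq'.2⟩,
        fun hq' => ⟨⟨hq'.1.1.2, trivial⟩, hq'.2⟩⟩
    rw [hIcc π h.1, hIcc π' h'.1,
      (h.2.2.2 a ⟨ha0, ha1⟩).2.unique hν (h'.2.2.2 a ⟨ha0, ha1⟩).2]
  · have hB' : ∀ π : Measure ((ℝ × ℝ) × ℝ), π.fst = quantileLift μ → π.snd = ν →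
        π ((Iic a ×ˢ univ) ×ˢ B) = ν B := fun π hπ hπ' => by
      rw [← hπ', Measure.snd_apply hB]
      refine measure_congr ?_
      filter_upwards [hcarrier π hπ] with q hq
      exact propext ⟨fun hq' => hq'.2, fun hq' => ⟨⟨hq.2.le.trans ha1, trivial⟩, hq'⟩⟩
    rw [hB' π h.1 h.2.1, hB' π' h'.1 h'.2.1]

theorem isLeftCurtain_law (hμ : Integrable (fun x : ℝ => x) μ)
    (hν : Integrable (fun x : ℝ => x) ν) (hcx : ConvexOrder μ ν) (hT : Measurable T)
    (hTt : ∀ u ∈ Ioo (0 : ℝ) 1, ∀ v ∈ Ioo (0 : ℝ) 1, T (u, v) = target μ ν u v)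
    (hG : Measurable G) (hGq : ∀ u ∈ Ioo (0 : ℝ) 1, G u = quantile μ u) :
    IsLeftCurtain μ ν ((unitLaw.prod unitLaw).map fun p => (G p.1, T p)) := by
  set π := (unitLaw.prod unitLaw).map fun p => (G p.1, T p) with hπ
  have hΦ : Measurable fun p : ℝ × ℝ => (G p.1, T p) := by fun_prop
  have hfst : π.fst = μ := by
    rw [hπ, Measure.fst_map_prodMk hT, show (fun p : ℝ × ℝ => G p.1) = G ∘ Prod.fst from rfl,
      ← Measure.map_map hG measurable_fst, Measure.map_fst_prod, measure_univ, one_smul,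
      map_quantile_version hGq]
  refine ⟨hfst, ?_, fun B hB => ?_, fun x => ⟨?_, ?_⟩⟩
  · rw [hπ, Measure.snd_map_prodMk (by fun_prop)]
    exact map_target_eq hμ hν hcx hT hTt
  · rw [hπ, setIntegral_map (hB.prod MeasurableSet.univ) (by fun_prop) hΦ.aemeasurable]
    have h1 : (fun p : ℝ × ℝ => (G p.1, T p)) ⁻¹' (B ×ˢ univ) = (G ⁻¹' B) ×ˢ univ := by
      ext p
      simp
    rw [h1, setIntegral_target_prod hμ hν hcx hT hTt]
    conv_rhs => rw [← map_quantile_version hGq]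
    rw [setIntegral_map hB (by fun_prop) hG.aemeasurable]
    refine integral_congr_ae (ae_restrict_of_ae ?_)
    filter_upwards [ae_restrict_mem measurableSet_Ioo] with u hu
    exact (hGq u hu).symm
  · ext s hs
    rw [Measure.fst_apply hs, Measure.restrict_apply (measurable_fst hs), ← prod_univ,
      prod_inter_prod, inter_univ, prod_univ, ← Measure.fst_apply (hs.inter measurableSet_Iic),
      hfst, Measure.restrict_apply hs]
  -- Up to null sets, `G(U) ≤ x` means `U ≤ μ(Iic x)`, so the shadow condition at `x` is the lifted
  -- one at this level. The levels `0` and `1` are treated separately below.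
  · have hset : (unitLaw.prod unitLaw).restrict ((G ⁻¹' Iic x) ×ˢ univ) =
        (unitLaw.prod unitLaw).restrict (Icc 0 (μ.real (Iic x)) ×ˢ univ) := by
      rw [← Measure.prod_restrict, ← Measure.prod_restrict]
      congr 1
      refine Measure.restrict_congr_set ?_
      filter_upwards [ae_restrict_mem measurableSet_Ioo] with u hu
      refine propext ?_
      change G u ≤ x ↔ 0 ≤ u ∧ u ≤ μ.real (Iic x)
      rw [hGq u hu, quantile_le_iff hu]
      exact ⟨fun h => ⟨hu.1.le, h⟩, fun h => h.2⟩
    have h1 : (π.restrict (Iic x ×ˢ univ)).snd =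
        ((unitLaw.prod unitLaw).restrict (Icc 0 (μ.real (Iic x)) ×ˢ univ)).map T := by
      rw [← hset, hπ, Measure.restrict_map hΦ (measurableSet_Iic.prod MeasurableSet.univ),
        Measure.snd, Measure.map_map measurable_snd hΦ, show (fun p : ℝ × ℝ => (G p.1, T p)) ⁻¹'
          (Iic x ×ˢ univ) = (G ⁻¹' Iic x) ×ˢ univ by ext p; simp]
      rfl
    rw [h1]
    have hF0 : 0 ≤ μ.real (Iic x) := measureReal_nonneg
    have hF1 : μ.real (Iic x) ≤ 1 := measureReal_le_one
    rcases eq_or_lt_of_le hF0 with h0 | h0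
    · have hμ0 : μ.restrict (Iic x) = 0 := by
        rw [Measure.restrict_eq_zero]
        exact (measureReal_eq_zero_iff).1 h0.symm
      have hρ0 : (unitLaw.prod unitLaw).restrict (Icc 0 (μ.real (Iic x)) ×ˢ univ) = 0 := by
        rw [Measure.restrict_eq_zero, Measure.prod_prod, ← h0, Icc_self]
        simp [unitLaw]
      rw [hμ0, hρ0, Measure.map_zero]
      exact ⟨Measure.zero_le _, ConvexOrder.refl 0, fun θ h _ => h⟩
    rcases eq_or_lt_of_le hF1 with h1 | h1
    · have hμ1 : μ.restrict (Iic x) = μ := by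
        refine Measure.restrict_eq_self_of_ae_mem ?_
        refine (prob_compl_eq_zero_iff measurableSet_Iic).2 ?_
        rw [← ofReal_measureReal, h1, ENNReal.ofReal_one]
      have hρ1 : (unitLaw.prod unitLaw).restrict (Icc 0 (μ.real (Iic x)) ×ˢ univ) =
          unitLaw.prod unitLaw := by
        rw [h1, ← Measure.prod_restrict, Measure.restrict_univ]
        congr 1
        refine Measure.restrict_eq_self_of_ae_mem ?_
        filter_upwards [ae_restrict_mem measurableSet_Ioo] with u hu
        exact Ioo_subset_Icc_self hu
      rw [hμ1, hρ1, map_target_eq hμ hν hcx hT hTt]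
      refine ⟨le_rfl, hcx, fun θ hθ hle => ?_⟩
      have hfθ : IsFiniteMeasure θ := isFiniteMeasure_of_le ν hle
      have hmass := hθ.real_univ_eq
      -- Below `ν` and, by the convex order, of the same mass.
      have : θ = ν := by
        refine Measure.eq_of_le_of_measure_univ_eq hle ?_
        rw [← ofReal_measureReal, ← hmass, probReal_univ, ENNReal.ofReal_one, measure_univ]
      rw [this]
      exact ConvexOrder.refl ν
    · rw [restrict_Iic_eq_leftPart ⟨h0, h1⟩]
      exact isShadow_target hμ hν hcx hT hTt ⟨h0, h1⟩

theorem IsLeftCurtain.unique (hν : Integrable (fun x : ℝ => x) ν) {π π' : Measure (ℝ × ℝ)}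
    (h : IsLeftCurtain μ ν π) (h' : IsLeftCurtain μ ν π') : π = π' := by
  have : IsFiniteMeasure π := ⟨by rw [← Measure.fst_univ, h.1]; exact measure_lt_top _ _⟩
  refine ext_of_Iic_prod fun a B hB => ?_
  rw [← restrict_prod_univ_snd_apply π _ hB, ← restrict_prod_univ_snd_apply π' _ hB,
    (h.2.2.2 a).2.unique hν (h'.2.2.2 a).2]

end Couplings

end Law

end LeftCurtain

/-! ### The martingale property -/

namespace LeftCurtain

open Filter Topology

section Martingale

variable {μ ν : Measure ℝ} [IsProbabilityMeasure μ] [IsProbabilityMeasure ν]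
  {Ω : Type*} [MeasurableSpace Ω] {P : Measure Ω} [IsProbabilityMeasure P]
  {U V : Ω → Ioo (0 : ℝ) 1}

theorem map_prodMk_eq (hU : Measurable U) (hV : Measurable V)
    (hUlaw : P.map (fun ω => (U ω : ℝ)) = volume.restrict (Ioo (0 : ℝ) 1))
    (hVlaw : P.map (fun ω => (V ω : ℝ)) = volume.restrict (Ioo (0 : ℝ) 1))
    (hUV : IndepFun U V P) :
    P.map (fun ω => ((U ω : ℝ), (V ω : ℝ))) = unitLaw.prod unitLaw := by
  have h := hUV.comp (measurable_subtype_coe (p := (· ∈ Ioo (0 : ℝ) 1)))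
    (measurable_subtype_coe (p := (· ∈ Ioo (0 : ℝ) 1)))
  have h2 := (indepFun_iff_map_prod_eq_prod_map_map
    (measurable_subtype_coe.comp hU).aemeasurable
    (measurable_subtype_coe.comp hV).aemeasurable).1 h
  refine h2.trans ?_
  change (P.map fun ω => (U ω : ℝ)).prod (P.map fun ω => (V ω : ℝ)) = _
  rw [hUlaw, hVlaw]

theorem martingale_curtainProcess (hμ : Integrable (fun x : ℝ => x) μ)
    (hν : Integrable (fun x : ℝ => x) ν) (hcx : ConvexOrder μ ν)
    (hU : Measurable U) (hV : Measurable V)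
    (hlaw : P.map (fun ω => ((U ω : ℝ), (V ω : ℝ))) = unitLaw.prod unitLaw) :
    Martingale (curtainProcess μ ν U V) (twoStepFiltration U V hU hV) P := by
  obtain ⟨G, hG, hGq⟩ := exists_measurable_quantile (μ := μ)
  obtain ⟨T, hT, hTt⟩ := exists_measurable_target hμ hν hcx
  have hW : Measurable fun ω => ((U ω : ℝ), (V ω : ℝ)) :=
    (measurable_subtype_coe.comp hU).prodMk (measurable_subtype_coe.comp hV)
  have hX : (fun ω => quantile μ (U ω)) = (fun p : ℝ × ℝ => G p.1) ∘
      fun ω => ((U ω : ℝ), (V ω : ℝ)) := by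
    ext ω
    exact (hGq _ (U ω).2).symm
  have hY : (fun ω => target μ ν (U ω) (V ω)) = T ∘ fun ω => ((U ω : ℝ), (V ω : ℝ)) := by
    ext ω
    exact (hTt _ (U ω).2 _ (V ω).2).symm
  have hGint : Integrable (fun p : ℝ × ℝ => G p.1) (unitLaw.prod unitLaw) :=
    Integrable.comp_fst ((integrableOn_quantile hμ).congr_fun
      (fun u hu => (hGq u hu).symm) measurableSet_Ioo) unitLaw
  have hXint : Integrable (fun ω => quantile μ (U ω)) P := by
    rw [hX]
    exact (hlaw ▸ hGint).comp_measurable hW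
  have hYint : Integrable (fun ω => target μ ν (U ω) (V ω)) P := by
    rw [hY]
    exact (hlaw ▸ integrable_target hμ hν hcx hT hTt).comp_measurable hW
  have hset : ∀ A : Set ℝ, MeasurableSet A →
      ∫ ω in (fun ω => (U ω : ℝ)) ⁻¹' A, quantile μ (U ω) ∂P = ∫ u in A, quantile μ u ∂unitLaw := by
    intro A hA
    have h1 := setIntegral_map (μ := P) (f := fun p : ℝ × ℝ => G p.1) (hA.prod MeasurableSet.univ)
      (hG.comp measurable_fst).aestronglyMeasurable hW.aemeasurable
    rw [hlaw, setIntegral_prod _ hGint.integrableOn] at h1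
    have h2 : (fun ω => ((U ω : ℝ), (V ω : ℝ))) ⁻¹' (A ×ˢ univ) = (fun ω => (U ω : ℝ)) ⁻¹' A := by
      ext ω
      simp
    rw [h2] at h1
    rw [show (fun ω => quantile μ (U ω)) = fun ω => G (U ω) from hX, ← h1]
    refine integral_congr_ae (ae_restrict_of_ae ?_)
    filter_upwards [ae_restrict_mem measurableSet_Ioo] with u hu
    simp [hGq u hu]
  have hset' : ∀ A : Set ℝ, MeasurableSet A →
      ∫ ω in (fun ω => (U ω : ℝ)) ⁻¹' A, target μ ν (U ω) (V ω) ∂P =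
        ∫ u in A, quantile μ u ∂unitLaw := by
    intro A hA
    have h1 := setIntegral_map (μ := P) (f := T) (hA.prod MeasurableSet.univ)
      hT.aestronglyMeasurable hW.aemeasurable
    rw [hlaw, setIntegral_target_prod hμ hν hcx hT hTt] at h1
    have h2 : (fun ω => ((U ω : ℝ), (V ω : ℝ))) ⁻¹' (A ×ˢ univ) = (fun ω => (U ω : ℝ)) ⁻¹' A := by
      ext ω
      simp
    rw [h2] at h1
    rw [h1, hY]
    rfl
  have hmeanX : ∫ ω, quantile μ (U ω) ∂P = ∫ x, x ∂μ := by
    have := hset univ MeasurableSet.univ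
    rw [preimage_univ, Measure.restrict_univ, Measure.restrict_univ] at this
    rw [this, integral_id_eq_setIntegral]
  have hmeanY : ∫ ω, target μ ν (U ω) (V ω) ∂P = ∫ x, x ∂μ := by
    have := hset' univ MeasurableSet.univ
    rw [preimage_univ, Measure.restrict_univ, Measure.restrict_univ] at this
    rw [this, integral_id_eq_setIntegral]
  have hXm : StronglyMeasurable[MeasurableSpace.comap U inferInstance]
      fun ω => quantile μ (U ω) :=
    ((measurable_coe_of_monotoneOn (quantile_monotoneOn (μ := μ))).comp
      (comap_measurable U)).stronglyMeasurable
  have hYm : StronglyMeasurable[MeasurableSpace.comap (fun ω => (U ω, V ω)) inferInstance]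
      fun ω => target μ ν (U ω) (V ω) :=
    ((measurable_target hμ hν hcx).comp
      (comap_measurable fun ω => (U ω, V ω))).stronglyMeasurable
  have hXY : P[fun ω => target μ ν (U ω) (V ω) | MeasurableSpace.comap U inferInstance] =ᵐ[P]
      fun ω => quantile μ (U ω) := by
    -- Every event of `σ(U)` is of the form `{U ∈ A}` with `A` Borel in `ℝ`, and there `X` and `Y`
    -- have the same integral by `hset` and `hset'`.
    refine (ae_eq_condExp_of_forall_setIntegral_eq hU.comap_le hYint
      (fun s _ _ => hXint.integrableOn) (fun s hs _ => ?_) hXm.aestronglyMeasurable).symm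
    obtain ⟨t, ht, rfl⟩ := hs
    obtain ⟨A, hA, rfl⟩ := ht
    have := (hset A hA).trans (hset' A hA).symm
    exact this
  have hXX : P[fun ω => quantile μ (U ω) | MeasurableSpace.comap U inferInstance] =
      fun ω => quantile μ (U ω) := condExp_of_stronglyMeasurable hU.comap_le hXm hXint
  have hYY : P[fun ω => target μ ν (U ω) (V ω) |
      MeasurableSpace.comap (fun ω => (U ω, V ω)) inferInstance] =
      fun ω => target μ ν (U ω) (V ω) :=
    condExp_of_stronglyMeasurable (hU.prodMk hV).comap_le hYm hYint
  refine ⟨fun i => ?_, fun i j hij => ?_⟩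
  · fin_cases i
    · exact stronglyMeasurable_const
    · exact hXm
    · exact hYm
  · fin_cases i
    · change P[curtainProcess μ ν U V j | ⊥] =ᵐ[P] fun _ => ∫ x, x ∂μ
      rw [condExp_bot]
      fin_cases j
      · change (fun _ => ∫ _, ∫ x, x ∂μ ∂P) =ᵐ[P] _
        simp
      · exact Eventually.of_forall fun _ => hmeanX
      · exact Eventually.of_forall fun _ => hmeanY
    · fin_cases j
      · exact absurd hij (by decide)
      · exact hXX.eventuallyEq
      · exact hXY
    · fin_cases j
      · exact absurd hij (by decide)
      · exact absurd hij (by decide)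
      · exact hYY.eventuallyEq

end Martingale

end LeftCurtain

/-! ### The theorem, transferred from the unit square to `Ω` -/

open LeftCurtain in
theorem theorem6p9
    (μ ν : Measure ℝ) [IsProbabilityMeasure μ] [IsProbabilityMeasure ν]
    (hμ : Integrable (fun x : ℝ => x) μ) (hν : Integrable (fun x : ℝ => x) ν)
    (hcx : ConvexOrder μ ν)
    {Ω : Type*} [MeasurableSpace Ω] (P : Measure Ω) [IsProbabilityMeasure P]
    (U V : Ω → Ioo (0 : ℝ) 1) (hU : Measurable U) (hV : Measurable V)
    (hUlaw : P.map (fun ω => (U ω : ℝ)) = volume.restrict (Ioo (0 : ℝ) 1))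
    (hVlaw : P.map (fun ω => (V ω : ℝ)) = volume.restrict (Ioo (0 : ℝ) 1))
    (hUV : IndepFun U V P) :
    -- `S(u)` is a real number for all `u`
    (∀ u ∈ Ioo (0 : ℝ) 1, (upperSet μ ν u).Nonempty) ∧
    -- in the irreducible case `R(u)` is a real number for all `u`
    ((OrdConnected {k : ℝ | 0 < potDiff μ ν k} ∧ μ {k : ℝ | 0 < potDiff μ ν k} = 1) →
      lowerDomain μ ν = Ioo (0 : ℝ) 1) ∧
    -- in general mass starting at `G(u)` does not move if `R(u)` is not real
    {u ∈ Ioo (0 : ℝ) 1 \ lowerDomain μ ν | upperFn μ ν u ≠ quantile μ u}.Countable ∧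
    -- left-monotonicity
    LeftMonotoneOn (quantile μ) (lowerFn μ ν) (upperFn μ ν) (lowerDomain μ ν) ∧
    -- the martingale and its marginal laws
    Martingale (curtainProcess μ ν U V) (twoStepFiltration U V hU hV) P ∧
    P.map (fun ω => quantile μ (U ω)) = μ ∧
    P.map (fun ω => target μ ν (U ω) (V ω)) = ν ∧
    -- the law of `((U, X), Y)` is the lifted left-curtain coupling
    (∀ π : Measure ((ℝ × ℝ) × ℝ), IsLiftedLeftCurtain μ ν π ↔
      π = P.map (fun ω => (((U ω : ℝ), quantile μ (U ω)), target μ ν (U ω) (V ω)))) ∧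
    -- the law of `(X, Y)` is the left-curtain coupling
    (∀ π : Measure (ℝ × ℝ), IsLeftCurtain μ ν π ↔
      π = P.map (fun ω => (quantile μ (U ω), target μ ν (U ω) (V ω)))) := by

  have hlaw := map_prodMk_eq hU hV hUlaw hVlaw hUV
  obtain ⟨G, hG, hGq⟩ := exists_measurable_quantile (μ := μ)
  obtain ⟨T, hT, hTt⟩ := exists_measurable_target hμ hν hcx
  have hW : Measurable fun ω => ((U ω : ℝ), (V ω : ℝ)) :=
    (measurable_subtype_coe.comp hU).prodMk (measurable_subtype_coe.comp hV)
  have hX : ∀ ω, quantile μ (U ω) = G (U ω) := fun ω => (hGq _ (U ω).2).symm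
  have hY : ∀ ω, target μ ν (U ω) (V ω) = T ((U ω : ℝ), (V ω : ℝ)) :=
    fun ω => (hTt _ (U ω).2 _ (V ω).2).symm
  have hlift : P.map (fun ω => (((U ω : ℝ), quantile μ (U ω)), target μ ν (U ω) (V ω))) =
      (unitLaw.prod unitLaw).map fun p => ((p.1, G p.1), T p) := by
    rw [← hlaw, Measure.map_map (by fun_prop) hW]
    simp only [hX, hY]
    rfl
  have hcurtain : P.map (fun ω => (quantile μ (U ω), target μ ν (U ω) (V ω))) =
      (unitLaw.prod unitLaw).map fun p => (G p.1, T p) := by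
    rw [← hlaw, Measure.map_map (by fun_prop) hW]
    simp only [hX, hY]
    rfl
  have hL := isLiftedLeftCurtain_law hμ hν hcx hT hTt hG hGq
  have hC := isLeftCurtain_law hμ hν hcx hT hTt hG hGq
  refine ⟨fun u hu => ⟨_, (excessShape hμ hν hcx hu).upper_mem⟩,
    fun h => lowerDomain_eq_of_irreducible hμ hν hcx h.1 h.2,
    countable_notMem_lowerDomain hμ hν hcx, leftMonotoneOn hμ hν hcx,
    martingale_curtainProcess hμ hν hcx hU hV hlaw, ?_, ?_, fun π => ?_, fun π => ?_⟩
  · simp only [hX]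
    rw [← map_quantile_version hGq, unitLaw, ← hUlaw, Measure.map_map hG hU.subtype_val]
    rfl
  · simp only [hY]
    rw [← map_target_eq hμ hν hcx hT hTt, ← hlaw, Measure.map_map hT hW]
    rfl
  · rw [hlift]
    exact ⟨fun h => h.unique hν hL, fun h => h ▸ hL⟩
  · rw [hcurtain]
    exact ⟨fun h => h.unique hν hC, fun h => h ▸ hC⟩
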